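/- Let $U\subseteq\mathbb R^4$ be an open coordinate domain, $\kappa>0$, $\alpha\in\mathbb R\setminus\{0\}$, $I\subseteq\mathbb R$ open and $f\colon I\to\mathbb R$ smooth. Consider smooth pairs $(g,\Gamma)$ on $U$, where $g$ is a metric of signature $(-,+,+,+)$ and $\Gamma^\lambda{}_{\mu\nu}$ an arbitrary affine connection, with $$R^\mu{}_{\nu\alpha\beta}=2\partial_{[\alpha}\Gamma^\mu{}_{|\nu|\beta]}+2\Gamma^\mu{}_{\rho[\alpha}\Gamma^\rho{}_{|\nu|\beta]},\quad R=g^{\mu\nu}R^\rho{}_{\mu\rho\nu},\quad S_{\mu\nu}{}^\rho=\Gamma^\rho{}_{[\mu\nu]},\quad Q_{\lambda\mu\nu}=-\nabla_\lambda g_{\mu\nu},$$ $\varepsilon^{\mu\nu\alpha\beta}=\epsilon^{\mu\nu\alpha\beta}/\sqrt{-g}$ (with $\epsilon^{0123}=1$), $Q_\lambda=Q_{\lambda\mu}{}^\mu$, $\tilde Q_\nu=Q^\mu{}_{\mu\nu}$, $S_\lambda=S_{\lambda\sigma}{}^\sigma$, $\tilde S^\rho=\varepsilon^{\rho\alpha\beta\gamma}S_{\alpha\beta\gamma}$.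 Let $\Omega_{\lambda\mu\nu}$ be the traceless part of $Q_{\lambda\mu\nu}$, and $Z_{\lambda\mu}{}^\nu$ the part of $S_{\lambda\mu}{}^\nu$ left after removing its trace part (built from $S_\lambda$) and its totally antisymmetric part (built from $\tilde S^\rho$). Tildes on $\tilde\Gamma$, $\tilde R$ denote Levi-Civita quantities of $g$. A pair $(g,\Gamma)$ with $R(U)\subseteq I$ is called a solution of the metric-affine theory if the action $$S[g,\Gamma]=\frac1{2\kappa}\int d^4x\,\sqrt{-g}\,\bigl(f(R)+\alpha\,\varepsilon^{\mu\nu\alpha\beta}R_{\mu\nu\alpha\beta}\bigr)$$ is stationary at $(g,\Gamma)$ under all smooth variations of $g$ and $\Gamma$ that are compactly supported in $U$. (1) For every smooth one-form $\xi$, the projective transformation $\Gamma^\lambda{}_{\mu\nu}\mapsto\Gamma^\lambda{}_{\mu\nu}+\delta^\lambda_\mu\xi_\nu$ leaves $R$ and the Lagrangian density unchanged and maps solutions to solutions. (2) Let $(g,\Gamma)$ be a solution with $f'(R)\neq0$ everywhere on $U$. Then $\Omega_{\lambda\mu\nu}=0$, $Z_{\lambda\mu}{}^\nu=0$ and $Q_{\lambda\mu\nu}=\tilde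 Q_\lambda g_{\mu\nu}$, and there is exactly one projective transformation after which the nonmetricity vanishes; it is smooth. If $\Gamma$ is in this gauge, $Q_{\lambda\mu\nu}=0$, then there is a smooth $\Phi\colon U\to(-\pi/2,\pi/2)$ with $$f'(R)=2\alpha\tan\Phi,\qquad \tilde S_\mu=-3\,\partial_\mu\Phi,\qquad S_\mu=\tfrac38\,\partial_\mu\ln\bigl(f'(R)^2+4\alpha^2\bigr),$$ so that both torsion vectors are exact, and $$\Gamma^\lambda{}_{\mu\nu}=\tilde\Gamma^\lambda{}_{\mu\nu}+\tfrac16\varepsilon^\lambda{}_{\mu\nu\rho}\tilde S^\rho+\tfrac{f'(R)}{12\alpha}\bigl(g_{\mu\nu}\tilde S^\lambda-\delta^\lambda_\nu\tilde S_\mu\bigr).$$ (3) Assume moreover that $f''\neq0$ on $I$ and that $f'$ is injective on $I$; let $\chi\colon f'(I)\to I$ be its inverse and $V(\psi)=f(\chi(\psi))-\psi\,\chi(\psi)$. Consider the metric, torsion-free scalar-tensor theory for $(g,\Psi)$, $\Psi\colon U\to f'(I)$ smooth, with action $$S[g,\Psi]=\frac1{2\kappa}\int d^4x\,\sqrt{-g}\,\Bigl[\Psi\tilde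 R+V(\Psi)+\frac32\,\frac{\Psi}{4\alpha^2+\Psi^2}\,\partial_\mu\Psi\,\partial^\mu\Psi\Bigr],$$ whose solutions are its stationary points under smooth variations of $g$ and $\Psi$ compactly supported in $U$. The two theories are on-shell equivalent: (a) if $(g,\Gamma)$ is a solution of the metric-affine theory with $f'(R)\ne0$ everywhere, then $(g,f'(R))$ is a solution of the scalar-tensor theory; (b) if $(g,\Psi)$ is a solution of the scalar-tensor theory with $\Psi\neq0$ everywhere, then there is a connection $\Gamma$ on $U$ with $Q_{\lambda\mu\nu}=0$ such that $(g,\Gamma)$ is a solution of the metric-affine theory with $f'(R)=\Psi$. It is the only such connection, and every solution $(g,\Gamma')$ of the metric-affine theory with the same $g$ and $f'(R)=\Psi$ arises from it by a smooth projective transformation. (4) Under the assumptions on $f$ in (3), let $g$ be a smooth Lorentzian metric on $U$ and $\Psi\colon U\to f'(I)\setminus\{0\}$ smooth. As $\alpha\to0$, the Lagrangian density of the scalar-tensor theory converges pointwise, and its first variation in every compactly supported direction converges, to that of Brans–Dicke theory $\frac1{2\kappa}\sqrt{-g}\,[\Psi\tilde R+V(\Psi)-\frac{\omega_0}{\Psi}\partial_\mu\Psi\partial^\mu\Psi]$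 with $\omega_0=-\frac32$. -/

import Mathlib

open scoped ContDiff

noncomputable section

namespace MAG

/-! All fields live on an open coordinate domain `U` of `ℝ⁴` with coordinates `x⁰, …, x³`; they are
given by their components, and only their values on `U` matter. -/

/-- Coordinate space. -/
abbrev Pt : Type := Fin 4 → ℝ

/-- Components of a metric: `g x μ ν = g_{μν}(x)`. -/
abbrev MetricField : Type := Pt → Matrix (Fin 4) (Fin 4) ℝ

/-- Components of an affine connection: `Γ x l μ ν = Γ^l_{μν}(x)`, with
`∇_ν v^l = ∂_ν v^l + Γ^l_{μν} v^μ`. -/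
abbrev ConnField : Type := Pt → Fin 4 → Fin 4 → Fin 4 → ℝ

/-- Components of a one-form. -/
abbrev OneForm : Type := Pt → Fin 4 → ℝ

/-- Partial derivative `∂_μ F (x)`. -/
def pd (μ : Fin 4) (F : Pt → ℝ) (x : Pt) : ℝ := fderiv ℝ F x (Pi.single μ 1)

/-- The Minkowski matrix `diag(-1, 1, 1, 1)`. -/
def minkowski : Matrix (Fin 4) (Fin 4) ℝ := Matrix.diagonal ![-1, 1, 1, 1]

/-- `g` is a smooth metric on `U`, symmetric and of signature `(-,+,+,+)` at each point. -/
structure IsLorentzMetric (U : Set Pt) (g : MetricField) : Prop where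
  smooth : ∀ μ ν, ContDiffOn ℝ ∞ (fun x => g x μ ν) U
  signature : ∀ x ∈ U, ∃ P : Matrix (Fin 4) (Fin 4) ℝ,
    P.det ≠ 0 ∧ g x = P.transpose * minkowski * P

/-- `Γ` is smooth on `U`. -/
def SmoothConn (U : Set Pt) (Γ : ConnField) : Prop :=
  ∀ l μ ν, ContDiffOn ℝ ∞ (fun x => Γ x l μ ν) U

/-- `ξ` is smooth on `U`. -/
def SmoothForm (U : Set Pt) (ξ : OneForm) : Prop :=
  ∀ μ, ContDiffOn ℝ ∞ (fun x => ξ x μ) U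

/-- The inverse metric `g^{μν}`. -/
def ginv (g : MetricField) (x : Pt) (μ ν : Fin 4) : ℝ := (g x)⁻¹ μ ν

/-- The volume density `√(-g)`. -/
def vol (g : MetricField) (x : Pt) : ℝ := Real.sqrt (-(g x).det)

/-- The Levi-Civita symbol: the sign of `(a,b,c,d)` as a permutation of `(0,1,2,3)`, and `0` if an
index is repeated. -/
def symb (a b c d : Fin 4) : ℝ :=
  Matrix.det (Matrix.of fun i j : Fin 4 => if ![a, b, c, d] i = j then (1 : ℝ) else 0)

/-- The Levi-Civita tensor `ε^{abcd}`, the symbol divided by `√(-g)`. -/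
def epsUp (g : MetricField) (x : Pt) (a b c d : Fin 4) : ℝ := symb a b c d / vol g x

/-- `ε_{abcd}`: all indices lowered with `g`. -/
def epsLow (g : MetricField) (x : Pt) (a b c d : Fin 4) : ℝ :=
  ∑ i, ∑ j, ∑ k, ∑ l, g x a i * g x b j * g x c k * g x d l * epsUp g x i j k l

/-- The Levi-Civita connection of `g`. -/
def leviCivita (g : MetricField) : ConnField := fun x l μ ν =>
  (1 / 2) * ∑ r, ginv g x r l *
    (pd μ (fun y => g y ν r) x + pd ν (fun y => g y r μ) x - pd r (fun y => g y μ ν) x)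

/-- The Riemann tensor `R^μ_{ναβ}` of an affine connection. -/
def riem (Γ : ConnField) (x : Pt) (μ ν a b : Fin 4) : ℝ :=
  pd a (fun y => Γ y μ ν b) x - pd b (fun y => Γ y μ ν a) x
    + ∑ r, (Γ x μ r a * Γ x r ν b - Γ x μ r b * Γ x r ν a)

/-- The Ricci tensor `R_{μν} = R^ρ_{μρν}`. -/
def ricci (Γ : ConnField) (x : Pt) (μ ν : Fin 4) : ℝ := ∑ r, riem Γ x r μ r ν

/-- The scalar curvature `R = g^{μν} R_{μν}(Γ)`. -/
def scal (g : MetricField) (Γ : ConnField) (x : Pt) : ℝ :=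
  ∑ μ, ∑ ν, ginv g x μ ν * ricci Γ x μ ν

/-- The Riemannian scalar curvature, that of the Levi-Civita connection. -/
def scalLC (g : MetricField) (x : Pt) : ℝ := scal g (leviCivita g) x

/-- The Holst term `ε^{μναβ} R_{μναβ}`. -/
def holst (g : MetricField) (Γ : ConnField) (x : Pt) : ℝ :=
  ∑ μ, ∑ ν, ∑ a, ∑ b, epsUp g x μ ν a b * ∑ r, g x μ r * riem Γ x r ν a b

/-- The torsion `S_{μν}^ρ = Γ^ρ_{[μν]}`. -/
def tors (Γ : ConnField) (x : Pt) (μ ν r : Fin 4) : ℝ := (Γ x r μ ν - Γ x r ν μ) / 2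

/-- The nonmetricity `Q_{lμν} = -∇_l g_{μν}`. -/
def nonmet (g : MetricField) (Γ : ConnField) (x : Pt) (l μ ν : Fin 4) : ℝ :=
  -pd l (fun y => g y μ ν) x + ∑ r, (Γ x r μ l * g x r ν + Γ x r ν l * g x μ r)

/-- `Q_l = Q_{lμ}^μ`. -/
def weylVec (g : MetricField) (Γ : ConnField) (x : Pt) (l : Fin 4) : ℝ :=
  ∑ μ, ∑ ν, ginv g x μ ν * nonmet g Γ x l μ ν

/-- The second nonmetricity vector `Q^μ_{μν}`. -/
def secondVec (g : MetricField) (Γ : ConnField) (x : Pt) (ν : Fin 4) : ℝ :=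
  ∑ l, ∑ μ, ginv g x l μ * nonmet g Γ x l μ ν

/-- The torsion vector `S_l = S_{lσ}^σ`. -/
def torsVec (Γ : ConnField) (x : Pt) (l : Fin 4) : ℝ := ∑ s, tors Γ x l s s

/-- The torsion pseudo-vector `ε^{ραβγ} S_{αβγ}`, index up. -/
def pseudoUp (g : MetricField) (Γ : ConnField) (x : Pt) (r : Fin 4) : ℝ :=
  ∑ a, ∑ b, ∑ c, epsUp g x r a b c * ∑ s, tors Γ x a b s * g x s c

/-- The torsion pseudo-vector, index down. -/
def pseudoLow (g : MetricField) (Γ : ConnField) (x : Pt) (m : Fin 4) : ℝ :=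
  ∑ r, g x m r * pseudoUp g Γ x r

/-- The traceless part `Ω_{lμν}` of the nonmetricity. -/
def nonmetTraceless (g : MetricField) (Γ : ConnField) (x : Pt) (l μ ν : Fin 4) : ℝ :=
  nonmet g Γ x l μ ν -
    ((5 / 18) * weylVec g Γ x l * g x μ ν - (1 / 9) * secondVec g Γ x l * g x μ ν
      + (4 / 9) * ((g x l ν * secondVec g Γ x μ + g x l μ * secondVec g Γ x ν) / 2)
      - (1 / 9) * ((g x l ν * weylVec g Γ x μ + g x l μ * weylVec g Γ x ν) / 2))

/-- The traceless part `Z_{lμ}^ν` of the torsion: both the trace and the totally antisymmetric part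
are removed. -/
def torsTraceless (g : MetricField) (Γ : ConnField) (x : Pt) (l μ ν : Fin 4) : ℝ :=
  tors Γ x l μ ν -
    ((2 / 3) * (((if μ = ν then 1 else 0) * torsVec Γ x l
        - (if l = ν then 1 else 0) * torsVec Γ x μ) / 2)
      + (1 / 6) * ∑ k, ∑ r, epsLow g x l μ k r * ginv g x k ν * pseudoUp g Γ x r)

/-- `Γ` is compatible with `g` on `U`: the nonmetricity vanishes. -/
def MetricCompatible (U : Set Pt) (g : MetricField) (Γ : ConnField) : Prop :=
  ∀ x ∈ U, ∀ l μ ν, nonmet g Γ x l μ ν = 0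

/-- The projective transformation `Γ^l_{μν} ↦ Γ^l_{μν} + δ^l_μ ξ_ν`. -/
def projective (Γ : ConnField) (ξ : OneForm) : ConnField := fun x l μ ν =>
  Γ x l μ ν + (if l = μ then 1 else 0) * ξ x ν

/-- `g^{μν} ∂_μ Ψ ∂_ν Ψ`. -/
def gradSq (g : MetricField) (Ψ : Pt → ℝ) (x : Pt) : ℝ :=
  ∑ μ, ∑ ν, ginv g x μ ν * pd μ Ψ x * pd ν Ψ x

/-- Lagrangian density of metric-affine `f(R)` gravity with Holst term. -/
def lagMAG (κ α : ℝ) (f : ℝ → ℝ) (g : MetricField) (Γ : ConnField) (x : Pt) : ℝ :=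
  1 / (2 * κ) * (vol g x * (f (scal g Γ x) + α * holst g Γ x))

/-- Lagrangian density of the metric, torsion-free scalar-tensor theory. -/
def lagST (κ α : ℝ) (V : ℝ → ℝ) (g : MetricField) (Ψ : Pt → ℝ) (x : Pt) : ℝ :=
  1 / (2 * κ) * (vol g x * (Ψ x * scalLC g x + V (Ψ x)
    + (3 / 2) * (Ψ x / (4 * α ^ 2 + Ψ x ^ 2)) * gradSq g Ψ x))

/-- Lagrangian density of Brans-Dicke theory with parameter `ω₀` and potential `V`. -/
def lagBD (κ ω₀ : ℝ) (V : ℝ → ℝ) (g : MetricField) (Ψ : Pt → ℝ) (x : Pt) : ℝ :=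
  1 / (2 * κ) * (vol g x * (Ψ x * scalLC g x + V (Ψ x) - ω₀ / Ψ x * gradSq g Ψ x))

/-- The potential `V(ψ) = f(χ(ψ)) - ψ χ(ψ)`, where `χ` inverts `f'` on `I`. -/
def potential (f : ℝ → ℝ) (I : Set ℝ) (ψ : ℝ) : ℝ :=
  f (Function.invFunOn (deriv f) I ψ) - ψ * Function.invFunOn (deriv f) I ψ

/-- Smooth functions with compact support inside `U`. -/
def IsTest (U : Set Pt) (φ : Pt → ℝ) : Prop :=
  ContDiff ℝ ∞ φ ∧ HasCompactSupport φ ∧ tsupport φ ⊆ U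

/-- Admissible variations of the metric: symmetric, smooth, compactly supported in `U`. -/
def IsMetricVar (U : Set Pt) (h : MetricField) : Prop :=
  (∀ x, (h x).IsSymm) ∧ ∀ μ ν, IsTest U (fun x => h x μ ν)

/-- Admissible variations of the connection. -/
def IsConnVar (U : Set Pt) (γ : ConnField) : Prop :=
  ∀ l μ ν, IsTest U (fun x => γ x l μ ν)

/-- For a one-parameter family `L t` of Lagrangian densities that differ only on a compact subset of
`U`: the action changes at rate `v` at `t = 0`. -/
def HasFirstVariation (U : Set Pt) (L : ℝ → Pt → ℝ) (v : ℝ) : Prop :=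
  HasDerivAt (fun t => ∫ x in U, (L t x - L 0 x)) v 0

/-- `(g, Γ)` is on shell for metric-affine `f(R)` gravity with Holst term: `g` and `Γ` are smooth
fields with scalar curvature in the domain `I` of `f`, and the action is stationary under independent
compactly supported variations of the metric and of the connection. -/
structure IsMAGSolution (U : Set Pt) (κ α : ℝ) (f : ℝ → ℝ) (I : Set ℝ)
    (g : MetricField) (Γ : ConnField) : Prop where
  metric : IsLorentzMetric U g
  conn : SmoothConn U Γ
  range : ∀ x ∈ U, scal g Γ x ∈ I
  stationary : ∀ h γ, IsMetricVar U h → IsConnVar U γ →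
    HasFirstVariation U (fun t => lagMAG κ α f (g + t • h) (Γ + t • γ)) 0

/-- `(g, Ψ)` is on shell for the scalar-tensor theory, with `Ψ` taking values in the domain `J` of
the potential. -/
structure IsSTSolution (U : Set Pt) (κ α : ℝ) (V : ℝ → ℝ) (J : Set ℝ)
    (g : MetricField) (Ψ : Pt → ℝ) : Prop where
  metric : IsLorentzMetric U g
  scalar : ContDiffOn ℝ ∞ Ψ U
  range : ∀ x ∈ U, Ψ x ∈ J
  stationary : ∀ h ψ, IsMetricVar U h → IsTest U ψ →
    HasFirstVariation U (fun t => lagST κ α V (g + t • h) (Ψ + t • ψ)) 0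

end MAG

end

noncomputable section

namespace MAG

/-! ### The Levi-Civita symbol -/

/-! Freeze Ψ = f'(R) and W = f(R) − ΨR at the fields in question. By the chain rule the f(R) action
then has the same first variation as the first-order density `lagFirst`, √−g (ΨR + W + α εR)
(`deriv_lagMAG`). This density is linear in the curvature, hence at most quadratic in the
connection. Write Γ as the Levi-Civita connection plus a tensor M. Up to a divergence there remain
the Riemannian part (its Holst term vanishes by the Bianchi identity), a term linear in M with
coefficient dΨ, and an algebraic quadratic form in M, `pairing` (`lagFirst_add`).

Now complete the square. The Euler equation of this quadratic function of M is solved by an explicit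
contortion proportional to dΨ, the sum of an ε part and a vector part (`bracket_contortion`,
`pairing_contortion`). Added to the Levi-Civita connection it gives the metric-compatible connection
`scalarConn α g Ψ`. With D = Γ − `scalarConn α g Ψ`, the first-order density equals the
scalar-tensor density plus a divergence plus the pairing of D with itself
(`lagFirst_eq_scalarTensor`); the kinetic term of the scalar is the critical value of the quadratic
function.

The claims follow from this identity. The connection equation says that the gradient of the
quadratic form vanishes at D. This is a linear system for the 64 components of D, and for Ψ ≠ 0 its
kernel consists of the projective shifts (`kernel_lorentz`): in an orthonormal frame it splits into
four blocks, and the elimination in each only divides by F, F² + q² and F² + 9q². So every solution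
is a projective transform of `scalarConn`, and torsion and nonmetricity can be read off.

For the equivalence, the square has no first variation at D = 0 and projective shifts change no
density, so the metric variations of the two actions agree. The Ψ-equation of the scalar-tensor
theory says R = χ(Ψ), because V is a Legendre transform with V' = −χ. Finally, Brans–Dicke theory is
the member α = 0 of the scalar-tensor family, which is smooth in α where Ψ ≠ 0, so the limits are
continuity at 0. -/

/-- The Levi-Civita symbol as an integer, in a form that can be evaluated. -/
def symbInt (a b c d : Fin 4) : ℤ :=
  Int.sign ((b : ℤ) - a) * Int.sign ((c : ℤ) - a) * Int.sign ((d : ℤ) - a) * Int.sign ((c : ℤ) - b)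
    * Int.sign ((d : ℤ) - b) * Int.sign ((d : ℤ) - c)

/-- Determinants over ℝ cannot be evaluated by `decide`. The same determinant over ℤ can, in all 256
cases, and the ring homomorphism ℤ → ℝ carries the result over. -/
theorem symb_eq_symbInt (a b c d : Fin 4) : symb a b c d = symbInt a b c d := by
  have key : ∀ a b c d : Fin 4,
      Matrix.det (Matrix.of fun i j : Fin 4 => if ![a, b, c, d] i = j then (1 : ℤ) else 0)
        = symbInt a b c d := by
    intro a b c d
    simp only [Matrix.det_succ_row_zero, Fin.sum_univ_succ, Matrix.det_fin_zero]
    simp [Fin.succAbove]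
    revert a b c d
    decide +kernel
  rw [← key]
  have := (Int.castRingHom ℝ).map_det
    (Matrix.of fun i j : Fin 4 => if ![a, b, c, d] i = j then (1 : ℤ) else 0)
  rw [eq_intCast] at this
  rw [this, symb]
  congr 1
  ext i j
  simp only [RingHom.mapMatrix_apply, Matrix.map_apply, Matrix.of_apply]
  split_ifs <;> simp

theorem symb_swap₁₂ (a b c d : Fin 4) : symb b a c d = -symb a b c d := by
  have key : ∀ a b c d : Fin 4, symbInt b a c d = -symbInt a b c d := by decide +kernel
  simp only [symb_eq_symbInt]
  exact_mod_cast key a b c d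

theorem symb_swap₂₃ (a b c d : Fin 4) : symb a c b d = -symb a b c d := by
  have key : ∀ a b c d : Fin 4, symbInt a c b d = -symbInt a b c d := by decide +kernel
  simp only [symb_eq_symbInt]
  exact_mod_cast key a b c d

theorem symb_swap₃₄ (a b c d : Fin 4) : symb a b d c = -symb a b c d := by
  have key : ∀ a b c d : Fin 4, symbInt a b d c = -symbInt a b c d := by decide +kernel
  simp only [symb_eq_symbInt]
  exact_mod_cast key a b c d

theorem symb_swap₁₃ (a b c d : Fin 4) : symb c b a d = -symb a b c d := by
  rw [symb_swap₁₂ b c, symb_swap₂₃ b a, symb_swap₁₂ a b, neg_neg]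

/-- This and the next two contractions occur below in exactly these index orders; each is a finite
check on `symbInt`. -/
theorem symb_contract_two (n b k l : Fin 4) : ∑ m, ∑ a, symb m n a b * symb m k a l =
    2 * ((if n = k then 1 else 0) * (if b = l then 1 else 0)
      - (if n = l then 1 else 0) * (if b = k then 1 else 0)) := by
  have key : ∀ n b k l : Fin 4, ∑ m, ∑ a, symbInt m n a b * symbInt m k a l =
    2 * ((if n = k then 1 else 0) * (if b = l then 1 else 0)
      - (if n = l then 1 else 0) * (if b = k then 1 else 0)) := by decide +kernel
  simp only [symb_eq_symbInt]
  exact_mod_cast key n b k l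

theorem symb_contract_two_mid (m b j k : Fin 4) : ∑ r, ∑ a, symb m r b a * symb j r a k =
    -2 * ((if j = m then 1 else 0) * (if b = k then 1 else 0)
      - (if k = m then 1 else 0) * (if j = b then 1 else 0)) := by
  have key : ∀ m b j k : Fin 4, ∑ r, ∑ a, symbInt m r b a * symbInt j r a k =
    -2 * ((if j = m then 1 else 0) * (if b = k then 1 else 0)
      - (if k = m then 1 else 0) * (if j = b then 1 else 0)) := by decide +kernel
  simp only [symb_eq_symbInt]
  exact_mod_cast key m b j k

/-- The sign comes from the position of k: rotating c behind a, b is even, moving k from the last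
place to the first is odd. The 6 counts the orderings of three indices. -/
theorem symb_contract_three (r k : Fin 4) : ∑ a, ∑ b, ∑ c, symb r a b c * symb c a b k =
    -6 * (if r = k then 1 else 0) := by
  have key : ∀ r k : Fin 4, ∑ a, ∑ b, ∑ c, symbInt r a b c * symbInt c a b k =
    -6 * (if r = k then 1 else 0) := by decide +kernel
  simp only [symb_eq_symbInt]
  exact_mod_cast key r k

theorem symb_eq_sum_perm (i j k l : Fin 4) :
    symb i j k l = ∑ s : Equiv.Perm (Fin 4), (Equiv.Perm.sign s : ℝ) *
      ((if i = s 0 then 1 else 0) * (if j = s 1 then 1 else 0) * (if k = s 2 then 1 else 0)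
        * (if l = s 3 then 1 else 0)) := by
  unfold symb
  rw [← Matrix.det_transpose, Matrix.det_apply']
  refine Finset.sum_congr rfl fun s _ => ?_
  rw [Fin.prod_univ_four]
  rfl

/-- Both sides are the determinant of the matrix whose rows are the rows a, b, c, d of G: the left
by the Leibniz formula, the right because that matrix is a 0-1 matrix times G. For a metric this
lowers all four indices of the symbol. -/
theorem sum_rows_mul_symb (G : Matrix (Fin 4) (Fin 4) ℝ) (a b c d : Fin 4) :
    ∑ i, ∑ j, ∑ k, ∑ l, G a i * G b j * G c k * G d l * symb i j k l
      = G.det * symb a b c d := by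
  have h1 : symb a b c d * G.det = Matrix.det (Matrix.of ![G a, G b, G c, G d]) := by
    unfold symb
    rw [← Matrix.det_mul]
    congr 1
    ext i j
    simp only [Matrix.mul_apply, Matrix.of_apply, ite_mul, one_mul, zero_mul, Finset.sum_ite_eq,
      Finset.mem_univ, if_true]
    fin_cases i <;> rfl
  rw [mul_comm, h1]
  simp only [symb_eq_sum_perm, Finset.mul_sum]
  rw [← Matrix.det_transpose, Matrix.det_apply']
  simp only [Finset.sum_comm (s := (Finset.univ : Finset (Fin 4)))
    (t := (Finset.univ : Finset (Equiv.Perm (Fin 4))))]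
  refine Finset.sum_congr rfl fun s _ => ?_
  simp only [mul_ite, mul_one, mul_zero, Finset.sum_ite_eq', Finset.mem_univ, if_true,
    Fin.prod_univ_four]
  simp
  ring

/-- The contraction of an antisymmetric with a symmetric array vanishes. -/
theorem sum_antisymm_mul_symm (A S : Fin 4 → Fin 4 → ℝ) (hA : ∀ i j, A j i = -A i j)
    (hS : ∀ i j, S j i = S i j) : ∑ i, ∑ j, A i j * S i j = 0 := by
  have h : ∑ i, ∑ j, A i j * S i j = -∑ i, ∑ j, A i j * S i j := by
    conv_lhs => rw [Finset.sum_comm]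
    rw [← Finset.sum_neg_distrib]
    refine Finset.sum_congr rfl fun i _ => ?_
    rw [← Finset.sum_neg_distrib]
    refine Finset.sum_congr rfl fun j _ => ?_
    rw [hA, hS]; ring
  linarith

theorem sum_rotate₅ (f : Fin 4 → Fin 4 → Fin 4 → Fin 4 → Fin 4 → ℝ) :
    ∑ k, ∑ i, ∑ j, ∑ c, ∑ l, f i j c l k = ∑ i, ∑ j, ∑ c, ∑ l, ∑ k, f i j c l k := by
  rw [Finset.sum_comm]
  refine Finset.sum_congr rfl fun i _ => ?_
  rw [Finset.sum_comm]
  refine Finset.sum_congr rfl fun j _ => ?_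
  rw [Finset.sum_comm]
  refine Finset.sum_congr rfl fun c _ => ?_
  rw [Finset.sum_comm]

/-! ### Pointwise algebra of the connection equation

`G` and `Gi` are the components of the metric and of its inverse at a point, `v` is the volume
density, `F` the value of the scalar field and `w` a covector. -/

/-- The derivative of the Lagrangian density `v (F R + α ε R)` with respect to the curvature
`R^μ_{νab}`, doubled. -/
def momentum (G Gi : Matrix (Fin 4) (Fin 4) ℝ) (v F α : ℝ) (μ ν a b : Fin 4) : ℝ :=
  v * F * ((if μ = a then 1 else 0) * Gi ν b - (if μ = b then 1 else 0) * Gi ν a)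
    + 2 * α * ∑ m, G m μ * symb m ν a b

theorem momentum_antisymm (G Gi : Matrix (Fin 4) (Fin 4) ℝ) (v F α : ℝ) (μ ν a b : Fin 4) :
    momentum G Gi v F α μ ν b a = -momentum G Gi v F α μ ν a b := by
  simp only [momentum, symb_swap₃₄ _ _ a b, mul_neg, Finset.sum_neg_distrib]
  ring

/-- The part of the curvature term quadratic in the connection, polarized. -/
def pairing (P : Fin 4 → Fin 4 → Fin 4 → Fin 4 → ℝ) (M N : Fin 4 → Fin 4 → Fin 4 → ℝ) : ℝ :=
  ∑ μ, ∑ ν, ∑ a, ∑ b, ∑ r, P μ ν a b * (M μ r a * N r ν b)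

/-- The coefficients of the symmetrized pairing with a fixed array `N`. -/
def bracket (P : Fin 4 → Fin 4 → Fin 4 → Fin 4 → ℝ) (N : Fin 4 → Fin 4 → Fin 4 → ℝ)
    (μ ν b : Fin 4) : ℝ :=
  ∑ r, ∑ a, (P r ν a b * N r μ a + P μ r b a * N ν r a)

/-- Renaming the summation indices collects the coefficient of each component of γ. Thus `bracket P
N` is the gradient at N of the quadratic form `pairing P N N`, and connection equations can be
stated through it. -/
theorem pairing_add_pairing_swap (P : Fin 4 → Fin 4 → Fin 4 → Fin 4 → ℝ)
    (N γ : Fin 4 → Fin 4 → Fin 4 → ℝ) :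
    pairing P N γ + pairing P γ N = ∑ μ, ∑ ν, ∑ b, bracket P N μ ν b * γ μ ν b := by
  have h1 : pairing P N γ = ∑ μ, ∑ ν, ∑ b, ∑ r, ∑ a, P r ν a b * N r μ a * γ μ ν b := by
    unfold pairing
    calc _ = ∑ r, ∑ ν, ∑ a, ∑ b, ∑ μ, P r ν a b * N r μ a * γ μ ν b := by
            simp only [mul_assoc]
      _ = ∑ r, ∑ ν, ∑ a, ∑ μ, ∑ b, P r ν a b * N r μ a * γ μ ν b :=
            Finset.sum_congr rfl fun r _ => Finset.sum_congr rfl fun ν _ =>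
              Finset.sum_congr rfl fun a _ => Finset.sum_comm
      _ = ∑ r, ∑ ν, ∑ μ, ∑ a, ∑ b, P r ν a b * N r μ a * γ μ ν b :=
            Finset.sum_congr rfl fun r _ => Finset.sum_congr rfl fun ν _ => Finset.sum_comm
      _ = ∑ r, ∑ μ, ∑ ν, ∑ a, ∑ b, P r ν a b * N r μ a * γ μ ν b :=
            Finset.sum_congr rfl fun r _ => Finset.sum_comm
      _ = ∑ μ, ∑ r, ∑ ν, ∑ a, ∑ b, P r ν a b * N r μ a * γ μ ν b := Finset.sum_comm
      _ = ∑ μ, ∑ ν, ∑ r, ∑ a, ∑ b, P r ν a b * N r μ a * γ μ ν b :=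
            Finset.sum_congr rfl fun μ _ => Finset.sum_comm
      _ = ∑ μ, ∑ ν, ∑ r, ∑ b, ∑ a, P r ν a b * N r μ a * γ μ ν b :=
            Finset.sum_congr rfl fun μ _ => Finset.sum_congr rfl fun ν _ =>
              Finset.sum_congr rfl fun r _ => Finset.sum_comm
      _ = _ := Finset.sum_congr rfl fun μ _ => Finset.sum_congr rfl fun ν _ => Finset.sum_comm
  have h2 : pairing P γ N = ∑ μ, ∑ ν, ∑ b, ∑ r, ∑ a, P μ r b a * N ν r a * γ μ ν b := by
    unfold pairing
    calc _ = ∑ μ, ∑ r, ∑ b, ∑ a, ∑ ν, P μ r b a * N ν r a * γ μ ν b := by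
            refine Finset.sum_congr rfl fun μ _ => Finset.sum_congr rfl fun r _ =>
              Finset.sum_congr rfl fun b _ => Finset.sum_congr rfl fun a _ =>
              Finset.sum_congr rfl fun ν _ => ?_
            ring
      _ = ∑ μ, ∑ r, ∑ b, ∑ ν, ∑ a, P μ r b a * N ν r a * γ μ ν b :=
            Finset.sum_congr rfl fun μ _ => Finset.sum_congr rfl fun r _ =>
              Finset.sum_congr rfl fun b _ => Finset.sum_comm
      _ = ∑ μ, ∑ r, ∑ ν, ∑ b, ∑ a, P μ r b a * N ν r a * γ μ ν b :=
            Finset.sum_congr rfl fun μ _ => Finset.sum_congr rfl fun r _ => Finset.sum_comm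
      _ = ∑ μ, ∑ ν, ∑ r, ∑ b, ∑ a, P μ r b a * N ν r a * γ μ ν b :=
            Finset.sum_congr rfl fun μ _ => Finset.sum_comm
      _ = _ := Finset.sum_congr rfl fun μ _ => Finset.sum_congr rfl fun ν _ => Finset.sum_comm
  rw [h1, h2]
  simp only [← Finset.sum_add_distrib]
  refine Finset.sum_congr rfl fun μ _ => Finset.sum_congr rfl fun ν _ =>
    Finset.sum_congr rfl fun b _ => ?_
  simp only [bracket, Finset.sum_mul]
  refine Finset.sum_congr rfl fun r _ => Finset.sum_congr rfl fun a _ => ?_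
  ring

/-- Resolving the Kronecker deltas separates the scalar-curvature part, with coefficient v F, from
the Holst part, with coefficient 2 α. The contraction lemmas below evaluate each of the sums on the
right. -/
theorem bracket_momentum (G Gi : Matrix (Fin 4) (Fin 4) ℝ) (v F α : ℝ)
    (N : Fin 4 → Fin 4 → Fin 4 → ℝ) (μ ν b : Fin 4) :
    bracket (momentum G Gi v F α) N μ ν b =
      v * F * (Gi ν b * (∑ a, N a μ a) - ∑ a, Gi ν a * N b μ a
        + (if μ = b then 1 else 0) * (∑ r, ∑ a, Gi r a * N ν r a) - ∑ r, Gi r b * N ν r μ)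
      + 2 * α * ((∑ m, ∑ a, symb m ν a b * ∑ r, G m r * N r μ a)
        + ∑ r, ∑ a, (∑ m, G m μ * symb m r b a) * N ν r a) := by
  have e1 : ∑ r, ∑ a, momentum G Gi v F α r ν a b * N r μ a =
      v * F * (Gi ν b * (∑ a, N a μ a) - ∑ a, Gi ν a * N b μ a)
        + 2 * α * ∑ m, ∑ a, symb m ν a b * ∑ r, G m r * N r μ a := by
    have : ∀ r a, momentum G Gi v F α r ν a b * N r μ a =
        (if r = a then v * F * Gi ν b * N a μ a else 0)
        - (if r = b then v * F * (Gi ν a * N b μ a) else 0)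
        + ∑ m, 2 * α * (symb m ν a b * (G m r * N r μ a)) := by
      intro r a
      have hs : ∑ m, 2 * α * (symb m ν a b * (G m r * N r μ a)) =
          2 * α * (∑ m, G m r * symb m ν a b) * N r μ a := by
        rw [Finset.mul_sum, Finset.sum_mul]
        exact Finset.sum_congr rfl fun m _ => by ring
      rw [hs, momentum]
      split_ifs <;> subst_vars <;> ring
    simp only [this, Finset.sum_add_distrib, Finset.sum_sub_distrib]
    congr 1
    · simp only [Finset.sum_ite_eq, Finset.mem_univ, if_true]
      rw [Finset.sum_comm]
      simp only [Finset.sum_ite_eq', Finset.mem_univ, if_true, mul_sub, Finset.mul_sum, mul_assoc]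
    · simp only [Finset.mul_sum]
      calc _ = ∑ a, ∑ r, ∑ m, 2 * α * (symb m ν a b * (G m r * N r μ a)) := Finset.sum_comm
        _ = ∑ a, ∑ m, ∑ r, 2 * α * (symb m ν a b * (G m r * N r μ a)) :=
            Finset.sum_congr rfl fun a _ => Finset.sum_comm
        _ = _ := Finset.sum_comm
  have e2 : ∑ r, ∑ a, momentum G Gi v F α μ r b a * N ν r a =
      v * F * ((if μ = b then 1 else 0) * (∑ r, ∑ a, Gi r a * N ν r a) - ∑ r, Gi r b * N ν r μ)
        + 2 * α * ∑ r, ∑ a, (∑ m, G m μ * symb m r b a) * N ν r a := by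
    have : ∀ r a, momentum G Gi v F α μ r b a * N ν r a =
        v * F * ((if μ = b then 1 else 0) * (Gi r a * N ν r a))
        - (if μ = a then v * F * (Gi r b * N ν r μ) else 0)
        + 2 * α * ((∑ m, G m μ * symb m r b a) * N ν r a) := by
      intro r a
      rw [momentum]
      by_cases h : μ = a
      · subst h; simp only [if_true]; ring
      · simp only [h, if_false]; ring
    simp only [this, Finset.sum_add_distrib, Finset.sum_sub_distrib, Finset.sum_ite_eq,
      Finset.mem_univ, if_true, mul_sub, Finset.mul_sum]
  simp only [bracket, Finset.sum_add_distrib, e1, e2]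
  ring

/-- The epsilon part of the contortion, `ε^l_{mn}{}^d w_d` up to the volume factor. -/
def axialPart (G : Matrix (Fin 4) (Fin 4) ℝ) (w : Fin 4 → ℝ) (l m n : Fin 4) : ℝ :=
  ∑ c, (∑ b, (∑ d, symb l b c d * w d) * G b m) * G c n

/-- The vector part of the contortion. -/
def vectorPart (G Gi : Matrix (Fin 4) (Fin 4) ℝ) (w : Fin 4 → ℝ) (l m n : Fin 4) : ℝ :=
  G m n * (∑ d, Gi l d * w d) - (if l = n then 1 else 0) * w m

/-! ### Contractions of the axial and vector parts of the contortion -/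

section contractions

variable {G Gi : Matrix (Fin 4) (Fin 4) ℝ} (hG : ∀ i j, G j i = G i j)
  (hGi : ∀ i j, Gi j i = Gi i j) (hinv : ∀ i j, ∑ k, Gi i k * G k j = if i = j then 1 else 0)

include hG hinv in
theorem raise_lower (X : Fin 4 → ℝ) (n : Fin 4) : ∑ a, Gi n a * ∑ c, X c * G c a = X n := by
  simp only [Finset.mul_sum]
  rw [Finset.sum_comm]
  have : ∀ c, ∑ a, Gi n a * (X c * G c a) = X c * ∑ a, Gi n a * G a c := by
    intro c
    rw [Finset.mul_sum]
    exact Finset.sum_congr rfl fun a _ => by rw [hG c a]; ring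
  simp [this, hinv]

include hG hGi hinv in
theorem lower_raise (w : Fin 4 → ℝ) (m : Fin 4) : ∑ c, G m c * ∑ d, Gi c d * w d = w m := by
  simp only [Finset.mul_sum]
  rw [Finset.sum_comm]
  have : ∀ d, ∑ c, G m c * (Gi c d * w d) = w d * ∑ c, Gi d c * G c m := by
    intro d
    rw [Finset.mul_sum]
    exact Finset.sum_congr rfl fun a _ => by rw [hG m a, hGi]; ring
  simp [this, hinv]

theorem dual_swap₂₃ (w : Fin 4 → ℝ) (l b c : Fin 4) :
    ∑ d, symb l c b d * w d = -∑ d, symb l b c d * w d := by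
  simp only [symb_swap₂₃ l b c, neg_mul, Finset.sum_neg_distrib]

theorem dual_swap₁₃ (w : Fin 4 → ℝ) (l b c : Fin 4) :
    ∑ d, symb c b l d * w d = -∑ d, symb l b c d * w d := by
  simp only [symb_swap₁₃ l b c, neg_mul, Finset.sum_neg_distrib]

include hG in
theorem sum_axialPart_trace (w : Fin 4 → ℝ) (m : Fin 4) : ∑ a, axialPart G w a m a = 0 := by
  refine sum_antisymm_mul_symm (fun a c => ∑ b, (∑ d, symb a b c d * w d) * G b m)
    (fun a c => G c a) (fun i j => ?_) (fun i j => (hG _ _))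
  simp only [dual_swap₁₃ w i, neg_mul, Finset.sum_neg_distrib]

include hG hinv in
theorem sum_inv_mul_axialPart_right (w : Fin 4 → ℝ) (ν b μ : Fin 4) :
    ∑ a, Gi ν a * axialPart G w b μ a = ∑ c, (∑ d, symb b c ν d * w d) * G c μ :=
  raise_lower hG hinv (fun c => ∑ b', (∑ d, symb b b' c d * w d) * G b' μ) ν

theorem axialPart_swap (w : Fin 4 → ℝ) (l m n : Fin 4) :
    axialPart G w l n m = -axialPart G w l m n := by
  unfold axialPart
  simp only [Finset.sum_mul _ _ (G _ _)]
  rw [Finset.sum_comm, ← Finset.sum_neg_distrib]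
  refine Finset.sum_congr rfl fun b _ => ?_
  rw [← Finset.sum_neg_distrib]
  refine Finset.sum_congr rfl fun c _ => ?_
  simp only [← Finset.sum_mul]
  rw [dual_swap₂₃ w l b c]
  ring

include hG hGi hinv in
theorem sum_inv_mul_axialPart_left (w : Fin 4 → ℝ) (ν b μ : Fin 4) :
    ∑ r, Gi r b * axialPart G w ν r μ = ∑ c, (∑ d, symb ν b c d * w d) * G c μ := by
  have := sum_inv_mul_axialPart_right hG hinv w b ν μ
  simp only [hGi b, axialPart_swap w ν μ]
  simp only [mul_neg, neg_mul, Finset.sum_neg_distrib, this, dual_swap₂₃ w ν b, neg_neg]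

include hGi in
theorem sum_inv_axialPart (w : Fin 4 → ℝ) (ν : Fin 4) :
    ∑ r, ∑ a, Gi r a * axialPart G w ν r a = 0 := by
  have := sum_antisymm_mul_symm (fun r a => axialPart G w ν r a) (fun r a => Gi r a)
    (fun i j => axialPart_swap w ν i j) (fun i j => hGi i j)
  simpa only [mul_comm] using this

include hG hGi hinv in
-- In `axialPart` two indices of the symbol are already lowered. Lowering the first and writing w as
-- a lowered vector supplies all four factors of G, and `sum_rows_mul_symb` turns them into the
-- determinant.
theorem lower_axialPart (w : Fin 4 → ℝ) (m μ a : Fin 4) :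
    ∑ r, G m r * axialPart G w r μ a = G.det * ∑ k, symb m μ a k * ∑ d, Gi k d * w d := by
  have hr : G.det * ∑ k, symb m μ a k * ∑ d, Gi k d * w d =
      ∑ k, ∑ i, ∑ j, ∑ c, ∑ l,
        G m i * G μ j * G a c * G k l * symb i j c l * ∑ d, Gi k d * w d := by
    rw [Finset.mul_sum]
    refine Finset.sum_congr rfl fun k _ => ?_
    rw [← mul_assoc, ← sum_rows_mul_symb G m μ a k]
    simp only [Finset.sum_mul]
  rw [hr, sum_rotate₅ fun i j c l k =>
    G m i * G μ j * G a c * G k l * symb i j c l * ∑ d, Gi k d * w d]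
  refine Finset.sum_congr rfl fun i _ => ?_
  rw [axialPart, Finset.mul_sum, Finset.sum_comm]
  refine Finset.sum_congr rfl fun c _ => ?_
  rw [Finset.sum_mul, Finset.mul_sum]
  refine Finset.sum_congr rfl fun j _ => ?_
  rw [Finset.sum_mul, Finset.sum_mul, Finset.mul_sum]
  refine Finset.sum_congr rfl fun l _ => ?_
  -- Replacing w by G (Gi w) provides the fourth factor of G.
  rw [← lower_raise hG hGi hinv w l, hG j μ, hG c a]
  simp only [Finset.sum_mul, Finset.mul_sum]
  refine Finset.sum_congr rfl fun k _ => Finset.sum_congr rfl fun d _ => ?_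
  rw [hG k l]; ring

include hG hGi hinv in
theorem axialPart_eq (w : Fin 4 → ℝ) (l m n : Fin 4) :
    axialPart G w l m n = G.det * ∑ j, Gi l j * ∑ k, symb j m n k * ∑ d, Gi k d * w d := by
  have h := raise_lower hG hinv (fun r => axialPart G w r m n) l
  rw [← h, Finset.mul_sum]
  refine Finset.sum_congr rfl fun j _ => ?_
  have := lower_axialPart hG hGi hinv w j m n
  have h' : ∑ c, axialPart G w c m n * G c j = ∑ r, G j r * axialPart G w r m n :=
    Finset.sum_congr rfl fun r _ => by rw [hG j r]; ring
  rw [h', this]; ring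

include hG hGi hinv in
theorem sum_symb_lower_axialPart (w : Fin 4 → ℝ) (μ ν b : Fin 4) :
    ∑ m, ∑ a, symb m ν a b * ∑ r, G m r * axialPart G w r μ a =
      2 * G.det * ((if μ = ν then 1 else 0) * (∑ d, Gi b d * w d)
        - (if μ = b then 1 else 0) * ∑ d, Gi ν d * w d) := by
  simp only [lower_axialPart hG hGi hinv]
  generalize hW : (fun k => ∑ d, Gi k d * w d) = W
  have hW' : ∀ k, ∑ d, Gi k d * w d = W k := fun k => by rw [← hW]
  simp only [hW']
  calc _ = ∑ m, ∑ a, ∑ k, G.det * W k * (symb m ν a b * symb m μ a k) := by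
        simp only [Finset.mul_sum]
        refine Finset.sum_congr rfl fun i _ => Finset.sum_congr rfl fun j _ =>
          Finset.sum_congr rfl fun c _ => ?_
        ring
    _ = ∑ m, ∑ k, ∑ a, G.det * W k * (symb m ν a b * symb m μ a k) :=
        Finset.sum_congr rfl fun i _ => Finset.sum_comm
    _ = ∑ k, ∑ m, ∑ a, G.det * W k * (symb m ν a b * symb m μ a k) := Finset.sum_comm
    _ = ∑ k, G.det * W k * (2 * ((if ν = μ then 1 else 0) * (if b = k then 1 else 0)
          - (if ν = k then 1 else 0) * (if b = μ then 1 else 0))) := by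
        simp only [← Finset.mul_sum, symb_contract_two]
    _ = _ := by
        have e : ∀ k, G.det * W k * (2 * ((if ν = μ then 1 else 0) * (if b = k then 1 else 0)
            - (if ν = k then 1 else 0) * (if b = μ then 1 else 0))) =
            (if b = k then 2 * G.det * (if μ = ν then 1 else 0) * W k else 0)
            - (if ν = k then 2 * G.det * (if μ = b then 1 else 0) * W k else 0) := by
          intro k
          simp only [eq_comm (a := ν) (b := μ), eq_comm (a := b) (b := μ)]
          split_ifs <;> ring
        simp only [e, Finset.sum_sub_distrib, Finset.sum_ite_eq, Finset.mem_univ, if_true]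
        split_ifs <;> ring

include hG hGi hinv in
theorem sum_lower_symb_axialPart (w : Fin 4 → ℝ) (μ ν b : Fin 4) :
    ∑ r, ∑ a, (∑ m, G m μ * symb m r b a) * axialPart G w ν r a =
      -(2 * G.det) * ((if μ = ν then 1 else 0) * (∑ d, Gi b d * w d) - Gi ν b * w μ) := by
  simp only [axialPart_eq hG hGi hinv]
  have hlow := lower_raise hG hGi hinv w μ
  generalize hW : (fun k => ∑ d, Gi k d * w d) = W at *
  have hW' : ∀ k, ∑ d, Gi k d * w d = W k := fun k => by rw [← hW]
  simp only [hW'] at *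
  calc _ = ∑ r, ∑ a, ∑ m, ∑ j, ∑ k, G.det * G m μ * Gi ν j * W k * (symb m r b a * symb j r a k) := by
        refine Finset.sum_congr rfl fun r _ => Finset.sum_congr rfl fun a _ => ?_
        rw [Finset.sum_mul]
        refine Finset.sum_congr rfl fun m _ => ?_
        rw [Finset.mul_sum, Finset.mul_sum]
        refine Finset.sum_congr rfl fun j _ => ?_
        rw [Finset.mul_sum, Finset.mul_sum, Finset.mul_sum]
        refine Finset.sum_congr rfl fun k _ => ?_
        ring
    _ = ∑ r, ∑ m, ∑ j, ∑ k, ∑ a, G.det * G m μ * Gi ν j * W k * (symb m r b a * symb j r a k) := by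
        refine Finset.sum_congr rfl fun r _ => ?_
        rw [Finset.sum_comm]
        refine Finset.sum_congr rfl fun m _ => ?_
        rw [Finset.sum_comm]
        refine Finset.sum_congr rfl fun j _ => ?_
        rw [Finset.sum_comm]
    _ = ∑ m, ∑ j, ∑ k, ∑ r, ∑ a, G.det * G m μ * Gi ν j * W k * (symb m r b a * symb j r a k) := by
        rw [Finset.sum_comm]
        refine Finset.sum_congr rfl fun m _ => ?_
        rw [Finset.sum_comm]
        refine Finset.sum_congr rfl fun j _ => ?_
        rw [Finset.sum_comm]
    _ = ∑ m, ∑ j, ∑ k, G.det * G m μ * Gi ν j * W k *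
          (-2 * ((if j = m then 1 else 0) * (if b = k then 1 else 0)
          - (if k = m then 1 else 0) * (if j = b then 1 else 0))) := by
        simp only [← Finset.mul_sum, symb_contract_two_mid]
    _ = -(2 * G.det) * ((∑ m, Gi ν m * G m μ) * W b - Gi ν b * ∑ m, G μ m * W m) := by
        have e : ∀ m k j, G.det * G m μ * Gi ν j * W k *
            (-2 * ((if j = m then 1 else 0) * (if b = k then 1 else 0)
            - (if k = m then 1 else 0) * (if j = b then 1 else 0))) =
            (if b = k then (if j = m then -(2 * G.det) * (Gi ν m * G m μ * W b) else 0) else 0)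
            - (if k = m then (if j = b then -(2 * G.det) * (Gi ν b * (G μ m * W m)) else 0)
              else 0) := by
          intro m k j
          rw [hG μ m]
          split_ifs <;> subst_vars <;> ring
        have e' : ∀ m, ∑ j, ∑ k, G.det * G m μ * Gi ν j * W k *
            (-2 * ((if j = m then 1 else 0) * (if b = k then 1 else 0)
            - (if k = m then 1 else 0) * (if j = b then 1 else 0))) =
            -(2 * G.det) * (Gi ν m * G m μ * W b) - -(2 * G.det) * (Gi ν b * (G μ m * W m)) := by
          intro m
          rw [Finset.sum_comm]
          simp only [e, Finset.sum_sub_distrib]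
          rw [Finset.sum_comm, Finset.sum_comm (γ := Fin 4) (f := fun k j =>
            (if k = m then (if j = b then -(2 * G.det) * (Gi ν b * (G μ m * W m)) else 0) else 0))]
          simp
        rw [Finset.sum_congr rfl fun m _ => e' m]
        simp only [Finset.sum_sub_distrib, mul_sub, Finset.mul_sum, Finset.sum_mul]
    _ = _ := by rw [hinv, hlow]; simp only [eq_comm (a := ν)]

include hG hGi hinv in
theorem sum_vectorPart_trace (w : Fin 4 → ℝ) (μ : Fin 4) :
    ∑ a, vectorPart G Gi w a μ a = -3 * w μ := by
  have := lower_raise hG hGi hinv w μ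
  simp only [vectorPart, Finset.sum_sub_distrib, this]
  simp
  ring

include hG hinv in
theorem sum_inv_mul_vectorPart_right (w : Fin 4 → ℝ) (ν b μ : Fin 4) :
    ∑ a, Gi ν a * vectorPart G Gi w b μ a =
      (if μ = ν then 1 else 0) * (∑ d, Gi b d * w d) - Gi ν b * w μ := by
  have : ∑ a, Gi ν a * G a μ = if ν = μ then 1 else 0 := hinv ν μ
  have h2 : ∑ a, Gi ν a * (G μ a * ∑ d, Gi b d * w d) =
      (∑ a, Gi ν a * G a μ) * ∑ d, Gi b d * w d := by
    rw [Finset.sum_mul]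
    exact Finset.sum_congr rfl fun a _ => by rw [hG μ a]; ring
  simp only [vectorPart, mul_sub, Finset.sum_sub_distrib, h2, this, eq_comm (a := ν)]
  simp

include hG hGi hinv in
theorem sum_inv_vectorPart (w : Fin 4 → ℝ) (ν : Fin 4) :
    ∑ r, ∑ a, Gi r a * vectorPart G Gi w ν r a = 3 * ∑ d, Gi ν d * w d := by
  simp only [sum_inv_mul_vectorPart_right hG hinv w]
  simp only [Finset.sum_sub_distrib, if_true, one_mul, Finset.sum_const, Finset.card_univ,
    Fintype.card_fin, nsmul_eq_mul]
  have : ∑ r, Gi r ν * w r = ∑ d, Gi ν d * w d :=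
    Finset.sum_congr rfl fun r _ => by rw [hGi]
  rw [this]; push_cast; ring

include hGi hinv in
theorem sum_inv_mul_vectorPart_left (w : Fin 4 → ℝ) (ν b μ : Fin 4) :
    ∑ r, Gi r b * vectorPart G Gi w ν r μ =
      (if μ = b then 1 else 0) * (∑ d, Gi ν d * w d)
        - (if μ = ν then 1 else 0) * ∑ d, Gi b d * w d := by
  have : ∑ a, Gi b a * G a μ = if b = μ then 1 else 0 := hinv b μ
  have h2 : ∑ a, Gi a b * (G a μ * ∑ d, Gi ν d * w d) =
      (∑ a, Gi b a * G a μ) * ∑ d, Gi ν d * w d := by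
    rw [Finset.sum_mul]
    exact Finset.sum_congr rfl fun a _ => by rw [hGi b a]; ring
  have h3 : ∑ a, Gi a b * ((if ν = μ then 1 else 0) * w a) =
      (if ν = μ then 1 else 0) * ∑ d, Gi b d * w d := by
    rw [Finset.mul_sum]
    exact Finset.sum_congr rfl fun a _ => by rw [hGi b a]; ring
  simp only [vectorPart, mul_sub, Finset.sum_sub_distrib, h2, h3, this, eq_comm (a := b),
    eq_comm (a := μ) (b := ν)]

include hG hGi hinv in
theorem sum_symb_lower_vectorPart (w : Fin 4 → ℝ) (μ ν b : Fin 4) :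
    ∑ m, ∑ a, symb m ν a b * ∑ r, G m r * vectorPart G Gi w r μ a =
      ∑ c, (∑ d, symb ν b c d * w d) * G c μ := by
  have h1 : ∀ m a, ∑ r, G m r * vectorPart G Gi w r μ a = G μ a * w m - G m a * w μ := by
    intro m a
    have := lower_raise hG hGi hinv w m
    rw [← this]
    simp only [vectorPart, mul_sub, Finset.sum_sub_distrib, Finset.mul_sum]
    simp
    refine Finset.sum_congr rfl fun r _ => Finset.sum_congr rfl fun d _ => ?_
    ring
  have h2 : ∑ m, ∑ a, symb m ν a b * (G m a * w μ) = 0 := by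
    have := sum_antisymm_mul_symm (fun m a => symb m ν a b) (fun m a => G m a * w μ)
      (fun i j => symb_swap₁₃ _ _ _ _) (fun i j => by rw [hG])
    exact this
  simp only [h1, mul_sub, Finset.sum_sub_distrib, h2, sub_zero]
  rw [Finset.sum_comm]
  refine Finset.sum_congr rfl fun c _ => ?_
  rw [Finset.sum_mul]
  refine Finset.sum_congr rfl fun d _ => ?_
  rw [hG c μ, symb_swap₁₂ ν d c b, symb_swap₂₃ ν c d b, symb_swap₃₄ ν c b d, symb_swap₂₃ ν b c d]
  ring

include hG in
theorem sum_lower_symb_vectorPart (w : Fin 4 → ℝ) (μ ν b : Fin 4) :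
    ∑ r, ∑ a, (∑ m, G m μ * symb m r b a) * vectorPart G Gi w ν r a =
      ∑ c, (∑ d, symb ν b c d * w d) * G c μ := by
  have h2 : ∑ r, ∑ a, (∑ m, G m μ * symb m r b a) * (G r a * ∑ d, Gi ν d * w d) = 0 := by
    refine sum_antisymm_mul_symm _ _ (fun i j => ?_) (fun i j => by rw [hG])
    rw [← Finset.sum_neg_distrib]
    refine Finset.sum_congr rfl fun m _ => ?_
    rw [symb_swap₂₃ m b j i, symb_swap₃₄ m b i j, symb_swap₂₃ m i b j]
    ring
  simp only [vectorPart, mul_sub, Finset.sum_sub_distrib, h2, zero_sub]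
  simp only [mul_ite, ite_mul, mul_zero, zero_mul, one_mul, Finset.sum_ite_eq, Finset.mem_univ,
    if_true]
  simp only [Finset.sum_mul]
  rw [Finset.sum_comm, ← Finset.sum_neg_distrib]
  refine Finset.sum_congr rfl fun c _ => ?_
  rw [← Finset.sum_neg_distrib]
  refine Finset.sum_congr rfl fun d _ => ?_
  rw [symb_swap₁₂ d c b ν, symb_swap₃₄ d c ν b, symb_swap₁₃ ν c d b, symb_swap₃₄ ν c b d,
    symb_swap₂₃ ν b c d]
  ring

end contractions

end MAG

end

/-! ### The contortion that solves the connection equation with a gradient source -/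

noncomputable section

namespace MAG

/-- The contortion of the connections that solve the connection equation. -/
def contortion (G Gi : Matrix (Fin 4) (Fin 4) ℝ) (v F α : ℝ) (w : Fin 4 → ℝ) (l m n : Fin 4) : ℝ :=
  1 / (6 * v) * axialPart G w l m n + F / (12 * α) * vectorPart G Gi w l m n

theorem bracket_linear (P : Fin 4 → Fin 4 → Fin 4 → Fin 4 → ℝ) (M N : Fin 4 → Fin 4 → Fin 4 → ℝ)
    (c d : ℝ) (μ ν b : Fin 4) :
    bracket P (fun l m n => c * M l m n + d * N l m n) μ ν b
      = c * bracket P M μ ν b + d * bracket P N μ ν b := by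
  simp only [bracket, Finset.mul_sum, ← Finset.sum_add_distrib]
  refine Finset.sum_congr rfl fun r _ => Finset.sum_congr rfl fun a _ => ?_
  ring

/-- Let X be the ε-contraction of w and Y the bracket in the last line of the statement. The axial
part is mapped to −2vF X − 4αv² Y and the vector part to 4α X − 2vF Y. The coefficients 1/(6v) and
F/(12α) are in the ratio that cancels X, and the Y terms add up to the factor F² + 4α². The sign of
the determinant, `G.det = -v ^ 2`, makes this a sum of squares. -/
theorem bracket_contortion {G Gi : Matrix (Fin 4) (Fin 4) ℝ} (hG : ∀ i j, G j i = G i j)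
    (hGi : ∀ i j, Gi j i = Gi i j) (hinv : ∀ i j, ∑ k, Gi i k * G k j = if i = j then 1 else 0)
    {v : ℝ} (hv : v ≠ 0) (hdet : G.det = -v ^ 2) (F : ℝ) {α : ℝ} (hα : α ≠ 0) (w : Fin 4 → ℝ)
    (μ ν b : Fin 4) :
    bracket (momentum G Gi v F α) (contortion G Gi v F α w) μ ν b =
      -(v * (F ^ 2 + 4 * α ^ 2) / (6 * α)) *
        (Gi ν b * w μ - (if μ = b then 1 else 0) * ∑ d, Gi ν d * w d) := by
  have hcyc : ∑ c, (∑ d, symb b c ν d * w d) * G c μ = ∑ c, (∑ d, symb ν b c d * w d) * G c μ := by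
    refine Finset.sum_congr rfl fun c _ => ?_
    rw [dual_swap₁₃ w ν c b, dual_swap₂₃ w ν b c, neg_neg]
  have h1 := bracket_momentum G Gi v F α (axialPart G w) μ ν b
  have h2 := bracket_momentum G Gi v F α (vectorPart G Gi w) μ ν b
  rw [sum_axialPart_trace hG, sum_inv_mul_axialPart_right hG hinv, hcyc, sum_inv_axialPart hGi,
    sum_inv_mul_axialPart_left hG hGi hinv, sum_symb_lower_axialPart hG hGi hinv,
    sum_lower_symb_axialPart hG hGi hinv, hdet] at h1
  rw [sum_vectorPart_trace hG hGi hinv, sum_inv_mul_vectorPart_right hG hinv,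
    sum_inv_vectorPart hG hGi hinv, sum_inv_mul_vectorPart_left hGi hinv,
    sum_symb_lower_vectorPart hG hGi hinv, sum_lower_symb_vectorPart hG] at h2
  have h3 := bracket_linear (momentum G Gi v F α) (axialPart G w) (vectorPart G Gi w)
    (1 / (6 * v)) (F / (12 * α)) μ ν b
  change bracket _ (fun l m n => _) _ _ _ = _ at h3
  change bracket _ (fun l m n => 1 / (6 * v) * axialPart G w l m n
    + F / (12 * α) * vectorPart G Gi w l m n) _ _ _ = _
  rw [h3, h1, h2]
  field_simp
  ring

/-! ### The kernel of the connection equation -/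

/-- One of the four blocks of the homogeneous connection equation: 16 equations in 16 unknowns. The
letters a, b, c, d stand for components in which a chosen index i is unpaired, the p's for
components with the three other indices all distinct. Multiplying the B and C rows by F and
eliminating the p's with the D rows leaves equations in the a's and b's whose coefficients are F²
plus positive multiples of q². Only the trace direction c = d survives. -/
theorem connection_block {F q a1 a2 a3 b1 b2 b3 c1 c2 c3 d p123 p231 p312 p132 p213 p321 : ℝ}
    (hF : F ≠ 0)
    (h0 : F * (a1 + b1 + a2 + b2 + a3 + b3) = 0)
    (A1 : F * (a1 + b1) + q * (p213 - p312 + p123 - p132) = 0)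
    (A2 : F * (a2 + b2) + q * (p321 - p123 + p231 - p213) = 0)
    (A3 : F * (a3 + b3) + q * (p132 - p231 + p312 - p321) = 0)
    (B1 : F * (c1 - d - b2 - b3) = q * (p123 - p132))
    (B2 : F * (c2 - d - b1 - b3) = q * (p231 - p213))
    (B3 : F * (c3 - d - b1 - b2) = q * (p312 - p321))
    (C1 : F * (c1 - d - a2 - a3) = q * (p213 - p312))
    (C2 : F * (c2 - d - a1 - a3) = q * (p321 - p123))
    (C3 : F * (c3 - d - a1 - a2) = q * (p132 - p231))
    (D1 : F * (p312 + p231) = -q * (a1 - c1 - b2 + c2))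
    (D2 : F * (p123 + p312) = -q * (a2 - c2 - b3 + c3))
    (D3 : F * (p231 + p123) = -q * (a3 - c3 - b1 + c1))
    (D4 : F * (p321 + p132) = q * (a2 - c2 - b1 + c1))
    (D5 : F * (p213 + p321) = q * (a1 - c1 - b3 + c3))
    (D6 : F * (p132 + p213) = q * (a3 - c3 - b2 + c2)) :
    a1 = 0 ∧ b1 = 0 ∧ c1 = d ∧ p123 = 0 := by
  have cancel : ∀ y : ℝ, F * y = 0 → y = 0 := fun y h => (mul_eq_zero.1 h).resolve_left hF
  have h0' := cancel _ h0
  have hc1 : c1 = d - a1 - b1 := by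
    have := cancel (2 * (c1 - (d - a1 - b1))) (by linear_combination A1 + B1 + C1 + h0)
    linarith
  have hc2 : c2 = d - a2 - b2 := by
    have := cancel (2 * (c2 - (d - a2 - b2))) (by linear_combination A2 + B2 + C2 + h0)
    linarith
  have hc3 : c3 = d - a3 - b3 := by
    have := cancel (2 * (c3 - (d - a3 - b3))) (by linear_combination A3 + B3 + C3 + h0)
    linarith
  subst hc1 hc2 hc3
  have hpos : ∀ n y : ℝ, 0 < n → (F ^ 2 + n * q ^ 2) * y = 0 → y = 0 := by
    intro n y hn h
    have : 0 < F ^ 2 + n * q ^ 2 := by positivity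
    exact (mul_eq_zero.1 h).resolve_left this.ne'
  -- The differences p − p in the B rows, once multiplied by F, are combinations of the D rows; the
  -- constraint `h0'` tidies up the q² part. R comes from B in this way, and S below from C.
  have R1 : F ^ 2 * (a1 + (b1 + b2 + b3)) + q ^ 2 * (b1 + b2 + b3 + 5 * a1 + 4 * b1) = 0 := by
    linear_combination -F * B1 - q / 2 * (D2 + D3 - D1 - D4 - D6 + D5) + 2 * q ^ 2 * h0'
  have R2 : F ^ 2 * (a2 + (b1 + b2 + b3)) + q ^ 2 * (b1 + b2 + b3 + 5 * a2 + 4 * b2) = 0 := by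
    linear_combination -F * B2 - q / 2 * (D1 + D3 - D2 - D5 - D6 + D4) + 2 * q ^ 2 * h0'
  have R3 : F ^ 2 * (a3 + (b1 + b2 + b3)) + q ^ 2 * (b1 + b2 + b3 + 5 * a3 + 4 * b3) = 0 := by
    linear_combination -F * B3 - q / 2 * (D1 + D2 - D3 - D4 - D5 + D6) + 2 * q ^ 2 * h0'
  have hβ : b1 + b2 + b3 = 0 := by
    apply hpos 1 _ one_pos
    linear_combination (R1 + R2 + R3 - F ^ 2 * h0' - 5 * q ^ 2 * h0') / 2
  have S1 : F ^ 2 * (b1 - (b1 + b2 + b3)) + q ^ 2 * (-(b1 + b2 + b3) + 5 * b1 + 4 * a1) = 0 := by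
    linear_combination -F * C1 - q / 2 * (D5 + D6 - D4 - D1 - D2 + D3)
      - (F ^ 2 - 1 * q ^ 2) * h0'
  have S2 : F ^ 2 * (b2 - (b1 + b2 + b3)) + q ^ 2 * (-(b1 + b2 + b3) + 5 * b2 + 4 * a2) = 0 := by
    linear_combination -F * C2 - q / 2 * (D4 + D5 - D6 - D2 - D3 + D1)
      - (F ^ 2 - 1 * q ^ 2) * h0'
  have S3 : F ^ 2 * (b3 - (b1 + b2 + b3)) + q ^ 2 * (-(b1 + b2 + b3) + 5 * b3 + 4 * a3) = 0 := by
    linear_combination -F * C3 - q / 2 * (D4 + D6 - D5 - D1 - D3 + D2)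
      - (F ^ 2 - 1 * q ^ 2) * h0'
  rw [hβ] at R1 R2 R3 S1 S2 S3
  -- The symmetric 2×2 system in a and b has eigenvectors a + b and a − b, with eigenvalues F² + 9q²
  -- and F² + q².
  have both : ∀ a b : ℝ, F ^ 2 * (a + 0) + q ^ 2 * (0 + 5 * a + 4 * b) = 0 →
      F ^ 2 * (b - 0) + q ^ 2 * (-0 + 5 * b + 4 * a) = 0 → a = 0 ∧ b = 0 := by
    intro a b h h'
    have e1 := hpos 9 (a + b) (by norm_num) (by linear_combination h + h')
    have e2 := hpos 1 (a - b) (by norm_num) (by linear_combination h - h')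
    constructor <;> linarith
  obtain ⟨rfl, rfl⟩ := both _ _ R1 S1
  obtain ⟨rfl, rfl⟩ := both _ _ R2 S2
  obtain ⟨rfl, rfl⟩ := both _ _ R3 S3
  refine ⟨rfl, rfl, by ring, ?_⟩
  have := cancel (2 * p123) (by linear_combination D2 + D3 - D1)
  linarith

theorem sum_eq_of_distinct {i j k l : Fin 4} (hij : i ≠ j) (hik : i ≠ k) (hil : i ≠ l)
    (hjk : j ≠ k) (hjl : j ≠ l) (hkl : k ≠ l) (f : Fin 4 → ℝ) :
    ∑ a, f a = f i + f j + f k + f l := by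
  have : (Finset.univ : Finset (Fin 4)) = {i, j, k, l} := by
    symm
    apply Finset.eq_univ_of_card
    rw [Finset.card_insert_of_notMem (by simp [hij, hik, hil]),
      Finset.card_insert_of_notMem (by simp [hjk, hjl]), Finset.card_pair hkl]
    rfl
  rw [this, Finset.sum_insert (by simp [hij, hik, hil]), Finset.sum_insert (by simp [hjk, hjl]),
    Finset.sum_pair hkl]
  ring

theorem symb_self₁₂ (a c d : Fin 4) : symb a a c d = 0 := by
  linarith [symb_swap₁₂ a a c d]

theorem symb_self₂₃ (a b d : Fin 4) : symb a b b d = 0 := by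
  linarith [symb_swap₂₃ a b b d]

theorem symb_self₃₄ (a b c : Fin 4) : symb a b c c = 0 := by
  linarith [symb_swap₃₄ a b c c]

theorem symb_self₁₃ (a b d : Fin 4) : symb a b a d = 0 := by
  linarith [symb_swap₁₃ a b a d]

theorem symb_self₂₄ (a b c : Fin 4) : symb a b c b = 0 := by
  rw [symb_swap₂₃, symb_self₃₄, neg_zero]

theorem symb_self₁₄ (a b c : Fin 4) : symb a b c a = 0 := by
  rw [symb_swap₁₂, symb_self₂₄, neg_zero]

/-- The connection equation in an orthonormal frame, in terms of the diagonal entries `e` of the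
Minkowski metric. -/
theorem bracket_momentum_diagonal (e : Fin 4 → ℝ) (v F α : ℝ) (N : Fin 4 → Fin 4 → Fin 4 → ℝ)
    (μ ν b : Fin 4) :
    bracket (momentum (Matrix.diagonal e) (Matrix.diagonal e) v F α) N μ ν b =
      v * F * ((if ν = b then e ν else 0) * (∑ a, N a μ a) - e ν * N b μ ν
        + (if μ = b then 1 else 0) * (∑ r, e r * N ν r r) - e b * N ν b μ)
      + 2 * α * ((∑ m, ∑ a, symb m ν a b * (e m * N m μ a))
        + ∑ r, ∑ a, (e μ * symb μ r b a) * N ν r a) := by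
  rw [bracket_momentum]
  simp [Matrix.diagonal_apply]

/-! ### Components of the connection equation in an orthonormal frame -/

section frame

variable {e : Fin 4 → ℝ} {v F α : ℝ} {N : Fin 4 → Fin 4 → Fin 4 → ℝ}
  (H : ∀ μ ν b, bracket (momentum (Matrix.diagonal e) (Matrix.diagonal e) v F α) N μ ν b = 0)
  {i j k l : Fin 4} (hij : i ≠ j) (hik : i ≠ k) (hil : i ≠ l)
  (hjk : j ≠ k) (hjl : j ≠ l) (hkl : k ≠ l)

include H hij hik hil hjk hjl hkl

/-- In this and the next four lemmas the suffix of the name is the index triple (μ, ν, b) at which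
the connection equation is evaluated, with i, j, k, l the four distinct indices. -/
theorem bracket_eq_iii :
    v * F * e i * (N j i j + N k i k + N l i l)
      + v * F * (e j * N i j j + e k * N i k k + e l * N i l l) = 0 := by
  have h := H i i i
  rw [bracket_momentum_diagonal] at h
  simp only [sum_eq_of_distinct hij hik hil hjk hjl hkl, symb_self₁₃,
    symb_self₂₄, if_true, mul_zero, zero_mul] at h
  linarith

theorem bracket_eq_jji :
    v * F * (-e j * N i j j - e i * N j i j)
      + 2 * α * symb i j k l * (e k * N k j l - e l * N l j k + e j * (N j k l - N j l k)) = 0 := by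
  have h := H j j i
  rw [bracket_momentum_diagonal] at h
  simp only [sum_eq_of_distinct hij hik hil hjk hjl hkl, symb_self₁₂, symb_self₁₃, symb_self₁₄,
    symb_self₂₃, symb_self₂₄, symb_self₃₄, if_neg hij.symm, mul_zero, zero_mul] at h
  have s1 : symb k j l i = symb i j k l := by
    rw [symb_swap₃₄ k j i l, symb_swap₁₃ i j k l, neg_neg]
  have s2 : symb l j k i = -symb i j k l := by
    rw [symb_swap₁₃ k j l i, s1]
  have s3 : symb j k i l = symb i j k l := by
    rw [symb_swap₂₃ j i k l, symb_swap₁₂ i j k l, neg_neg]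
  have s4 : symb j l i k = -symb i j k l := by
    rw [symb_swap₂₃ j i l k, symb_swap₁₂ i j l k, symb_swap₃₄ i j k l, neg_neg]
  rw [s1, s2, s3, s4] at h
  linarith

theorem bracket_eq_ijj :
    v * F * e j * (N i i i + N k i k + N l i l - N j j i)
      - 2 * α * symb i j k l * e i * (N j k l - N j l k) = 0 := by
  have h := H i j j
  rw [bracket_momentum_diagonal] at h
  simp only [sum_eq_of_distinct hij hik hil hjk hjl hkl, symb_self₁₂, symb_self₁₄,
    symb_self₂₃, symb_self₂₄, symb_self₃₄, if_true, if_neg hij, mul_zero, zero_mul] at h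
  have s3 : symb i k j l = -symb i j k l := symb_swap₂₃ i j k l
  have s4 : symb i l j k = symb i j k l := by
    rw [symb_swap₂₃ i j l k, symb_swap₃₄ i j k l, neg_neg]
  rw [s3, s4] at h
  linarith

theorem bracket_eq_jij :
    v * F * (e i * N i i i + e k * N i k k + e l * N i l l - e i * N j j i)
      - 2 * α * symb i j k l * (e k * N k j l - e l * N l j k) = 0 := by
  have h := H j i j
  rw [bracket_momentum_diagonal] at h
  simp only [sum_eq_of_distinct hij hik hil hjk hjl hkl, symb_self₁₂, symb_self₁₃, symb_self₁₄,
    symb_self₂₃, symb_self₃₄, if_true, if_neg hij, mul_zero, zero_mul] at h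
  have s3 : symb k i l j = -symb i j k l := by
    rw [symb_swap₁₂ i k l j, symb_swap₃₄ i k j l, symb_swap₂₃ i j k l, neg_neg]
  have s4 : symb l i k j = symb i j k l := by
    rw [symb_swap₁₃ k i l j, s3, neg_neg]
  rw [s3, s4] at h
  linarith

theorem bracket_eq_jkl :
    v * F * (-e k * N l j k - e l * N k l j)
      + 2 * α * symb i j k l * (-e i * N i j j + e j * N j j i + e j * (N k i k - N k k i)) = 0 := by
  have h := H j k l
  rw [bracket_momentum_diagonal] at h
  simp only [sum_eq_of_distinct hij hik hil hjk hjl hkl, symb_self₁₂, symb_self₁₃, symb_self₁₄,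
    symb_self₂₃, symb_self₂₄, symb_self₃₄, if_neg hkl, if_neg hjl, mul_zero, zero_mul] at h
  have s1 : symb i k j l = -symb i j k l := symb_swap₂₃ i j k l
  have s2 : symb j k i l = symb i j k l := by
    rw [symb_swap₂₃ j i k l, symb_swap₁₂ i j k l, neg_neg]
  have s3 : symb j i l k = symb i j k l := by
    rw [symb_swap₃₄ j i k l, symb_swap₁₂ i j k l, neg_neg]
  have s4 : symb j k l i = -symb i j k l := by
    rw [symb_swap₃₄ j k i l, s2]
  rw [s1, s2, s3, s4] at h
  linarith

end frame

/-- A diagonal metric makes the system decouple by index parity: the metric terms preserve the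
parity with which each index value occurs, and the ε terms flip all four. So components in which
only i occurs an odd number of times couple only to those in which j, k, l each occur once. The five
equation types, over all orderings of j, k, l, give the 16 equations of `connection_block`. -/
theorem kernel_distinct {e : Fin 4 → ℝ} {v F α : ℝ} {N : Fin 4 → Fin 4 → Fin 4 → ℝ}
    (H : ∀ μ ν b, bracket (momentum (Matrix.diagonal e) (Matrix.diagonal e) v F α) N μ ν b = 0)
    (hvF : v * F ≠ 0) (he : ∀ a, e a = 1 ∨ e a = -1) {i j k l : Fin 4}
    (hprod : e i * e j * e k * e l = -1) (hij : i ≠ j) (hik : i ≠ k) (hil : i ≠ l)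
    (hjk : j ≠ k) (hjl : j ≠ l) (hkl : k ≠ l) :
    N i j j = 0 ∧ N j i j = 0 ∧ N j j i = N i i i ∧ N j k l = 0 := by
  -- Cyclic reorderings of (j, k, l) keep the symbol and transpositions flip it, so all instances
  -- share one orientation sign.
  have s231 : symb i k l j = symb i j k l := by
    rw [symb_swap₃₄ i k j l, symb_swap₂₃ i j k l, neg_neg]
  have s312 : symb i l j k = symb i j k l := by
    rw [symb_swap₂₃ i j l k, symb_swap₃₄ i j k l, neg_neg]
  have s132 : symb i j l k = -symb i j k l := symb_swap₃₄ i j k l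
  have s213 : symb i k j l = -symb i j k l := symb_swap₂₃ i j k l
  have s321 : symb i l k j = -symb i j k l := by rw [symb_swap₃₄ i l j k, s312]
  have h0 := bracket_eq_iii H hij hik hil hjk hjl hkl
  have A1 := bracket_eq_jji H hij hik hil hjk hjl hkl
  have A2 := bracket_eq_jji H hik hil hij hkl hjk.symm hjl.symm
  have A3 := bracket_eq_jji H hil hij hik hjl.symm hkl.symm hjk
  have B1 := bracket_eq_ijj H hij hik hil hjk hjl hkl
  have B2 := bracket_eq_ijj H hik hil hij hkl hjk.symm hjl.symm
  have B3 := bracket_eq_ijj H hil hij hik hjl.symm hkl.symm hjk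
  have C1 := bracket_eq_jij H hij hik hil hjk hjl hkl
  have C2 := bracket_eq_jij H hik hil hij hkl hjk.symm hjl.symm
  have C3 := bracket_eq_jij H hil hij hik hjl.symm hkl.symm hjk
  have D1 := bracket_eq_jkl H hij hik hil hjk hjl hkl
  have D2 := bracket_eq_jkl H hik hil hij hkl hjk.symm hjl.symm
  have D3 := bracket_eq_jkl H hil hij hik hjl.symm hkl.symm hjk
  have D4 := bracket_eq_jkl H hik hij hil hjk.symm hkl hjl
  have D5 := bracket_eq_jkl H hij hil hik hjl hjk hkl.symm
  have D6 := bracket_eq_jkl H hil hik hij hkl.symm hjl.symm hjk.symm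
  rw [s231] at A2 B2 C2 D2
  rw [s312] at A3 B3 C3 D3
  rw [s213] at D4
  rw [s132] at D5
  rw [s321] at D6
  generalize symb i j k l = σ at *
  generalize v * F = f at *
  clear s231 s312 s132 s213 s321 H
  have h2 : ∀ a, e a ^ 2 = 1 := fun a => by rcases he a with h | h <;> rw [h] <;> norm_num
  -- The Lorentzian signature enters here. With product +1 the D equations would have the opposite
  -- relative sign, and F² − q² would replace F² + q² in the block.
  have pj : e i * e k * e l = -e j := by linear_combination e j * hprod - e i * e k * e l * h2 j
  have pk : e i * e j * e l = -e k := by linear_combination e k * hprod - e i * e j * e l * h2 k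
  have pl : e i * e j * e k = -e l := by linear_combination e l * hprod - e i * e j * e k * h2 l
  have main : e i * e j * N i j j = 0 ∧ N j i j = 0 ∧ N j j i = N i i i ∧ e j * N j k l = 0 := by
    -- Scaling the unknowns by the signs e removes these from the equations; the leftover sign e i
    -- and the orientation σ go into q.
    refine connection_block (F := f) (q := -2 * α * σ * e i) (a1 := e i * e j * N i j j)
      (a2 := e i * e k * N i k k) (a3 := e i * e l * N i l l) (b1 := N j i j) (b2 := N k i k)
      (b3 := N l i l) (c1 := N j j i) (c2 := N k k i) (c3 := N l l i) (d := N i i i)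
      (p123 := e j * N j k l) (p231 := e k * N k l j) (p312 := e l * N l j k)
      (p132 := e j * N j l k) (p213 := e k * N k j l) (p321 := e l * N l k j) hvF
      ?_ ?_ ?_ ?_ ?_ ?_ ?_ ?_ ?_ ?_ ?_ ?_ ?_ ?_ ?_ ?_
    · linear_combination e i * h0 - f * (N j i j + N k i k + N l i l) * h2 i
    · linear_combination -e i * A1 - f * N j i j * h2 i
    · linear_combination -e i * A2 - f * N k i k * h2 i
    · linear_combination -e i * A3 - f * N l i l * h2 i
    · linear_combination -e j * B1
        - f * (N j j i - N i i i - N k i k - N l i l) * h2 j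
    · linear_combination -e k * B2
        - f * (N k k i - N i i i - N j i j - N l i l) * h2 k
    · linear_combination -e l * B3
        - f * (N l l i - N i i i - N j i j - N k i k) * h2 l
    · linear_combination -e i * C1 - f * (N j j i - N i i i) * h2 i
    · linear_combination -e i * C2 - f * (N k k i - N i i i) * h2 i
    · linear_combination -e i * C3 - f * (N l l i - N i i i) * h2 i
    · linear_combination e i * e j * D1 + f * N l j k * pl + f * N k l j * pk
        - 2 * α * σ * e i * (N j j i + N k i k - N k k i) * h2 j
    · linear_combination e i * e k * D2 + f * N j k l * pj + f * N l j k * pl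
        - 2 * α * σ * e i * (N k k i + N l i l - N l l i) * h2 k
    · linear_combination e i * e l * D3 + f * N k l j * pk + f * N j k l * pj
        - 2 * α * σ * e i * (N l l i + N j i j - N j j i) * h2 l
    · linear_combination e i * e k * D4 + f * N l k j * pl + f * N j l k * pj
        + 2 * α * σ * e i * (N k k i + N j i j - N j j i) * h2 k
    · linear_combination e i * e j * D5 + f * N k j l * pk + f * N l k j * pl
        + 2 * α * σ * e i * (N j j i + N l i l - N l l i) * h2 j
    · linear_combination e i * e l * D6 + f * N j l k * pj + f * N k j l * pk
        + 2 * α * σ * e i * (N l l i + N k i k - N k k i) * h2 l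
  obtain ⟨h1, h2, h3, h4⟩ := main
  have hne : ∀ a, e a ≠ 0 := by
    intro a
    rcases he a with h | h <;> rw [h] <;> norm_num
  exact ⟨by simpa [hne] using h1, h2, h3, by simpa [hne] using h4⟩

end MAG

end

/-! ### The kernel for the Minkowski metric and for a general Lorentzian metric -/

noncomputable section

namespace MAG

/-- Every index triple is of one of the types treated in `kernel_distinct` for a suitable choice of
i, j, k, l. The only freedom left is one number per last index, the component of the projective
covector; nothing is needed about α. -/
theorem kernel_minkowski {v F α : ℝ} (hvF : v * F ≠ 0) {N : Fin 4 → Fin 4 → Fin 4 → ℝ}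
    (H : ∀ μ ν b, bracket (momentum minkowski minkowski v F α) N μ ν b = 0) (a b c : Fin 4) :
    N a b c = (if a = b then 1 else 0) * N c c c := by
  have he : ∀ a : Fin 4, (![-1, 1, 1, 1] : Fin 4 → ℝ) a = 1 ∨ (![-1, 1, 1, 1] : Fin 4 → ℝ) a = -1 := by
    intro a
    fin_cases a <;> simp
  have hp : ∀ i j k l : Fin 4, i ≠ j → i ≠ k → i ≠ l → j ≠ k → j ≠ l → k ≠ l →
      (![-1, 1, 1, 1] : Fin 4 → ℝ) i * (![-1, 1, 1, 1] : Fin 4 → ℝ) j *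
        (![-1, 1, 1, 1] : Fin 4 → ℝ) k * (![-1, 1, 1, 1] : Fin 4 → ℝ) l = -1 := by
    have key : ∀ i j k l : Fin 4, (i ≠ j ∧ i ≠ k ∧ i ≠ l ∧ j ≠ k ∧ j ≠ l ∧ k ≠ l) →
      (![-1, 1, 1, 1] : Fin 4 → ℤ) i * (![-1, 1, 1, 1] : Fin 4 → ℤ) j *
        (![-1, 1, 1, 1] : Fin 4 → ℤ) k * (![-1, 1, 1, 1] : Fin 4 → ℤ) l = -1 := by decide +kernel
    have hc : ∀ i : Fin 4, (![-1, 1, 1, 1] : Fin 4 → ℝ) i = ((![-1, 1, 1, 1] : Fin 4 → ℤ) i : ℝ) := by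
      intro i
      fin_cases i <;> simp
    intro i j k l h1 h2 h3 h4 h5 h6
    rw [hc, hc, hc, hc]
    exact_mod_cast key i j k l ⟨h1, h2, h3, h4, h5, h6⟩
  have main : ∀ i j k l : Fin 4, i ≠ j → i ≠ k → i ≠ l → j ≠ k → j ≠ l → k ≠ l →
      N i j j = 0 ∧ N j i j = 0 ∧ N j j i = N i i i ∧ N j k l = 0 :=
    fun i j k l h1 h2 h3 h4 h5 h6 =>
      kernel_distinct H hvF he (hp i j k l h1 h2 h3 h4 h5 h6) h1 h2 h3 h4 h5 h6
  have two : ∀ i j : Fin 4, i ≠ j →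
      ∃ k l, i ≠ j ∧ i ≠ k ∧ i ≠ l ∧ j ≠ k ∧ j ≠ l ∧ k ≠ l := by decide
  have three : ∀ j k l : Fin 4, j ≠ k → j ≠ l → k ≠ l →
      ∃ i, i ≠ j ∧ i ≠ k ∧ i ≠ l ∧ j ≠ k ∧ j ≠ l ∧ k ≠ l := by decide
  by_cases hab : a = b
  · subst hab
    rw [if_pos rfl, one_mul]
    by_cases hac : a = c
    · rw [hac]
    · obtain ⟨k, l, h1, h2, h3, h4, h5, h6⟩ := two c a (Ne.symm hac)
      exact (main c a k l h1 h2 h3 h4 h5 h6).2.2.1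
  · rw [if_neg hab, zero_mul]
    obtain ⟨k, l, h1, h2, h3, h4, h5, h6⟩ := two a b hab
    by_cases hbc : b = c
    · rw [← hbc]
      exact (main a b k l h1 h2 h3 h4 h5 h6).1
    by_cases hac : a = c
    · rw [← hac]
      exact (main b a k l h1.symm h4 h5 h2 h3 h6).2.1
    obtain ⟨i, h1, h2, h3, h4, h5, h6⟩ := three a b c hab hac hbc
    exact (main i a b c h1 h2 h3 h4 h5 h6).2.2.2

theorem minkowski_mul_self : minkowski * minkowski = 1 := by
  rw [minkowski, Matrix.diagonal_mul_diagonal, ← Matrix.diagonal_one]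
  congr 1
  ext i
  fin_cases i <;> simp

/-- The momentum in the frame `A` that brings the metric to Minkowski form. -/
theorem momentum_frame {G A B : Matrix (Fin 4) (Fin 4) ℝ} (hAB : A * B = 1)
    (hG : G = A.transpose * minkowski * A) (v F α : ℝ) (i j c d : Fin 4) :
    ∑ a, ∑ b, A c a * A d b * ∑ μ, (∑ ν, A j ν * momentum G G⁻¹ v F α μ ν a b) * B μ i =
      momentum minkowski minkowski v F (α * A.det) i j c d := by
  have hBA : B * A = 1 := mul_eq_one_comm.1 hAB
  have hGinv : G⁻¹ = B * minkowski * B.transpose := by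
    apply Matrix.inv_eq_right_inv
    calc G * (B * minkowski * B.transpose)
        = A.transpose * minkowski * (A * B) * minkowski * B.transpose := by
          rw [hG]; simp only [Matrix.mul_assoc]
      _ = A.transpose * (minkowski * minkowski) * B.transpose := by
          rw [hAB]; simp only [Matrix.mul_assoc, Matrix.mul_one]
      _ = 1 := by
          rw [minkowski_mul_self, Matrix.mul_one, ← Matrix.transpose_mul, hBA,
            Matrix.transpose_one]
  have hη : A * G⁻¹ * A.transpose = minkowski := by
    calc A * G⁻¹ * A.transpose = (A * B) * minkowski * (A * B).transpose := by
          rw [hGinv, Matrix.transpose_mul]; simp only [Matrix.mul_assoc]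
      _ = minkowski := by rw [hAB]; simp
  have hGB : G * B = A.transpose * minkowski := by
    rw [hG, Matrix.mul_assoc, hAB, Matrix.mul_one]
  have hAB' : ∀ c i, ∑ a, A c a * B a i = if c = i then 1 else 0 := fun c i => by
    rw [← Matrix.mul_apply, hAB, Matrix.one_apply]
  have hη' : ∀ j d, ∑ b, (∑ ν, A j ν * G⁻¹ ν b) * A d b = minkowski j d := fun j d => by
    rw [← hη, Matrix.mul_apply]
    simp only [Matrix.mul_apply, Matrix.transpose_apply]
  have hGB' : ∀ m, ∑ μ, G m μ * B μ i = A i m * minkowski i i := fun m => by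
    rw [← Matrix.mul_apply, hGB, minkowski, Matrix.mul_diagonal, Matrix.transpose_apply,
      Matrix.diagonal_apply_eq]
  have split : ∀ a b, ∑ μ, (∑ ν, A j ν * momentum G G⁻¹ v F α μ ν a b) * B μ i =
      v * F * ((∑ ν, A j ν * G⁻¹ ν b) * B a i - (∑ ν, A j ν * G⁻¹ ν a) * B b i)
        + 2 * α * ∑ m, ∑ ν, A i m * A j ν * minkowski i i * symb m ν a b := by
    intro a b
    have e1 : ∀ μ, (∑ ν, A j ν * momentum G G⁻¹ v F α μ ν a b) * B μ i =
        (if μ = a then v * F * ((∑ ν, A j ν * G⁻¹ ν b) * B a i) else 0)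
        - (if μ = b then v * F * ((∑ ν, A j ν * G⁻¹ ν a) * B b i) else 0)
        + ∑ m, ∑ ν, 2 * α * (A j ν * symb m ν a b * (G m μ * B μ i)) := by
      intro μ
      have e3 : ∑ m, ∑ ν, 2 * α * (A j ν * symb m ν a b * (G m μ * B μ i)) =
          (∑ ν, A j ν * (2 * α * ∑ m, G m μ * symb m ν a b)) * B μ i := by
        rw [Finset.sum_comm, Finset.sum_mul]
        refine Finset.sum_congr rfl fun ν _ => ?_
        rw [Finset.mul_sum, Finset.mul_sum, Finset.sum_mul]
        exact Finset.sum_congr rfl fun m _ => by ring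
      rw [e3]
      have e4 : ∀ b, ∑ ν, A j ν * (v * F * G⁻¹ ν b) = v * F * ∑ ν, A j ν * G⁻¹ ν b := by
        intro b
        rw [Finset.mul_sum]
        exact Finset.sum_congr rfl fun m _ => by ring
      have e5 : ∀ ν, A j ν * momentum G G⁻¹ v F α μ ν a b =
          (if μ = a then 1 else 0) * (A j ν * (v * F * G⁻¹ ν b))
          - (if μ = b then 1 else 0) * (A j ν * (v * F * G⁻¹ ν a))
          + A j ν * (2 * α * ∑ m, G m μ * symb m ν a b) := by
        intro ν
        rw [momentum]
        ring
      simp only [e5, Finset.sum_add_distrib, Finset.sum_sub_distrib, ← Finset.mul_sum, e4]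
      split_ifs <;> subst_vars <;> ring
    simp only [e1, Finset.sum_add_distrib, Finset.sum_sub_distrib, Finset.sum_ite_eq',
      Finset.mem_univ, if_true]
    rw [mul_sub, Finset.sum_comm, Finset.mul_sum]
    congr 1
    refine Finset.sum_congr rfl fun m _ => ?_
    rw [Finset.sum_comm, Finset.mul_sum]
    refine Finset.sum_congr rfl fun ν _ => ?_
    simp only [← Finset.mul_sum, hGB']
    ring
  have e6 : ∀ a b, A c a * A d b * ∑ μ, (∑ ν, A j ν * momentum G G⁻¹ v F α μ ν a b) * B μ i =
      v * F * ((A c a * B a i) * ((∑ ν, A j ν * G⁻¹ ν b) * A d b))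
      - v * F * (((∑ ν, A j ν * G⁻¹ ν a) * A c a) * (A d b * B b i))
      + 2 * α * minkowski i i * ∑ m, ∑ ν, A i m * A j ν * A c a * A d b * symb m ν a b := by
    intro a b
    rw [split]
    have : A c a * A d b * ∑ m, ∑ ν, A i m * A j ν * minkowski i i * symb m ν a b =
        minkowski i i * ∑ m, ∑ ν, A i m * A j ν * A c a * A d b * symb m ν a b := by
      simp only [Finset.mul_sum]
      refine Finset.sum_congr rfl fun m _ => Finset.sum_congr rfl fun ν _ => ?_
      ring
    linear_combination 2 * α * this
  simp only [e6, Finset.sum_add_distrib, Finset.sum_sub_distrib, ← Finset.mul_sum]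
  have e7 : ∑ a, ∑ b, ∑ m, ∑ ν, A i m * A j ν * A c a * A d b * symb m ν a b =
      ∑ m, ∑ ν, ∑ a, ∑ b, A i m * A j ν * A c a * A d b * symb m ν a b := by
    calc _ = ∑ a, ∑ m, ∑ b, ∑ ν, A i m * A j ν * A c a * A d b * symb m ν a b :=
          Finset.sum_congr rfl fun a _ => Finset.sum_comm
      _ = ∑ m, ∑ a, ∑ b, ∑ ν, A i m * A j ν * A c a * A d b * symb m ν a b := Finset.sum_comm
      _ = ∑ m, ∑ a, ∑ ν, ∑ b, A i m * A j ν * A c a * A d b * symb m ν a b :=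
          Finset.sum_congr rfl fun m _ => Finset.sum_congr rfl fun a _ => Finset.sum_comm
      _ = _ := Finset.sum_congr rfl fun m _ => Finset.sum_comm
  -- The symbol transforms with the determinant of the frame. This is the origin of `α * A.det`.
  rw [e7, sum_rows_mul_symb]
  simp only [← Finset.sum_mul, hAB', hη', momentum]
  have e8 : ∑ m, minkowski m i * symb m j c d = minkowski i i * symb i j c d := by
    simp only [minkowski, Matrix.diagonal_apply, ite_mul, zero_mul, Finset.sum_ite_eq',
      Finset.mem_univ, if_true]
  rw [e8]
  simp only [eq_comm (a := c) (b := i), eq_comm (a := d) (b := i)]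
  ring

/-- The only solutions of the homogeneous connection equation are projective. -/
theorem kernel_lorentz {G A : Matrix (Fin 4) (Fin 4) ℝ} (hA : A.det ≠ 0)
    (hG : G = A.transpose * minkowski * A) {v F α : ℝ} (hvF : v * F ≠ 0)
    {D : Fin 4 → Fin 4 → Fin 4 → ℝ} (H : ∀ μ ν b, bracket (momentum G G⁻¹ v F α) D μ ν b = 0) :
    ∃ ξ : Fin 4 → ℝ, ∀ l m n, D l m n = (if l = m then 1 else 0) * ξ n := by
  have hu : IsUnit A.det := isUnit_iff_ne_zero.2 hA
  obtain ⟨B, hB⟩ : ∃ B, B = A⁻¹ := ⟨_, rfl⟩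
  have hAB : A * B = 1 := by rw [hB]; exact Matrix.mul_nonsing_inv A hu
  have hBA : B * A = 1 := mul_eq_one_comm.1 hAB
  -- With the form indices a, b as labels, the connection equation becomes the matrix identity Σ_a
  -- (P_ab N_a + N_a P_ba) = 0. Conjugating by the frame respects it, and the form indices are
  -- changed separately with A and B.
  let Pm : Fin 4 → Fin 4 → Matrix (Fin 4) (Fin 4) ℝ := fun a b =>
    Matrix.of fun ν μ => momentum G G⁻¹ v F α μ ν a b
  let Nm : Fin 4 → Matrix (Fin 4) (Fin 4) ℝ := fun a => Matrix.of fun l m => D l m a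
  let N' : Fin 4 → Matrix (Fin 4) (Fin 4) ℝ := fun c => ∑ a, B a c • (A * Nm a * B)
  let P' : Fin 4 → Fin 4 → Matrix (Fin 4) (Fin 4) ℝ := fun c d =>
    ∑ a, ∑ b, (A c a * A d b) • (A * Pm a b * B)
  have hP' : ∀ i j c d, P' c d j i = momentum minkowski minkowski v F (α * A.det) i j c d := by
    intro i j c d
    rw [← momentum_frame hAB hG]
    simp only [P', Matrix.sum_apply, Matrix.smul_apply, Matrix.mul_apply, smul_eq_mul, Pm,
      Matrix.of_apply]
  have hN' : ∀ a, ∑ c, A c a • N' c = A * Nm a * B := by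
    intro a
    simp only [N', Finset.smul_sum, smul_smul]
    rw [Finset.sum_comm]
    simp only [← Finset.sum_smul]
    have : ∀ a', ∑ c, A c a * B a' c = if a' = a then 1 else 0 := by
      intro a'
      rw [← Matrix.one_apply, ← hBA, Matrix.mul_apply]
      exact Finset.sum_congr rfl fun c _ => mul_comm _ _
    simp [this]
  have hK : ∀ b, ∑ a, (Pm a b * Nm a + Nm a * Pm b a) = 0 := by
    intro b
    ext ν μ
    have := H μ ν b
    rw [bracket, Finset.sum_comm] at this
    simp only [Matrix.sum_apply, Matrix.add_apply, Matrix.mul_apply, Pm, Nm, Matrix.of_apply,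
      Matrix.zero_apply, ← Finset.sum_add_distrib]
    rw [← this]
    refine Finset.sum_congr rfl fun a _ => Finset.sum_congr rfl fun r _ => ?_
    ring
  have hK' : ∀ d, ∑ c, (P' c d * N' c + N' c * P' d c) = 0 := by
    intro d
    have e1 : ∑ c, P' c d * N' c = ∑ b, A d b • (A * (∑ a, Pm a b * Nm a) * B) := by
      calc ∑ c, P' c d * N' c
          = ∑ c, ∑ a, ∑ b, A d b • ((A * Pm a b * B) * (A c a • N' c)) := by
            refine Finset.sum_congr rfl fun c _ => ?_
            simp only [P', Finset.sum_mul]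
            refine Finset.sum_congr rfl fun a _ => Finset.sum_congr rfl fun b _ => ?_
            rw [Matrix.smul_mul, Matrix.mul_smul, smul_smul, mul_comm]
        _ = ∑ a, ∑ b, ∑ c, A d b • ((A * Pm a b * B) * (A c a • N' c)) := by
            rw [Finset.sum_comm]
            exact Finset.sum_congr rfl fun a _ => Finset.sum_comm
        _ = ∑ b, ∑ a, A d b • ((A * Pm a b * B) * (A * Nm a * B)) := by
            rw [Finset.sum_comm]
            simp only [← Finset.smul_sum, ← Finset.mul_sum, hN']
        _ = _ := by
            refine Finset.sum_congr rfl fun b _ => ?_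
            rw [← Finset.smul_sum, Finset.mul_sum, Finset.sum_mul]
            congr 1
            refine Finset.sum_congr rfl fun a _ => ?_
            calc A * Pm a b * B * (A * Nm a * B) = A * Pm a b * (B * A) * Nm a * B := by
                  simp only [Matrix.mul_assoc]
              _ = _ := by rw [hBA, Matrix.mul_one]; simp only [Matrix.mul_assoc]
    have e2 : ∑ c, N' c * P' d c = ∑ b, A d b • (A * (∑ a, Nm a * Pm b a) * B) := by
      calc ∑ c, N' c * P' d c
          = ∑ c, ∑ b, ∑ a, A d b • ((A c a • N' c) * (A * Pm b a * B)) := by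
            refine Finset.sum_congr rfl fun c _ => ?_
            simp only [P', Finset.mul_sum]
            refine Finset.sum_congr rfl fun a _ => Finset.sum_congr rfl fun b _ => ?_
            rw [Matrix.smul_mul, Matrix.mul_smul, smul_smul]
        _ = ∑ b, ∑ a, ∑ c, A d b • ((A c a • N' c) * (A * Pm b a * B)) := by
            rw [Finset.sum_comm]
            exact Finset.sum_congr rfl fun a _ => Finset.sum_comm
        _ = ∑ b, ∑ a, A d b • ((A * Nm a * B) * (A * Pm b a * B)) := by
            simp only [← Finset.smul_sum, ← Finset.sum_mul, hN']
        _ = _ := by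
            refine Finset.sum_congr rfl fun b _ => ?_
            rw [← Finset.smul_sum, Finset.mul_sum, Finset.sum_mul]
            congr 1
            refine Finset.sum_congr rfl fun a _ => ?_
            calc A * Nm a * B * (A * Pm b a * B) = A * Nm a * (B * A) * Pm b a * B := by
                  simp only [Matrix.mul_assoc]
              _ = _ := by rw [hBA, Matrix.mul_one]; simp only [Matrix.mul_assoc]
    rw [Finset.sum_add_distrib, e1, e2, ← Finset.sum_add_distrib]
    refine Finset.sum_eq_zero fun b _ => ?_
    rw [← smul_add, ← Matrix.add_mul, ← Matrix.mul_add, ← Finset.sum_add_distrib, hK b]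
    simp
  -- In the frame the momentum is the Minkowski one with a rescaled α, which the kernel statement
  -- allows.
  have ker := kernel_minkowski hvF (N := fun i j c => N' c i j) (α := α * A.det) (by
    intro i j d
    have h := congrFun (congrFun (hK' d) j) i
    simp only [Matrix.sum_apply, Matrix.add_apply, Matrix.mul_apply, Matrix.zero_apply, hP',
      ← Finset.sum_add_distrib] at h
    rw [bracket, Finset.sum_comm, ← h]
    refine Finset.sum_congr rfl fun a _ => Finset.sum_congr rfl fun r _ => ?_
    ring)
  have hN1 : ∀ c, N' c = N' c c c • (1 : Matrix (Fin 4) (Fin 4) ℝ) := by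
    intro c
    ext i j
    rw [Matrix.smul_apply, Matrix.one_apply, smul_eq_mul, mul_comm]
    exact ker i j c
  refine ⟨fun a => ∑ c, A c a * N' c c c, fun l m n => ?_⟩
  have e : Nm n = (∑ c, A c n * N' c c c) • (1 : Matrix (Fin 4) (Fin 4) ℝ) := by
    calc Nm n = (B * A) * Nm n * (B * A) := by rw [hBA]; simp
      _ = B * (A * Nm n * B) * A := by simp only [Matrix.mul_assoc]
      _ = B * (∑ c, A c n • N' c) * A := by rw [hN']
      _ = B * (∑ c, A c n • (N' c c c • (1 : Matrix (Fin 4) (Fin 4) ℝ))) * A := by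
          rw [Finset.sum_congr rfl fun c _ => congrArg (A c n • ·) (hN1 c)]
      _ = _ := by
          simp only [smul_smul, ← Finset.sum_smul]
          rw [Matrix.mul_smul, Matrix.smul_mul, Matrix.mul_one, hBA]
  have := congrFun (congrFun e l) m
  rw [Matrix.smul_apply, Matrix.one_apply, smul_eq_mul, mul_comm] at this
  exact this

end MAG

end

noncomputable section

namespace MAG

/-! ### Families of fields, smooth in parameters and coordinates -/

/-- The family `F` of functions is jointly smooth in the parameter and the coordinates at `(e, x)`. -/
def SmoothAt {E : Type*} [NormedAddCommGroup E] [NormedSpace ℝ E] (F : E → Pt → ℝ) (e : E)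
    (x : Pt) : Prop :=
  ContDiffAt ℝ ∞ (fun p : E × Pt => F p.1 p.2) (e, x)

section smooth

variable {E : Type*} [NormedAddCommGroup E] [NormedSpace ℝ E] {F H : E → Pt → ℝ} {e : E} {x : Pt}

theorem SmoothAt.add (hF : SmoothAt F e x) (hH : SmoothAt H e x) :
    SmoothAt (fun e y => F e y + H e y) e x :=
  ContDiffAt.add hF hH

theorem SmoothAt.sub (hF : SmoothAt F e x) (hH : SmoothAt H e x) :
    SmoothAt (fun e y => F e y - H e y) e x :=
  ContDiffAt.sub hF hH

theorem SmoothAt.neg (hF : SmoothAt F e x) : SmoothAt (fun e y => -F e y) e x :=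
  ContDiffAt.neg hF

theorem SmoothAt.mul (hF : SmoothAt F e x) (hH : SmoothAt H e x) :
    SmoothAt (fun e y => F e y * H e y) e x :=
  ContDiffAt.mul hF hH

theorem SmoothAt.div (hF : SmoothAt F e x) (hH : SmoothAt H e x) (h : H e x ≠ 0) :
    SmoothAt (fun e y => F e y / H e y) e x :=
  ContDiffAt.div hF hH h

theorem SmoothAt.const (c : ℝ) : SmoothAt (fun (_ : E) _ => c) e x :=
  contDiffAt_const

theorem SmoothAt.comp {φ : ℝ → ℝ} (hφ : ContDiffAt ℝ ∞ φ (F e x)) (hF : SmoothAt F e x) :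
    SmoothAt (fun e y => φ (F e y)) e x :=
  ContDiffAt.comp (x := (e, x)) (g := φ) (f := fun p : E × Pt => F p.1 p.2) hφ hF

theorem SmoothAt.sum {ι : Type*} {s : Finset ι} {F : ι → E → Pt → ℝ}
    (h : ∀ i ∈ s, SmoothAt (F i) e x) : SmoothAt (fun e y => ∑ i ∈ s, F i e y) e x :=
  ContDiffAt.sum h

theorem SmoothAt.prod {ι : Type*} {s : Finset ι} {F : ι → E → Pt → ℝ}
    (h : ∀ i ∈ s, SmoothAt (F i) e x) : SmoothAt (fun e y => ∏ i ∈ s, F i e y) e x :=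
  contDiffAt_prod h

theorem SmoothAt.of_field {φ : Pt → ℝ} (h : ContDiffAt ℝ ∞ φ x) : SmoothAt (fun _ : E => φ) e x :=
  ContDiffAt.comp (x := (e, x)) (g := φ) (f := fun p : E × Pt => p.2) h contDiffAt_snd

theorem SmoothAt.of_param {φ : E → ℝ} (h : ContDiffAt ℝ ∞ φ e) : SmoothAt (fun e _ => φ e) e x :=
  ContDiffAt.comp (x := (e, x)) (g := φ) (f := fun p : E × Pt => p.1) h contDiffAt_fst

theorem SmoothAt.field (h : SmoothAt F e x) : ContDiffAt ℝ ∞ (F e) x :=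
  ContDiffAt.comp (x := x) (g := fun p : E × Pt => F p.1 p.2) (f := fun y : Pt => (e, y)) h
    (contDiffAt_const.prodMk contDiffAt_id)

theorem SmoothAt.param (h : SmoothAt F e x) : ContDiffAt ℝ ∞ (fun e => F e x) e :=
  ContDiffAt.comp (x := e) (g := fun p : E × Pt => F p.1 p.2) (f := fun y : E => (y, x)) h
    (contDiffAt_id.prodMk contDiffAt_const)

theorem SmoothAt.reparam {E' : Type*} [NormedAddCommGroup E'] [NormedSpace ℝ E'] {r : E' → E}
    {e' : E'} (hF : SmoothAt F (r e') x) (hr : ContDiffAt ℝ ∞ r e') :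
    SmoothAt (fun e' => F (r e')) e' x :=
  ContDiffAt.comp (x := (e', x)) (g := fun p : E × Pt => F p.1 p.2)
    (f := fun p : E' × Pt => (r p.1, p.2)) hF
    ((ContDiffAt.comp (x := (e', x)) (g := r) (f := Prod.fst) hr contDiffAt_fst).prodMk
      contDiffAt_snd)

theorem SmoothAt.pd (μ : Fin 4) (hF : SmoothAt F e x) :
    SmoothAt (fun e => MAG.pd μ (F e)) e x := by
  have h : ContDiffAt ℝ ∞ (fun p : E × Pt => fderiv ℝ (F p.1) p.2) (e, x) := by
    refine ContDiffAt.fderiv (n := ∞) (f := fun (p : E × Pt) y => F p.1 y)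
      (g := fun p : E × Pt => p.2) ?_ contDiffAt_snd (by simp)
    exact ContDiffAt.comp (x := ((e, x), x)) (g := fun p : E × Pt => F p.1 p.2)
      (f := fun p : (E × Pt) × Pt => (p.1.1, p.2)) hF
      ((contDiffAt_fst.fst).prodMk contDiffAt_snd)
  exact h.clm_apply contDiffAt_const

/-- The components of a family of metrics are smooth, and the metrics have negative determinant. -/
structure SmoothMetricAt (g : E → MetricField) (e : E) (x : Pt) : Prop where
  comp : ∀ μ ν, SmoothAt (fun e y => g e y μ ν) e x
  det_neg : (g e x).det < 0

/-- The components of a family of connections are smooth. -/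
def SmoothConnAt (Γ : E → ConnField) (e : E) (x : Pt) : Prop :=
  ∀ l μ ν, SmoothAt (fun e y => Γ e y l μ ν) e x

theorem smoothAt_det {g : E → MetricField} (hg : ∀ μ ν, SmoothAt (fun e y => g e y μ ν) e x) :
    SmoothAt (fun e y => (g e y).det) e x := by
  simp only [Matrix.det_apply']
  exact SmoothAt.sum fun s _ => (SmoothAt.const _).mul (SmoothAt.prod fun i _ => hg _ _)

variable {g : E → MetricField} {Γ : E → ConnField} (hg : SmoothMetricAt g e x)
  (hΓ : SmoothConnAt Γ e x)

include hg

theorem SmoothMetricAt.ginv (μ ν : Fin 4) : SmoothAt (fun e y => MAG.ginv (g e) y μ ν) e x := by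
  have h : ∀ e y, MAG.ginv (g e) y μ ν = (g e y).adjugate μ ν / (g e y).det := by
    intro e y
    rw [MAG.ginv, Matrix.inv_def, Matrix.smul_apply, Ring.inverse_eq_inv', smul_eq_mul, div_eq_inv_mul]
  simp only [h]
  refine SmoothAt.div ?_ (smoothAt_det hg.comp) hg.det_neg.ne
  simp only [Matrix.adjugate_apply]
  refine smoothAt_det (g := fun e y => (g e y).updateRow ν (Pi.single μ 1)) fun i j => ?_
  by_cases hi : i = ν
  · subst hi
    simp only [Matrix.updateRow_self]
    exact SmoothAt.const _
  · simp only [Matrix.updateRow_ne hi]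
    exact hg.comp i j

theorem SmoothMetricAt.vol : SmoothAt (fun e => MAG.vol (g e)) e x := by
  have h := (smoothAt_det hg.comp).neg
  exact SmoothAt.comp (φ := Real.sqrt) (Real.contDiffAt_sqrt (by linarith [hg.det_neg])) h

theorem SmoothMetricAt.vol_pos : 0 < MAG.vol (g e) x :=
  Real.sqrt_pos.2 (by linarith [hg.det_neg])

theorem SmoothMetricAt.leviCivita : SmoothConnAt (fun e => MAG.leviCivita (g e)) e x :=
  fun l μ ν => (SmoothAt.const _).mul (SmoothAt.sum fun r _ => (hg.ginv r l).mul
    ((((hg.comp ν r).pd μ).add ((hg.comp r μ).pd ν)).sub ((hg.comp μ ν).pd r)))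

omit hg in
include hΓ in
theorem SmoothConnAt.riem (μ ν a b : Fin 4) : SmoothAt (fun e y => MAG.riem (Γ e) y μ ν a b) e x :=
  (((hΓ μ ν b).pd a).sub ((hΓ μ ν a).pd b)).add (SmoothAt.sum fun r _ =>
    ((hΓ μ r a).mul (hΓ r ν b)).sub ((hΓ μ r b).mul (hΓ r ν a)))

include hΓ in
theorem SmoothMetricAt.scal : SmoothAt (fun e => MAG.scal (g e) (Γ e)) e x :=
  SmoothAt.sum fun μ _ => SmoothAt.sum fun ν _ => (hg.ginv μ ν).mul
    (SmoothAt.sum fun r _ => hΓ.riem r μ r ν)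

theorem SmoothMetricAt.epsUp (a b c d : Fin 4) :
    SmoothAt (fun e y => MAG.epsUp (g e) y a b c d) e x :=
  (SmoothAt.const _).div hg.vol hg.vol_pos.ne'

include hΓ in
theorem SmoothMetricAt.holst : SmoothAt (fun e => MAG.holst (g e) (Γ e)) e x :=
  SmoothAt.sum fun μ _ => SmoothAt.sum fun ν _ => SmoothAt.sum fun a _ => SmoothAt.sum fun b _ =>
    (hg.epsUp μ ν a b).mul (SmoothAt.sum fun r _ => (hg.comp μ r).mul (hΓ.riem r ν a b))

theorem SmoothMetricAt.gradSq {Ψ : E → Pt → ℝ} (hΨ : SmoothAt Ψ e x) :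
    SmoothAt (fun e => MAG.gradSq (g e) (Ψ e)) e x :=
  SmoothAt.sum fun μ _ => SmoothAt.sum fun ν _ => ((hg.ginv μ ν).mul (hΨ.pd μ)).mul (hΨ.pd ν)

end smooth

/-! ### Fields built from the metric, a connection and a scalar -/

/-- The momentum of the curvature, as a field. -/
def momentumField (α : ℝ) (g : MetricField) (Ψ : Pt → ℝ) (x : Pt) :
    Fin 4 → Fin 4 → Fin 4 → Fin 4 → ℝ :=
  momentum (g x) (g x)⁻¹ (vol g x) (Ψ x) α

/-- The boundary current of the curvature term for a shift `M` of the connection. -/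
def flux (α : ℝ) (g : MetricField) (Ψ : Pt → ℝ) (M : ConnField) (a : Fin 4) (x : Pt) : ℝ :=
  ∑ μ, ∑ ν, ∑ b, momentumField α g Ψ x μ ν a b * M x μ ν b

/-- The one-form `-3 dΦ` with `Ψ = 2 α tan Φ`. -/
def axialForm (α : ℝ) (Ψ : Pt → ℝ) (x : Pt) (d : Fin 4) : ℝ :=
  -(6 * α) * pd d Ψ x / (Ψ x ^ 2 + 4 * α ^ 2)

/-- The metric-compatible connection that solves the connection equation for `g` and `Ψ`. -/
def scalarConn (α : ℝ) (g : MetricField) (Ψ : Pt → ℝ) : ConnField := fun x l m n =>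
  leviCivita g x l m n
    + contortion (g x) (g x)⁻¹ (vol g x) (Ψ x) α (axialForm α Ψ x) l m n

/-- The first-order Lagrangian density with independent scalar `Ψ` and potential term `W`. -/
def lagFirst (α : ℝ) (g : MetricField) (Γ : ConnField) (Ψ W : Pt → ℝ) (x : Pt) : ℝ :=
  vol g x * (Ψ x * scal g Γ x + W x + α * holst g Γ x)

section smoothFields

variable {E : Type*} [NormedAddCommGroup E] [NormedSpace ℝ E] {e : E} {x : Pt}
  {g : E → MetricField} {Γ : E → ConnField} {Ψ W : E → Pt → ℝ} (hg : SmoothMetricAt g e x)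
  (hΓ : SmoothConnAt Γ e x) (hΨ : SmoothAt Ψ e x) {α : ℝ}

include hg

theorem SmoothMetricAt.momentumField (α : ℝ) (hΨ : SmoothAt Ψ e x) (μ ν a b : Fin 4) :
    SmoothAt (fun e y => MAG.momentumField α (g e) (Ψ e) y μ ν a b) e x :=
  ((hg.vol.mul hΨ).mul (((SmoothAt.const _).mul (hg.ginv ν b)).sub
    ((SmoothAt.const _).mul (hg.ginv ν a)))).add
    ((SmoothAt.const _).mul (SmoothAt.sum fun m _ => (hg.comp m μ).mul (SmoothAt.const _)))

theorem SmoothMetricAt.flux (α : ℝ) (hΨ : SmoothAt Ψ e x) (hΓ : SmoothConnAt Γ e x) (a : Fin 4) :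
    SmoothAt (fun e => MAG.flux α (g e) (Ψ e) (Γ e) a) e x :=
  SmoothAt.sum fun μ _ => SmoothAt.sum fun ν _ => SmoothAt.sum fun b _ =>
    (hg.momentumField α hΨ μ ν a b).mul (hΓ μ ν b)

omit hg in
theorem SmoothAt.axialForm (hα : α ≠ 0) (hΨ : SmoothAt Ψ e x) (d : Fin 4) :
    SmoothAt (fun e y => MAG.axialForm α (Ψ e) y d) e x := by
  refine ((SmoothAt.const _).mul (hΨ.pd d)).div ?_ (by positivity)
  simp only [pow_two]
  exact (hΨ.mul hΨ).add (SmoothAt.const _)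

theorem SmoothMetricAt.scalarConn (hα : α ≠ 0) (hΨ : SmoothAt Ψ e x) :
    SmoothConnAt (fun e => MAG.scalarConn α (g e) (Ψ e)) e x := by
  intro l m n
  refine (hg.leviCivita l m n).add ((((SmoothAt.const _).div ((SmoothAt.const _).mul hg.vol) ?_).mul
    (SmoothAt.sum fun c _ => (SmoothAt.sum fun b _ => (SmoothAt.sum fun d _ =>
      (SmoothAt.const _).mul (hΨ.axialForm hα d)).mul (hg.comp b m)).mul (hg.comp c n))).add
    ((hΨ.div (SmoothAt.const _) (by simpa using hα)).mul (((hg.comp m n).mul (SmoothAt.sum fun d _ =>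
      (hg.ginv l d).mul (hΨ.axialForm hα d))).sub ((SmoothAt.const _).mul (hΨ.axialForm hα m)))))
  have := hg.vol_pos
  positivity

theorem SmoothMetricAt.lagFirst (α : ℝ) (hΓ : SmoothConnAt Γ e x) (hΨ : SmoothAt Ψ e x)
    (hW : SmoothAt W e x) : SmoothAt (fun e => MAG.lagFirst α (g e) (Γ e) (Ψ e) (W e)) e x :=
  hg.vol.mul (((hΨ.mul (hg.scal hΓ)).add hW).add ((SmoothAt.const _).mul (hg.holst hΓ)))

theorem SmoothMetricAt.pairing (α : ℝ) (hΓ : SmoothConnAt Γ e x) (hΨ : SmoothAt Ψ e x) :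
    SmoothAt (fun e y => MAG.pairing (MAG.momentumField α (g e) (Ψ e) y) (Γ e y) (Γ e y)) e x :=
  SmoothAt.sum fun μ _ => SmoothAt.sum fun ν _ => SmoothAt.sum fun a _ => SmoothAt.sum fun b _ =>
    SmoothAt.sum fun r _ => (hg.momentumField α hΨ μ ν a b).mul ((hΓ μ r a).mul (hΓ r ν b))

end smoothFields

/-! ### Locality -/

section locality

open Filter Topology

variable {x : Pt} {g g' : MetricField} {Γ Γ' : ConnField} {Ψ Ψ' W W' : Pt → ℝ}

theorem pd_congr {F F' : Pt → ℝ} (μ : Fin 4) (h : F =ᶠ[𝓝 x] F') : pd μ F x = pd μ F' x := by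
  rw [pd, pd, h.fderiv_eq]

theorem leviCivita_congr (hg : g =ᶠ[𝓝 x] g') : leviCivita g x = leviCivita g' x := by
  have h : ∀ (c : Fin 4) μ ν, pd c (fun y => g y μ ν) x = pd c (fun y => g' y μ ν) x :=
    fun c μ ν => pd_congr c (hg.mono fun y hy => by simp only [hy])
  funext l μ ν
  simp only [leviCivita, h, ginv, hg.eq_of_nhds]

theorem leviCivita_eventuallyEq (hg : g =ᶠ[𝓝 x] g') : leviCivita g =ᶠ[𝓝 x] leviCivita g' := by
  filter_upwards [hg.eventuallyEq_nhds] with y hy using leviCivita_congr hy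

theorem riem_congr (hΓ : Γ =ᶠ[𝓝 x] Γ') : riem Γ x = riem Γ' x := by
  have h : ∀ (c : Fin 4) l μ ν, pd c (fun y => Γ y l μ ν) x = pd c (fun y => Γ' y l μ ν) x :=
    fun c l μ ν => pd_congr c (hΓ.mono fun y hy => by simp only [hy])
  funext μ ν a b
  simp only [riem, h, hΓ.eq_of_nhds]

theorem scal_congr (hg : g x = g' x) (hΓ : Γ =ᶠ[𝓝 x] Γ') : scal g Γ x = scal g' Γ' x := by
  simp only [scal, ricci, riem_congr hΓ, ginv, hg]

theorem holst_congr (hg : g x = g' x) (hΓ : Γ =ᶠ[𝓝 x] Γ') : holst g Γ x = holst g' Γ' x := by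
  simp only [holst, riem_congr hΓ, epsUp, vol, hg]

theorem lagMAG_congr (κ α : ℝ) (f : ℝ → ℝ) (hg : g x = g' x) (hΓ : Γ =ᶠ[𝓝 x] Γ') :
    lagMAG κ α f g Γ x = lagMAG κ α f g' Γ' x := by
  simp only [lagMAG, scal_congr hg hΓ, holst_congr hg hΓ, vol, hg]

theorem lagFirst_congr (α : ℝ) (hg : g x = g' x) (hΓ : Γ =ᶠ[𝓝 x] Γ') (hΨ : Ψ x = Ψ' x)
    (hW : W x = W' x) : lagFirst α g Γ Ψ W x = lagFirst α g' Γ' Ψ' W' x := by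
  simp only [lagFirst, scal_congr hg hΓ, holst_congr hg hΓ, vol, hg, hΨ, hW]

theorem gradSq_congr (hg : g x = g' x) (hΨ : Ψ =ᶠ[𝓝 x] Ψ') : gradSq g Ψ x = gradSq g' Ψ' x := by
  simp only [gradSq, ginv, hg, pd_congr _ hΨ]

theorem lagST_congr (κ α : ℝ) (V : ℝ → ℝ) (hg : g =ᶠ[𝓝 x] g') (hΨ : Ψ =ᶠ[𝓝 x] Ψ') :
    lagST κ α V g Ψ x = lagST κ α V g' Ψ' x := by
  simp only [lagST, scalLC, gradSq_congr hg.eq_of_nhds hΨ, vol, hg.eq_of_nhds, hΨ.eq_of_nhds,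
    scal_congr hg.eq_of_nhds (leviCivita_eventuallyEq hg)]

theorem axialForm_congr (α : ℝ) (hΨ : Ψ =ᶠ[𝓝 x] Ψ') : axialForm α Ψ x = axialForm α Ψ' x := by
  funext d
  simp only [axialForm, pd_congr _ hΨ, hΨ.eq_of_nhds]

theorem scalarConn_congr (α : ℝ) (hg : g =ᶠ[𝓝 x] g') (hΨ : Ψ =ᶠ[𝓝 x] Ψ') :
    scalarConn α g Ψ x = scalarConn α g' Ψ' x := by
  funext l m n
  simp only [scalarConn, leviCivita_congr hg, axialForm_congr α hΨ, vol, hg.eq_of_nhds,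
    hΨ.eq_of_nhds]

end locality

end MAG

end

noncomputable section

namespace MAG

open Filter Topology

/-! ### Calculus of the Levi-Civita connection -/

/-! ### Rules for partial derivatives -/

section pdRules

variable {x : Pt} {F H : Pt → ℝ}

theorem pd_add (c : Fin 4) (hF : DifferentiableAt ℝ F x) (hH : DifferentiableAt ℝ H x) :
    pd c (fun y => F y + H y) x = pd c F x + pd c H x := by
  simp only [pd, fderiv_fun_add hF hH, add_apply]

theorem pd_sub (c : Fin 4) (hF : DifferentiableAt ℝ F x) (hH : DifferentiableAt ℝ H x) :
    pd c (fun y => F y - H y) x = pd c F x - pd c H x := by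
  simp only [pd, fderiv_fun_sub hF hH, sub_apply]

theorem pd_mul (c : Fin 4) (hF : DifferentiableAt ℝ F x) (hH : DifferentiableAt ℝ H x) :
    pd c (fun y => F y * H y) x = pd c F x * H x + F x * pd c H x := by
  simp only [pd, fderiv_fun_mul hF hH, add_apply, smul_apply, smul_eq_mul]
  ring

theorem pd_const_mul (c : Fin 4) (k : ℝ) (hF : DifferentiableAt ℝ F x) :
    pd c (fun y => k * F y) x = k * pd c F x := by
  simp only [pd, fderiv_const_mul hF, smul_apply, smul_eq_mul]

theorem pd_const (c : Fin 4) (k : ℝ) : pd c (fun _ => k) x = 0 := by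
  simp [pd]

theorem pd_sum {ι : Type*} (s : Finset ι) (c : Fin 4) {F : ι → Pt → ℝ}
    (hF : ∀ i ∈ s, DifferentiableAt ℝ (F i) x) :
    pd c (fun y => ∑ i ∈ s, F i y) x = ∑ i ∈ s, pd c (F i) x := by
  simp only [pd, fderiv_fun_sum hF, sum_apply]

theorem pd_comp (c : Fin 4) {φ : ℝ → ℝ} (hφ : DifferentiableAt ℝ φ (F x))
    (hF : DifferentiableAt ℝ F x) :
    pd c (fun y => φ (F y)) x = deriv φ (F x) * pd c F x := by
  have := (hφ.hasDerivAt.comp_hasFDerivAt x hF.hasFDerivAt).fderiv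
  simp only [pd]
  rw [show (fun y => φ (F y)) = φ ∘ F from rfl, this, smul_apply, smul_eq_mul]

end pdRules

theorem SmoothAt.differentiableAt {E : Type*} [NormedAddCommGroup E] [NormedSpace ℝ E]
    {F : E → Pt → ℝ} {e : E} {x : Pt} (h : SmoothAt F e x) : DifferentiableAt ℝ (F e) x :=
  h.field.differentiableAt (by simp)

/-- Jacobi's formula: differentiating the Leibniz expansion replaces one column at a time by its
derivative, and Cramer's rule expands each of these determinants through the adjugate. -/
theorem pd_det {g : MetricField} {x : Pt} (hg : ∀ μ ν, DifferentiableAt ℝ (fun y => g y μ ν) x)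
    (c : Fin 4) :
    pd c (fun y => (g y).det) x = ∑ i, ∑ j, pd c (fun y => g y i j) x * (g x).adjugate j i := by
  have h1 : HasFDerivAt (fun y => (g y).det)
      (∑ s : Equiv.Perm (Fin 4), (Equiv.Perm.sign s : ℝ) •
        ∑ j, (∏ k ∈ Finset.univ.erase j, g x (s k) k) • fderiv ℝ (fun y => g y (s j) j) x) x := by
    simp only [Matrix.det_apply']
    refine HasFDerivAt.fun_sum fun s _ => HasFDerivAt.const_mul ?_ _
    exact HasFDerivAt.finsetProd fun j _ => (hg (s j) j).hasFDerivAt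
  have h2 : ∀ j, ∑ i, pd c (fun y => g y i j) x * (g x).adjugate j i =
      ((g x).updateCol j fun i => pd c (fun y => g y i j) x).det := by
    intro j
    rw [← Matrix.cramer_apply, Matrix.cramer_eq_adjugate_mulVec]
    simp only [Matrix.mulVec, dotProduct]
    exact Finset.sum_congr rfl fun i _ => mul_comm _ _
  rw [pd, h1.fderiv, Finset.sum_comm]
  simp only [h2, Matrix.det_apply']
  rw [Finset.sum_comm]
  simp only [sum_apply, smul_apply, smul_eq_mul]
  refine Finset.sum_congr rfl fun s _ => ?_
  rw [Finset.mul_sum]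
  refine Finset.sum_congr rfl fun j _ => ?_
  rw [← Finset.mul_prod_erase Finset.univ _ (Finset.mem_univ j), Matrix.updateCol_self]
  have : ∏ k ∈ Finset.univ.erase j, ((g x).updateCol j fun i => pd c (fun y => g y i j) x) (s k) k
      = ∏ k ∈ Finset.univ.erase j, g x (s k) k :=
    Finset.prod_congr rfl fun k hk => by rw [Matrix.updateCol_ne (Finset.ne_of_mem_erase hk)]
  rw [this]
  simp only [pd]
  ring

/-! ### Metric compatibility and the derivatives of the inverse metric and the volume -/

section leviCivita

variable {g : MetricField} {x : Pt} (hg : SmoothMetricAt (fun _ : ℝ => g) 0 x)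
  (hs : ∀ᶠ y in 𝓝 x, ∀ μ ν, g y ν μ = g y μ ν)

theorem ginv_mul_sum (h : (g x).det ≠ 0) (i j : Fin 4) :
    ∑ k, ginv g x i k * g x k j = if i = j then 1 else 0 := by
  rw [← Matrix.one_apply, ← Matrix.nonsing_inv_mul (g x) (isUnit_iff_ne_zero.2 h), Matrix.mul_apply]
  rfl

theorem ginv_symm (h : ∀ μ ν, g x ν μ = g x μ ν) (i j : Fin 4) : ginv g x j i = ginv g x i j := by
  have h1 : (g x).transpose = g x := by
    ext i j
    exact h i j
  have h2 := Matrix.transpose_nonsing_inv (g x)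
  rw [h1] at h2
  exact congrFun (congrFun h2 i) j

include hs in
theorem pd_metric_symm (c μ ν : Fin 4) :
    pd c (fun y => g y ν μ) x = pd c (fun y => g y μ ν) x :=
  pd_congr c (hs.mono fun _ hy => hy μ ν)

include hs in
theorem leviCivita_symm (l μ ν : Fin 4) : leviCivita g x l ν μ = leviCivita g x l μ ν := by
  simp only [leviCivita]
  congr 1
  refine Finset.sum_congr rfl fun r _ => ?_
  rw [pd_metric_symm hs r μ ν, pd_metric_symm hs ν μ r, pd_metric_symm hs μ r ν]
  ring

include hs in
theorem leviCivita_lower (hd : (g x).det ≠ 0) (n μ c : Fin 4) :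
    ∑ r, leviCivita g x r μ c * g x r n = (1 / 2) *
      (pd μ (fun y => g y c n) x + pd c (fun y => g y n μ) x - pd n (fun y => g y μ c) x) := by
  have hsx := hs.self_of_nhds
  have key : ∀ X : Fin 4 → ℝ, ∑ r, (∑ s, ginv g x s r * X s) * g x r n = X n := by
    intro X
    have : ∀ r, (∑ s, ginv g x s r * X s) * g x r n = ∑ s, X s * (ginv g x s r * g x r n) := by
      intro r
      rw [Finset.sum_mul]
      exact Finset.sum_congr rfl fun s _ => by ring
    simp only [this]
    rw [Finset.sum_comm]
    simp only [← Finset.mul_sum, ginv_mul_sum hd]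
    simp
  have := key fun s => pd μ (fun y => g y c s) x + pd c (fun y => g y s μ) x
    - pd s (fun y => g y μ c) x
  rw [← this, Finset.mul_sum]
  refine Finset.sum_congr rfl fun r _ => ?_
  simp only [leviCivita]
  ring

include hs in
-- Lowering the upper index of the two Christoffel symbols leaves six derivatives of g, four of
-- which cancel in pairs. This is ∇g = 0.
theorem pd_metric (hd : (g x).det ≠ 0) (c μ ν : Fin 4) :
    pd c (fun y => g y μ ν) x =
      ∑ r, (leviCivita g x r μ c * g x r ν + leviCivita g x r ν c * g x μ r) := by
  have hsx := hs.self_of_nhds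
  have h2 : ∑ r, leviCivita g x r ν c * g x μ r = ∑ r, leviCivita g x r ν c * g x r μ :=
    Finset.sum_congr rfl fun r _ => by rw [hsx]
  rw [Finset.sum_add_distrib, h2, leviCivita_lower hs hd, leviCivita_lower hs hd,
    pd_metric_symm hs c μ ν, pd_metric_symm hs μ ν c, pd_metric_symm hs ν μ c]
  ring

include hg hs in
-- Differentiate g⁻¹g = 1, insert ∇g = 0 and multiply by g⁻¹ from the right.
theorem pd_ginv (c i l : Fin 4) :
    pd c (fun y => ginv g y i l) x =
      -∑ r, (leviCivita g x i r c * ginv g x r l + leviCivita g x l r c * ginv g x i r) := by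
  have hd := hg.det_neg.ne
  have hsx := hs.self_of_nhds
  -- The identity g⁻¹g = 1 is to be differentiated, so invertibility is needed in a neighbourhood
  -- and not only at x.
  have hdev : ∀ᶠ y in 𝓝 x, (g y).det ≠ 0 := by
    have hc : ContinuousAt (fun y => (g y).det) x := (smoothAt_det hg.comp).differentiableAt.continuousAt
    exact hc.eventually_ne hd
  have hgi : ∀ i k, DifferentiableAt ℝ (fun y => ginv g y i k) x := fun i k =>
    (hg.ginv i k).differentiableAt
  have hgd : ∀ i k, DifferentiableAt ℝ (fun y => g y i k) x := fun i k =>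
    (hg.comp i k).differentiableAt
  have h0 : ∀ j, ∑ k, (pd c (fun y => ginv g y i k) x * g x k j
      + ginv g x i k * pd c (fun y => g y k j) x) = 0 := by
    intro j
    have e1 : pd c (fun y => ∑ k, ginv g y i k * g y k j) x = 0 := by
      rw [pd_congr (F' := fun _ => if i = j then 1 else 0) c
        (hdev.mono fun y hy => ginv_mul_sum hy i j), pd_const]
    rw [← e1, pd_sum (F := fun k y => ginv g y i k * g y k j) _ _ fun k _ => (hgi i k).mul (hgd k j)]
    exact Finset.sum_congr rfl fun k _ => (pd_mul c (hgi i k) (hgd k j)).symm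
  have h1 : ∀ j, ∑ k, pd c (fun y => ginv g y i k) x * g x k j =
      -(∑ k, ginv g x i k * ∑ r, leviCivita g x r k c * g x r j) - leviCivita g x i j c := by
    intro j
    have e := h0 j
    rw [Finset.sum_add_distrib] at e
    have e2 : ∑ k, ginv g x i k * pd c (fun y => g y k j) x =
        (∑ k, ginv g x i k * ∑ r, leviCivita g x r k c * g x r j) + leviCivita g x i j c := by
      simp only [pd_metric hs hd, Finset.sum_add_distrib, mul_add]
      congr 1
      have : ∀ k, ∑ r, leviCivita g x r j c * g x k r = ∑ r, leviCivita g x r j c * g x r k :=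
        fun k => Finset.sum_congr rfl fun r _ => by rw [hsx]
      simp only [this]
      exact raise_lower (G := g x) (Gi := (g x)⁻¹) (fun i j => hsx i j)
        (fun i j => ginv_mul_sum hd i j) (fun r => leviCivita g x r j c) i
    linarith
  have key : ∀ X : Fin 4 → ℝ, ∑ j, (∑ k, X k * g x k j) * ginv g x j l = X l := by
    intro X
    have := raise_lower (G := g x) (Gi := (g x)⁻¹) (fun i j => hsx i j)
      (fun i j => ginv_mul_sum hd i j) X l
    rw [← this]
    refine Finset.sum_congr rfl fun j _ => ?_
    rw [mul_comm, ginv_symm hsx l j]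
    rfl
  rw [← key fun k => pd c (fun y => ginv g y i k) x]
  simp only [h1, sub_mul, Finset.sum_sub_distrib, neg_mul, Finset.sum_neg_distrib,
    Finset.sum_add_distrib]
  have h3 : ∑ j, (∑ k, ginv g x i k * ∑ r, leviCivita g x r k c * g x r j) * ginv g x j l =
      ∑ k, leviCivita g x l k c * ginv g x i k := by
    simp only [Finset.sum_mul]
    rw [Finset.sum_comm]
    refine Finset.sum_congr rfl fun k _ => ?_
    simp only [mul_assoc, ← Finset.mul_sum]
    rw [key fun r => leviCivita g x r k c, mul_comm]
  rw [h3]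
  ring

include hg hs in
-- By Jacobi's formula and ∇g = 0 the logarithmic derivative of the determinant is twice the trace
-- of the Christoffel symbols; the square root halves it.
theorem pd_vol (c : Fin 4) : pd c (vol g) x = vol g x * ∑ r, leviCivita g x r r c := by
  have hd := hg.det_neg.ne
  have hsx := hs.self_of_nhds
  have hgd : ∀ i k, DifferentiableAt ℝ (fun y => g y i k) x := fun i k =>
    (hg.comp i k).differentiableAt
  have hdet : DifferentiableAt ℝ (fun y => (g y).det) x := (smoothAt_det hg.comp).differentiableAt
  have h1 : pd c (fun y => (g y).det) x = 2 * (g x).det * ∑ r, leviCivita g x r r c := by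
    rw [pd_det hgd]
    have hadj : ∀ i j, (g x).adjugate i j = (g x).det * ginv g x i j := by
      intro i j
      rw [ginv, Matrix.inv_def, Matrix.smul_apply, Ring.inverse_eq_inv', smul_eq_mul]
      field_simp
    have e : ∀ i j, pd c (fun y => g y i j) x * (g x).adjugate j i =
        (g x).det * (ginv g x j i * pd c (fun y => g y i j) x) := fun i j => by rw [hadj]; ring
    simp only [e, ← Finset.mul_sum]
    have e1 : ∑ i, ∑ j, ginv g x j i * ∑ r, leviCivita g x r i c * g x r j =
        ∑ r, leviCivita g x r r c := by
      refine Finset.sum_congr rfl fun i _ => ?_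
      have := raise_lower (G := g x) (Gi := (g x)⁻¹) (fun i j => hsx i j)
        (fun i j => ginv_mul_sum hd i j) (fun r => leviCivita g x r i c) i
      rw [← this]
      exact Finset.sum_congr rfl fun j _ => by rw [ginv_symm hsx i j]; rfl
    have e2 : ∑ i, ∑ j, ginv g x j i * ∑ r, leviCivita g x r j c * g x i r =
        ∑ r, leviCivita g x r r c := by
      rw [Finset.sum_comm]
      refine Finset.sum_congr rfl fun j _ => ?_
      have := raise_lower (G := g x) (Gi := (g x)⁻¹) (fun i j => hsx i j)
        (fun i j => ginv_mul_sum hd i j) (fun r => leviCivita g x r j c) j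
      rw [← this]
      refine Finset.sum_congr rfl fun i _ => ?_
      congr 1
      exact Finset.sum_congr rfl fun r _ => by rw [hsx]
    simp only [pd_metric hs hd, Finset.sum_add_distrib, mul_add]
    rw [e1, e2]; ring
  have hneg : 0 < -(g x).det := by linarith [hg.det_neg]
  have hsq : HasDerivAt Real.sqrt (1 / (2 * Real.sqrt (-(g x).det))) (-(g x).det) :=
    Real.hasDerivAt_sqrt hneg.ne'
  have h2 : pd c (vol g) x = deriv Real.sqrt (-(g x).det) * pd c (fun y => -(g y).det) x :=
    pd_comp (F := fun y => -(g y).det) c hsq.differentiableAt hdet.neg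
  have h3 : pd c (fun y => -(g y).det) x = -pd c (fun y => (g y).det) x := by
    have := pd_const_mul c (-1) hdet
    simpa only [neg_one_mul] using this
  have hv : vol g x ^ 2 = -(g x).det := Real.sq_sqrt hneg.le
  have hv0 : vol g x ≠ 0 := (Real.sqrt_pos.2 hneg).ne'
  rw [h2, hsq.deriv, h3, h1]
  change 1 / (2 * vol g x) * _ = _
  field_simp
  linear_combination (-∑ r, leviCivita g x r r c) * hv

end leviCivita

theorem vol_sq {g : MetricField} {x : Pt} (h : (g x).det < 0) : (g x).det = -vol g x ^ 2 := by
  rw [vol, Real.sq_sqrt (by linarith)]; ring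

end MAG

end

noncomputable section

namespace MAG

open Filter Topology

/-! ### The first-order Lagrangian in terms of the Levi-Civita connection -/

/-- The linear form on shifts `γ` of the connection that the gradient `dF` induces. -/
def gradTrace (Gi : Matrix (Fin 4) (Fin 4) ℝ) (dF : Fin 4 → ℝ) (γ : Fin 4 → Fin 4 → Fin 4 → ℝ) : ℝ :=
  ∑ μ, ∑ ν, ∑ b, (Gi ν b * dF μ - (if μ = b then 1 else 0) * ∑ a, Gi ν a * dF a) * γ μ ν b

theorem riem_antisymm (Γ : ConnField) (x : Pt) (μ ν a b : Fin 4) :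
    riem Γ x μ ν b a = -riem Γ x μ ν a b := by
  simp only [riem, Finset.sum_sub_distrib]
  ring

theorem sum_swap_ends₅ (f : Fin 4 → Fin 4 → Fin 4 → Fin 4 → Fin 4 → ℝ) :
    ∑ μ, ∑ ν, ∑ a, ∑ b, ∑ m, f μ ν a b m = ∑ m, ∑ ν, ∑ a, ∑ b, ∑ μ, f μ ν a b m := by
  rw [← sum_rotate₅ f]
  refine Finset.sum_congr rfl fun m _ => ?_
  rw [Finset.sum_comm]
  refine Finset.sum_congr rfl fun ν _ => ?_
  rw [Finset.sum_comm]
  refine Finset.sum_congr rfl fun a _ => ?_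
  rw [Finset.sum_comm]

theorem scal_eq_sum (g : MetricField) (Γ : ConnField) (x : Pt) :
    ∑ μ, ∑ ν, ∑ b, ginv g x ν b * riem Γ x μ ν μ b = scal g Γ x := by
  simp only [scal, ricci, Finset.mul_sum]
  rw [Finset.sum_comm]
  exact Finset.sum_congr rfl fun ν _ => Finset.sum_comm

/-- The density is linear in the curvature. `momentum` is antisymmetrized in its last two indices,
so each curvature term is counted twice and the factor 1/2 appears. -/
theorem lagFirst_eq_momentum {g : MetricField} {x : Pt} (hv : vol g x ≠ 0) (α : ℝ) (Γ : ConnField)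
    (Ψ W : Pt → ℝ) :
    lagFirst α g Γ Ψ W x = vol g x * W x
      + (1 / 2) * ∑ μ, ∑ ν, ∑ a, ∑ b, momentumField α g Ψ x μ ν a b * riem Γ x μ ν a b := by
  have h1 : ∀ μ ν a b, momentumField α g Ψ x μ ν a b * riem Γ x μ ν a b =
      (if μ = a then vol g x * Ψ x * (ginv g x ν b * riem Γ x a ν a b) else 0)
      - (if μ = b then vol g x * Ψ x * (ginv g x ν a * riem Γ x b ν a b) else 0)
      + ∑ m, 2 * α * (symb m ν a b * (g x m μ * riem Γ x μ ν a b)) := by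
    intro μ ν a b
    have : ∑ m, 2 * α * (symb m ν a b * (g x m μ * riem Γ x μ ν a b)) =
        2 * α * (∑ m, g x m μ * symb m ν a b) * riem Γ x μ ν a b := by
      rw [Finset.mul_sum, Finset.sum_mul]
      exact Finset.sum_congr rfl fun m _ => by ring
    rw [this, momentumField, momentum]
    change (vol g x * Ψ x * (_ * ginv g x ν b - _ * ginv g x ν a) + _) * _ = _
    split_ifs <;> subst_vars <;> ring
  have h2 : ∑ μ, ∑ ν, ∑ a, ∑ b, (if μ = a then
      vol g x * Ψ x * (ginv g x ν b * riem Γ x a ν a b) else 0) = vol g x * Ψ x * scal g Γ x := by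
    have : ∀ μ ν, ∑ a, ∑ b, (if μ = a then
        vol g x * Ψ x * (ginv g x ν b * riem Γ x a ν a b) else 0) =
        ∑ b, vol g x * Ψ x * (ginv g x ν b * riem Γ x μ ν μ b) := by
      intro μ ν
      rw [Finset.sum_comm]
      simp
    simp only [this, ← Finset.mul_sum, scal_eq_sum]
  have h3 : ∑ μ, ∑ ν, ∑ a, ∑ b, (if μ = b then
      vol g x * Ψ x * (ginv g x ν a * riem Γ x b ν a b) else 0) = -(vol g x * Ψ x * scal g Γ x) := by
    have : ∀ μ ν, ∑ a, ∑ b, (if μ = b then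
        vol g x * Ψ x * (ginv g x ν a * riem Γ x b ν a b) else 0) =
        ∑ a, -(vol g x * Ψ x) * (ginv g x ν a * riem Γ x μ ν μ a) := by
      intro μ ν
      refine Finset.sum_congr rfl fun a _ => ?_
      rw [Finset.sum_ite_eq, if_pos (Finset.mem_univ _), riem_antisymm Γ x μ ν μ a]
      ring
    simp only [this, ← Finset.mul_sum, scal_eq_sum]
    rw [neg_mul]
  have h4 : ∑ μ, ∑ ν, ∑ a, ∑ b, ∑ m, 2 * α * (symb m ν a b * (g x m μ * riem Γ x μ ν a b)) =
      2 * α * (vol g x * holst g Γ x) := by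
    have e1 : vol g x * holst g Γ x =
        ∑ m, ∑ ν, ∑ a, ∑ b, ∑ μ, symb m ν a b * (g x m μ * riem Γ x μ ν a b) := by
      simp only [holst, Finset.mul_sum, epsUp]
      refine Finset.sum_congr rfl fun m _ => Finset.sum_congr rfl fun ν _ =>
        Finset.sum_congr rfl fun a _ => Finset.sum_congr rfl fun b _ =>
        Finset.sum_congr rfl fun μ _ => ?_
      field_simp
    rw [e1, sum_swap_ends₅ fun μ ν a b m =>
      2 * α * (symb m ν a b * (g x m μ * riem Γ x μ ν a b))]
    simp only [← Finset.mul_sum]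
  simp only [h1, Finset.sum_add_distrib, Finset.sum_sub_distrib, h2, h3, h4, lagFirst]
  ring

/-- The Levi-Civita curvature is the antisymmetrization in a, b of an array that is symmetric in ν,
b because the torsion vanishes. Contraction with a totally antisymmetric symbol kills it. -/
theorem symb_mul_riem_leviCivita {g : MetricField} {x : Pt}
    (hs : ∀ᶠ y in 𝓝 x, ∀ μ ν, g y ν μ = g y μ ν) (m r : Fin 4) :
    ∑ ν, ∑ a, ∑ b, symb m ν a b * riem (leviCivita g) x r ν a b = 0 := by
  have hsx : ∀ l μ ν, leviCivita g x l ν μ = leviCivita g x l μ ν := leviCivita_symm hs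
  have hpd : ∀ c l μ ν, pd c (fun y => leviCivita g y l ν μ) x
      = pd c (fun y => leviCivita g y l μ ν) x := fun c l μ ν =>
    pd_congr c (hs.eventually_nhds.mono fun y hy => leviCivita_symm hy l μ ν)
  let X : Fin 4 → Fin 4 → Fin 4 → ℝ := fun ν a b =>
    pd a (fun y => leviCivita g y r ν b) x + ∑ s, leviCivita g x r s a * leviCivita g x s ν b
  have hX : ∀ ν a b, riem (leviCivita g) x r ν a b = X ν a b - X ν b a := by
    intro ν a b
    simp only [riem, X, Finset.sum_sub_distrib]
    ring
  have hXs : ∀ ν a b, X b a ν = X ν a b := by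
    intro ν a b
    simp only [X, hpd a r ν b, hsx _ ν b]
  have h1 : ∑ ν, ∑ a, ∑ b, symb m ν a b * X ν a b = 0 := by
    rw [Finset.sum_comm]
    refine Finset.sum_eq_zero fun a _ => ?_
    refine sum_antisymm_mul_symm (fun ν b => symb m ν a b) (fun ν b => X ν a b) (fun ν b => ?_)
      (fun ν b => hXs ν a b)
    rw [symb_swap₂₃ m a b ν, symb_swap₃₄ m a ν b, symb_swap₂₃ m ν a b, neg_neg]
  have h2 : ∑ ν, ∑ a, ∑ b, symb m ν a b * X ν b a = -∑ ν, ∑ a, ∑ b, symb m ν a b * X ν a b := by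
    rw [← Finset.sum_neg_distrib]
    refine Finset.sum_congr rfl fun ν _ => ?_
    rw [Finset.sum_comm, ← Finset.sum_neg_distrib]
    refine Finset.sum_congr rfl fun a _ => ?_
    rw [← Finset.sum_neg_distrib]
    refine Finset.sum_congr rfl fun b _ => ?_
    rw [symb_swap₃₄ m ν a b]; ring
  simp only [hX, mul_sub, Finset.sum_sub_distrib, h2, h1]
  ring

/-- The algebraic Bianchi identity in contracted form. -/
theorem holst_leviCivita {g : MetricField} {x : Pt}
    (hs : ∀ᶠ y in 𝓝 x, ∀ μ ν, g y ν μ = g y μ ν) : holst g (leviCivita g) x = 0 := by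
  rw [holst]
  refine Finset.sum_eq_zero fun m _ => ?_
  have : ∀ ν a b, epsUp g x m ν a b * ∑ r, g x m r * riem (leviCivita g) x r ν a b =
      ∑ r, g x m r / vol g x * (symb m ν a b * riem (leviCivita g) x r ν a b) := by
    intro ν a b
    rw [Finset.mul_sum]
    exact Finset.sum_congr rfl fun r _ => by rw [epsUp]; ring
  simp only [this]
  have e : ∑ ν, ∑ a, ∑ b, ∑ r, g x m r / vol g x * (symb m ν a b * riem (leviCivita g) x r ν a b) =
      ∑ r, g x m r / vol g x * ∑ ν, ∑ a, ∑ b, symb m ν a b * riem (leviCivita g) x r ν a b := by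
    simp only [Finset.mul_sum]
    symm
    rw [Finset.sum_comm]
    refine Finset.sum_congr rfl fun ν _ => ?_
    rw [Finset.sum_comm]
    refine Finset.sum_congr rfl fun a _ => ?_
    rw [Finset.sum_comm]
  rw [e]
  exact Finset.sum_eq_zero fun r _ => by rw [symb_mul_riem_leviCivita hs, mul_zero]

/-! ### Expansion of the first-order Lagrangian in a shift of the connection -/

section identity

variable {g : MetricField} {x : Pt} (hg : SmoothMetricAt (fun _ : ℝ => g) 0 x)
  (hs : ∀ᶠ y in 𝓝 x, ∀ μ ν, g y ν μ = g y μ ν) {Ψ : Pt → ℝ}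
  (hΨ : SmoothAt (fun _ : ℝ => Ψ) 0 x)

include hg hs hΨ

/-- Since the volume and the inverse metric are covariantly constant, the derivative consists of
Christoffel terms and the gradient of Ψ only. -/
theorem pd_vol_mul_ginv (c i j : Fin 4) :
    pd c (fun y => vol g y * Ψ y * ginv g y i j) x =
      vol g x * pd c Ψ x * ginv g x i j + vol g x * Ψ x *
        ((∑ r, leviCivita g x r r c) * ginv g x i j - ∑ r, leviCivita g x i r c * ginv g x r j
          - ∑ r, leviCivita g x j r c * ginv g x i r) := by
  rw [pd_mul c (hg.vol.differentiableAt.fun_mul hΨ.differentiableAt) (hg.ginv i j).differentiableAt,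
    pd_mul c hg.vol.differentiableAt hΨ.differentiableAt, pd_vol hg hs, pd_ginv hg hs,
    Finset.sum_add_distrib]
  ring

/-- The divergence of the momentum. -/
theorem sum_pd_momentumField (α : ℝ) (μ ν b : Fin 4) :
    ∑ a, pd a (fun y => momentumField α g Ψ y μ ν a b) x =
      ∑ a, ∑ r, (leviCivita g x r μ a * momentumField α g Ψ x r ν a b
        - leviCivita g x ν r a * momentumField α g Ψ x μ r a b)
      + vol g x * (ginv g x ν b * pd μ Ψ x
        - (if μ = b then 1 else 0) * ∑ a, ginv g x ν a * pd a Ψ x) := by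
  have hd := hg.det_neg.ne
  have hsx := hs.self_of_nhds
  have hLs : ∀ l μ ν, leviCivita g x l ν μ = leviCivita g x l μ ν := leviCivita_symm hs
  have hdiff : ∀ i j, DifferentiableAt ℝ (fun y => vol g y * Ψ y * ginv g y i j) x := fun i j =>
    (hg.vol.differentiableAt.fun_mul hΨ.differentiableAt).fun_mul (hg.ginv i j).differentiableAt
  have hgd : ∀ i k, DifferentiableAt ℝ (fun y => g y i k) x := fun i k =>
    (hg.comp i k).differentiableAt
  have e1 : ∀ a, pd a (fun y => momentumField α g Ψ y μ ν a b) x =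
      (if μ = a then 1 else 0) * pd a (fun y => vol g y * Ψ y * ginv g y ν b) x
      - (if μ = b then 1 else 0) * pd a (fun y => vol g y * Ψ y * ginv g y ν a) x
      + 2 * α * ∑ m, symb m ν a b * pd a (fun y => g y m μ) x := by
    intro a
    have ef : (fun y => momentumField α g Ψ y μ ν a b) = fun y =>
        ((if μ = a then 1 else 0) * (vol g y * Ψ y * ginv g y ν b)
        - (if μ = b then 1 else 0) * (vol g y * Ψ y * ginv g y ν a))
        + 2 * α * ∑ m, symb m ν a b * g y m μ := by
      funext y
      rw [momentumField, momentum]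
      change vol g y * Ψ y * (_ * ginv g y ν b - _ * ginv g y ν a) + _ = _
      have : ∑ m, g y m μ * symb m ν a b = ∑ m, symb m ν a b * g y m μ :=
        Finset.sum_congr rfl fun m _ => mul_comm _ _
      rw [this]; ring
    have d1 : DifferentiableAt ℝ (fun y => ∑ m, symb m ν a b * g y m μ) x :=
      DifferentiableAt.fun_sum fun m _ => (hgd m μ).const_mul _
    rw [ef, pd_add a (((hdiff ν b).const_mul _).fun_sub ((hdiff ν a).const_mul _)) (d1.const_mul _),
      pd_sub a ((hdiff ν b).const_mul _) ((hdiff ν a).const_mul _), pd_const_mul a _ (hdiff ν b),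
      pd_const_mul a _ (hdiff ν a), pd_const_mul a _ d1,
      pd_sum (F := fun m y => symb m ν a b * g y m μ) _ _ fun m _ => (hgd m μ).const_mul _]
    congr 2
    exact Finset.sum_congr rfl fun m _ => pd_const_mul a _ (hgd m μ)
  -- Of the two Christoffel terms in ∂g, one is symmetric in the pair a, m in which the symbol is
  -- antisymmetric, and drops out.
  have e2 : ∑ a, ∑ m, symb m ν a b * pd a (fun y => g y m μ) x =
      ∑ a, ∑ r, leviCivita g x r μ a * ∑ m, g x m r * symb m ν a b := by
    have z : ∑ a, ∑ m, symb m ν a b * ∑ r, leviCivita g x r m a * g x r μ = 0 := by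
      refine sum_antisymm_mul_symm (fun a m => symb m ν a b)
        (fun a m => ∑ r, leviCivita g x r m a * g x r μ) (fun i j => symb_swap₁₃ _ _ _ _)
        (fun i j => ?_)
      simp only [hLs _ i j]
    simp only [pd_metric hs hd, Finset.sum_add_distrib, mul_add, z, zero_add]
    refine Finset.sum_congr rfl fun a _ => ?_
    simp only [Finset.mul_sum]
    rw [Finset.sum_comm]
    exact Finset.sum_congr rfl fun r _ => Finset.sum_congr rfl fun m _ => by ring
  have e3 : ∑ a, ∑ r, leviCivita g x ν r a * ∑ m, g x m μ * symb m r a b = 0 := by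
    have := sum_antisymm_mul_symm (fun a r => ∑ m, g x m μ * symb m r a b)
      (fun a r => leviCivita g x ν r a) (fun i j => by
        simp only [symb_swap₂₃ _ j i b, mul_neg, Finset.sum_neg_distrib]) (fun i j => hLs _ _ _)
    rw [← this]
    exact Finset.sum_congr rfl fun a _ => Finset.sum_congr rfl fun r _ => mul_comm _ _
  have e4 : ∑ a, ∑ r, leviCivita g x r μ a * momentumField α g Ψ x r ν a b =
      vol g x * Ψ x * ((∑ r, leviCivita g x r r μ) * ginv g x ν b
        - ∑ r, leviCivita g x b r μ * ginv g x ν r)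
      + 2 * α * ∑ a, ∑ r, leviCivita g x r μ a * ∑ m, g x m r * symb m ν a b := by
    have : ∀ a r, leviCivita g x r μ a * momentumField α g Ψ x r ν a b =
        (if r = a then vol g x * Ψ x * (leviCivita g x r r μ * ginv g x ν b) else 0)
        - (if r = b then vol g x * Ψ x * (leviCivita g x b a μ * ginv g x ν a) else 0)
        + 2 * α * (leviCivita g x r μ a * ∑ m, g x m r * symb m ν a b) := by
      intro a r
      rw [momentumField, momentum]
      change _ * (vol g x * Ψ x * (_ * ginv g x ν b - _ * ginv g x ν a) + _) = _
      rw [hLs r a μ]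
      split_ifs <;> subst_vars <;> ring
    simp only [this, Finset.sum_add_distrib, Finset.sum_sub_distrib, Finset.sum_ite_eq',
      Finset.mem_univ, if_true, ← Finset.mul_sum, ← Finset.sum_mul]
    ring
  have e5 : ∑ a, ∑ r, leviCivita g x ν r a * momentumField α g Ψ x μ r a b =
      vol g x * Ψ x * ((∑ r, leviCivita g x ν r μ * ginv g x r b)
        - (if μ = b then 1 else 0) * ∑ a, ∑ r, leviCivita g x ν r a * ginv g x r a) := by
    have : ∀ a r, leviCivita g x ν r a * momentumField α g Ψ x μ r a b =
        (if μ = a then vol g x * Ψ x * (leviCivita g x ν r μ * ginv g x r b) else 0)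
        - vol g x * Ψ x * ((if μ = b then 1 else 0) * (leviCivita g x ν r a * ginv g x r a))
        + 2 * α * (leviCivita g x ν r a * ∑ m, g x m μ * symb m r a b) := by
      intro a r
      rw [momentumField, momentum]
      change _ * (vol g x * Ψ x * (_ * ginv g x r b - _ * ginv g x r a) + _) = _
      by_cases h : μ = a
      · subst h; simp only [if_true]; ring
      · simp only [h, if_false]; ring
    simp only [this, Finset.sum_add_distrib, Finset.sum_sub_distrib, ← Finset.mul_sum, e3]
    rw [Finset.sum_comm]
    simp only [Finset.sum_ite_eq, Finset.mem_univ, if_true, ← Finset.mul_sum]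
    ring
  have e6 : ∑ a, ((∑ r, leviCivita g x r r a) * ginv g x ν a) =
      ∑ a, ∑ r, leviCivita g x a r a * ginv g x ν r := by
    simp only [Finset.sum_mul]
    rw [Finset.sum_comm]
    exact Finset.sum_congr rfl fun r _ => Finset.sum_congr rfl fun a _ => by rw [hLs r r a]
  have e7 : ∑ a, vol g x * pd a Ψ x * ginv g x ν a = vol g x * ∑ a, ginv g x ν a * pd a Ψ x := by
    rw [Finset.mul_sum]
    exact Finset.sum_congr rfl fun a _ => by ring
  simp only [e1, Finset.sum_add_distrib, Finset.sum_sub_distrib, ← Finset.mul_sum, e2,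
    pd_vol_mul_ginv hg hs hΨ, e4, e5, e6, e7]
  simp only [ite_mul, one_mul, zero_mul, Finset.sum_ite_eq, Finset.mem_univ, if_true]
  split_ifs <;> ring

omit hg hΨ hs in
-- The new terms are grouped so that the second bracket is the first with a and b exchanged, ready
-- for contraction with the antisymmetric momentum.
theorem riem_add {Γ M : ConnField} (hΓ : ∀ l μ ν, DifferentiableAt ℝ (fun y => Γ y l μ ν) x)
    (hM : ∀ l μ ν, DifferentiableAt ℝ (fun y => M y l μ ν) x) (μ ν a b : Fin 4) :
    riem (fun y l m n => Γ y l m n + M y l m n) x μ ν a b = riem Γ x μ ν a b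
      + (pd a (fun y => M y μ ν b) x + ∑ r, (Γ x μ r a * M x r ν b + M x μ r a * Γ x r ν b)
          + ∑ r, M x μ r a * M x r ν b)
      - (pd b (fun y => M y μ ν a) x + ∑ r, (Γ x μ r b * M x r ν a + M x μ r b * Γ x r ν a)
          + ∑ r, M x μ r b * M x r ν a) := by
  have e : ∑ r, ((Γ x μ r a + M x μ r a) * (Γ x r ν b + M x r ν b)
      - (Γ x μ r b + M x μ r b) * (Γ x r ν a + M x r ν a)) =
      ∑ r, (Γ x μ r a * Γ x r ν b - Γ x μ r b * Γ x r ν a)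
      + (∑ r, (Γ x μ r a * M x r ν b + M x μ r a * Γ x r ν b) + ∑ r, M x μ r a * M x r ν b)
      - (∑ r, (Γ x μ r b * M x r ν a + M x μ r b * Γ x r ν a) + ∑ r, M x μ r b * M x r ν a) := by
    simp only [← Finset.sum_add_distrib, ← Finset.sum_sub_distrib]
    exact Finset.sum_congr rfl fun r _ => by ring
  simp only [riem]
  rw [pd_add a (hΓ μ ν b) (hM μ ν b), pd_add b (hΓ μ ν a) (hM μ ν a), e]
  ring

omit hg hΨ hs in
theorem sum_momentum_mul_antisymm (P A : Fin 4 → Fin 4 → Fin 4 → Fin 4 → ℝ)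
    (hP : ∀ μ ν a b, P μ ν b a = -P μ ν a b) :
    ∑ μ, ∑ ν, ∑ a, ∑ b, P μ ν a b * (A μ ν a b - A μ ν b a) =
      2 * ∑ μ, ∑ ν, ∑ a, ∑ b, P μ ν a b * A μ ν a b := by
  have h : ∀ μ ν, ∑ a, ∑ b, P μ ν a b * A μ ν b a = -∑ a, ∑ b, P μ ν a b * A μ ν a b := by
    intro μ ν
    rw [Finset.sum_comm, ← Finset.sum_neg_distrib]
    refine Finset.sum_congr rfl fun a _ => ?_
    rw [← Finset.sum_neg_distrib]
    exact Finset.sum_congr rfl fun b _ => by rw [hP]; ring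
  simp only [mul_sub, Finset.sum_sub_distrib, h, Finset.sum_neg_distrib]
  ring

/-- Expansion of the first-order Lagrangian around the Levi-Civita connection, with the terms
linear in the shift written as a divergence. -/
theorem lagFirst_add {M : ConnField} (hM : SmoothConnAt (fun _ : ℝ => M) 0 x) (α : ℝ)
    (W : Pt → ℝ) :
    lagFirst α g (fun y l m n => leviCivita g y l m n + M y l m n) Ψ W x =
      vol g x * (Ψ x * scalLC g x + W x) + ∑ a, pd a (flux α g Ψ M a) x
        - vol g x * gradTrace (g x)⁻¹ (fun d => pd d Ψ x) (M x)
        + pairing (momentumField α g Ψ x) (M x) (M x) := by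
  have hL : ∀ l μ ν, DifferentiableAt ℝ (fun y => leviCivita g y l μ ν) x := fun l μ ν =>
    (hg.leviCivita l μ ν).differentiableAt
  have hMd : ∀ l μ ν, DifferentiableAt ℝ (fun y => M y l μ ν) x := fun l μ ν =>
    (hM l μ ν).differentiableAt
  have hPd : ∀ μ ν a b, DifferentiableAt ℝ (fun y => momentumField α g Ψ y μ ν a b) x :=
    fun μ ν a b => (hg.momentumField α hΨ μ ν a b).differentiableAt
  have hv : vol g x ≠ 0 := hg.vol_pos.ne'
  have h0 : lagFirst α g (leviCivita g) Ψ W x = vol g x * (Ψ x * scalLC g x + W x) := by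
    rw [lagFirst, holst_leviCivita hs, scalLC]; ring
  rw [← h0, lagFirst_eq_momentum hv, lagFirst_eq_momentum hv]
  set P := momentumField α g Ψ x with hP
  set L := leviCivita g x with hLdef
  have hflux : ∑ a, pd a (flux α g Ψ M a) x =
      ∑ μ, ∑ ν, ∑ b, (∑ a, pd a (fun y => momentumField α g Ψ y μ ν a b) x) * M x μ ν b
      + ∑ μ, ∑ ν, ∑ a, ∑ b, P μ ν a b * pd a (fun y => M y μ ν b) x := by
    have e1 : ∀ a, pd a (flux α g Ψ M a) x = ∑ μ, ∑ ν, ∑ b,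
        (pd a (fun y => momentumField α g Ψ y μ ν a b) x * M x μ ν b
          + P μ ν a b * pd a (fun y => M y μ ν b) x) := by
      intro a
      have d1 : ∀ μ ν b, DifferentiableAt ℝ (fun y => momentumField α g Ψ y μ ν a b * M y μ ν b) x :=
        fun μ ν b => (hPd μ ν a b).fun_mul (hMd μ ν b)
      have d2 : ∀ μ ν, DifferentiableAt ℝ
          (fun y => ∑ b, momentumField α g Ψ y μ ν a b * M y μ ν b) x :=
        fun μ ν => DifferentiableAt.fun_sum fun b _ => d1 μ ν b
      have d3 : ∀ μ, DifferentiableAt ℝ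
          (fun y => ∑ ν, ∑ b, momentumField α g Ψ y μ ν a b * M y μ ν b) x :=
        fun μ => DifferentiableAt.fun_sum fun ν _ => d2 μ ν
      change pd a (fun y => ∑ μ, ∑ ν, ∑ b, momentumField α g Ψ y μ ν a b * M y μ ν b) x = _
      rw [pd_sum _ a fun μ _ => d3 μ]
      refine Finset.sum_congr rfl fun μ _ => ?_
      rw [pd_sum _ a fun ν _ => d2 μ ν]
      refine Finset.sum_congr rfl fun ν _ => ?_
      rw [pd_sum _ a fun b _ => d1 μ ν b]
      exact Finset.sum_congr rfl fun b _ => pd_mul a (hPd μ ν a b) (hMd μ ν b)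
    simp only [e1, Finset.sum_add_distrib]
    congr 1
    · rw [Finset.sum_comm]
      refine Finset.sum_congr rfl fun μ _ => ?_
      rw [Finset.sum_comm]
      refine Finset.sum_congr rfl fun ν _ => ?_
      rw [Finset.sum_comm]
      exact Finset.sum_congr rfl fun b _ => (Finset.sum_mul _ _ _).symm
    · rw [Finset.sum_comm]
      refine Finset.sum_congr rfl fun μ _ => ?_
      rw [Finset.sum_comm]
  -- The Christoffel part of the divergence of the momentum is the bracket with the Levi-Civita
  -- connection, so it cancels the cross terms of the expansion. Of the linear terms only the
  -- gradient of Ψ is left.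
  have hdiv : ∑ μ, ∑ ν, ∑ b, (∑ a, pd a (fun y => momentumField α g Ψ y μ ν a b) x) * M x μ ν b =
      ∑ μ, ∑ ν, ∑ a, ∑ b, P μ ν a b * (∑ r, (L μ r a * M x r ν b + M x μ r a * L r ν b))
      + vol g x * gradTrace (g x)⁻¹ (fun d => pd d Ψ x) (M x) := by
    have hb : ∑ μ, ∑ ν, ∑ a, ∑ b, P μ ν a b * (∑ r, (L μ r a * M x r ν b + M x μ r a * L r ν b)) =
        pairing P L (M x) + pairing P (M x) L := by
      simp only [pairing, ← Finset.sum_add_distrib, Finset.mul_sum, mul_add]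
    rw [hb, pairing_add_pairing_swap]
    simp only [sum_pd_momentumField hg hs hΨ, gradTrace, Finset.mul_sum (a := vol g x),
      ← Finset.sum_add_distrib]
    refine Finset.sum_congr rfl fun μ _ => Finset.sum_congr rfl fun ν _ =>
      Finset.sum_congr rfl fun b _ => ?_
    have : bracket P L μ ν b = ∑ a, ∑ r, (L r μ a * P r ν a b - L ν r a * P μ r a b) := by
      rw [bracket, Finset.sum_comm]
      refine Finset.sum_congr rfl fun a _ => Finset.sum_congr rfl fun r _ => ?_
      rw [hP, momentumField, momentum_antisymm _ _ _ _ _ μ r a b]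
      ring
    rw [this, ← hP, ← hLdef]
    simp only [ginv]
    ring
  let A : Fin 4 → Fin 4 → Fin 4 → Fin 4 → ℝ := fun μ ν a b =>
    pd a (fun y => M y μ ν b) x + ∑ r, (L μ r a * M x r ν b + M x μ r a * L r ν b)
      + ∑ r, M x μ r a * M x r ν b
  have hA : ∀ μ ν a b, riem (fun y l m n => leviCivita g y l m n + M y l m n) x μ ν a b =
      riem (leviCivita g) x μ ν a b + (A μ ν a b - A μ ν b a) := by
    intro μ ν a b
    rw [riem_add hL hMd]
    simp only [A, hLdef]
    ring
  have hmain : ∑ μ, ∑ ν, ∑ a, ∑ b,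
      P μ ν a b * riem (fun y l m n => leviCivita g y l m n + M y l m n) x μ ν a b =
      ∑ μ, ∑ ν, ∑ a, ∑ b, P μ ν a b * riem (leviCivita g) x μ ν a b
      + 2 * ∑ μ, ∑ ν, ∑ a, ∑ b, P μ ν a b * A μ ν a b := by
    rw [← sum_momentum_mul_antisymm P A fun μ ν a b => momentum_antisymm _ _ _ _ _ _ _ _ _]
    simp only [hA, mul_add, Finset.sum_add_distrib]
  have hsplit : ∑ μ, ∑ ν, ∑ a, ∑ b, P μ ν a b * A μ ν a b =
      ∑ μ, ∑ ν, ∑ a, ∑ b, P μ ν a b * pd a (fun y => M y μ ν b) x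
      + ∑ μ, ∑ ν, ∑ a, ∑ b, P μ ν a b * (∑ r, (L μ r a * M x r ν b + M x μ r a * L r ν b))
      + pairing P (M x) (M x) := by
    have : pairing P (M x) (M x) = ∑ μ, ∑ ν, ∑ a, ∑ b, P μ ν a b * ∑ r, M x μ r a * M x r ν b := by
      simp only [pairing, Finset.mul_sum]
    rw [this]
    simp only [A, ← Finset.sum_add_distrib, mul_add]
  rw [hmain, hsplit, hflux, hdiv]
  ring

end identity

/-! ### The scalar connection -/

theorem gradTrace_linear (Gi : Matrix (Fin 4) (Fin 4) ℝ) (dF : Fin 4 → ℝ)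
    (M N : Fin 4 → Fin 4 → Fin 4 → ℝ) (c d : ℝ) :
    gradTrace Gi dF (fun l m n => c * M l m n + d * N l m n) =
      c * gradTrace Gi dF M + d * gradTrace Gi dF N := by
  simp only [gradTrace, Finset.mul_sum, ← Finset.sum_add_distrib]
  refine Finset.sum_congr rfl fun μ _ => Finset.sum_congr rfl fun ν _ =>
    Finset.sum_congr rfl fun b _ => ?_
  ring

theorem gradTrace_eq (Gi : Matrix (Fin 4) (Fin 4) ℝ) (dF : Fin 4 → ℝ)
    (γ : Fin 4 → Fin 4 → Fin 4 → ℝ) :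
    gradTrace Gi dF γ = ∑ μ, dF μ * ∑ ν, ∑ b, Gi ν b * γ μ ν b
      - ∑ ν, (∑ a, Gi ν a * dF a) * ∑ μ, γ μ ν μ := by
  have h1 : ∀ μ ν, ∑ b, (Gi ν b * dF μ - (if μ = b then 1 else 0) * ∑ a, Gi ν a * dF a) * γ μ ν b =
      dF μ * ∑ b, Gi ν b * γ μ ν b - (∑ a, Gi ν a * dF a) * γ μ ν μ := by
    intro μ ν
    have : ∀ b, (Gi ν b * dF μ - (if μ = b then 1 else 0) * ∑ a, Gi ν a * dF a) * γ μ ν b =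
        dF μ * (Gi ν b * γ μ ν b) - (if μ = b then (∑ a, Gi ν a * dF a) * γ μ ν b else 0) := by
      intro b
      split_ifs <;> ring
    simp only [this, Finset.sum_sub_distrib, ← Finset.mul_sum, Finset.sum_ite_eq, Finset.mem_univ,
      if_true]
  simp only [gradTrace, h1, Finset.sum_sub_distrib, ← Finset.mul_sum]
  congr 1
  rw [Finset.sum_comm]
  simp only [← Finset.mul_sum]

/-- The covector −6α dF/(F² + 4α²) is chosen so that the factor −v(F² + 4α²)/(6α) of
`bracket_contortion` becomes v. The contortion is then a critical point of the quadratic function of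
the shift. -/
theorem pairing_contortion {G Gi : Matrix (Fin 4) (Fin 4) ℝ} (hG : ∀ i j, G j i = G i j)
    (hGi : ∀ i j, Gi j i = Gi i j) (hinv : ∀ i j, ∑ k, Gi i k * G k j = if i = j then 1 else 0)
    {v : ℝ} (hv : v ≠ 0) (hdet : G.det = -v ^ 2) (F : ℝ) {α : ℝ} (hα : α ≠ 0) (dF : Fin 4 → ℝ)
    (μ ν b : Fin 4) :
    bracket (momentum G Gi v F α)
      (contortion G Gi v F α fun d => -(6 * α) * dF d / (F ^ 2 + 4 * α ^ 2)) μ ν b =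
      v * (Gi ν b * dF μ - (if μ = b then 1 else 0) * ∑ a, Gi ν a * dF a) := by
  have hpos : F ^ 2 + 4 * α ^ 2 ≠ 0 := by positivity
  rw [bracket_contortion hG hGi hinv hv hdet F hα]
  have : ∑ d, Gi ν d * (-(6 * α) * dF d / (F ^ 2 + 4 * α ^ 2)) =
      -(6 * α) / (F ^ 2 + 4 * α ^ 2) * ∑ d, Gi ν d * dF d := by
    rw [Finset.mul_sum]
    exact Finset.sum_congr rfl fun d _ => by ring
  rw [this]
  field_simp
  ring

/-- Only the vector part has nonzero traces, 3 w and −3 w. The value found here, times −v/2, is the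
kinetic term of the scalar-tensor theory. -/
theorem gradTrace_contortion {G Gi : Matrix (Fin 4) (Fin 4) ℝ} (hG : ∀ i j, G j i = G i j)
    (hGi : ∀ i j, Gi j i = Gi i j) (hinv : ∀ i j, ∑ k, Gi i k * G k j = if i = j then 1 else 0)
    (v F : ℝ) {α : ℝ} (hα : α ≠ 0) (dF : Fin 4 → ℝ) :
    gradTrace Gi dF (contortion G Gi v F α fun d => -(6 * α) * dF d / (F ^ 2 + 4 * α ^ 2)) =
      -(3 * (F / (4 * α ^ 2 + F ^ 2)) * ∑ μ, ∑ ν, Gi μ ν * dF μ * dF ν) := by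
  have hpos : F ^ 2 + 4 * α ^ 2 ≠ 0 := by positivity
  have hpos' : 4 * α ^ 2 + F ^ 2 ≠ 0 := by positivity
  set w : Fin 4 → ℝ := fun d => -(6 * α) * dF d / (F ^ 2 + 4 * α ^ 2) with hw
  have h := gradTrace_linear Gi dF (axialPart G w) (vectorPart G Gi w) (1 / (6 * v)) (F / (12 * α))
  change gradTrace Gi dF (fun l m n => 1 / (6 * v) * axialPart G w l m n
    + F / (12 * α) * vectorPart G Gi w l m n) = _
  rw [h, gradTrace_eq, gradTrace_eq]
  simp only [sum_inv_axialPart hGi, sum_axialPart_trace hG, sum_inv_vectorPart hG hGi hinv,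
    sum_vectorPart_trace hG hGi hinv, mul_zero, Finset.sum_const_zero, sub_zero, zero_add]
  have e1 : ∑ μ, dF μ * (3 * ∑ d, Gi μ d * w d) =
      -(18 * α) / (F ^ 2 + 4 * α ^ 2) * ∑ μ, ∑ ν, Gi μ ν * dF μ * dF ν := by
    simp only [Finset.mul_sum]
    refine Finset.sum_congr rfl fun μ _ => Finset.sum_congr rfl fun ν _ => ?_
    simp only [hw]; ring
  have e2 : ∑ ν, (∑ a, Gi ν a * dF a) * (-3 * w ν) =
      (18 * α) / (F ^ 2 + 4 * α ^ 2) * ∑ μ, ∑ ν, Gi μ ν * dF μ * dF ν := by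
    simp only [Finset.mul_sum, Finset.sum_mul]
    refine Finset.sum_congr rfl fun μ _ => Finset.sum_congr rfl fun ν _ => ?_
    simp only [hw]; ring
  rw [e1, e2]
  field_simp
  ring

theorem pairing_add (P : Fin 4 → Fin 4 → Fin 4 → Fin 4 → ℝ) (M N : Fin 4 → Fin 4 → Fin 4 → ℝ) :
    pairing P (fun l m n => M l m n + N l m n) (fun l m n => M l m n + N l m n) =
      pairing P M M + (pairing P M N + pairing P N M) + pairing P N N := by
  simp only [pairing, ← Finset.sum_add_distrib]
  refine Finset.sum_congr rfl fun μ _ => Finset.sum_congr rfl fun ν _ =>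
    Finset.sum_congr rfl fun a _ => Finset.sum_congr rfl fun b _ => Finset.sum_congr rfl fun r _ => ?_
  ring

/-- The Euler equation of the quadratic function, tested against an arbitrary shift γ. It removes
the cross terms when the square is completed. -/
theorem pairing_scalarConn {g : MetricField} {x : Pt} (hd : (g x).det < 0)
    (hsx : ∀ μ ν, g x ν μ = g x μ ν) {α : ℝ} (hα : α ≠ 0) (Ψ : Pt → ℝ)
    (γ : Fin 4 → Fin 4 → Fin 4 → ℝ) :
    pairing (momentumField α g Ψ x)
        (contortion (g x) (g x)⁻¹ (vol g x) (Ψ x) α (axialForm α Ψ x)) γ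
      + pairing (momentumField α g Ψ x) γ
        (contortion (g x) (g x)⁻¹ (vol g x) (Ψ x) α (axialForm α Ψ x)) =
      vol g x * gradTrace (g x)⁻¹ (fun d => pd d Ψ x) γ := by
  rw [pairing_add_pairing_swap]
  have hv : vol g x ≠ 0 := (Real.sqrt_pos.2 (by linarith)).ne'
  have h := pairing_contortion (G := g x) (Gi := (g x)⁻¹) (fun i j => hsx i j)
    (fun i j => ginv_symm hsx i j) (fun i j => ginv_mul_sum hd.ne i j) hv (vol_sq hd) (Ψ x) hα
    (fun d => pd d Ψ x)
  simp only [gradTrace, Finset.mul_sum (a := vol g x)]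
  refine Finset.sum_congr rfl fun μ _ => Finset.sum_congr rfl fun ν _ =>
    Finset.sum_congr rfl fun b _ => ?_
  have h' : bracket (momentumField α g Ψ x)
      (contortion (g x) (g x)⁻¹ (vol g x) (Ψ x) α (axialForm α Ψ x)) μ ν b = _ := h μ ν b
  rw [h']
  ring

/-- The first-order Lagrangian equals the scalar-tensor Lagrangian up to a divergence and a term
quadratic in the deviation from the scalar connection. -/
theorem lagFirst_eq_scalarTensor {g : MetricField} {x : Pt}
    (hg : SmoothMetricAt (fun _ : ℝ => g) 0 x)
    (hs : ∀ᶠ y in 𝓝 x, ∀ μ ν, g y ν μ = g y μ ν) {Ψ : Pt → ℝ}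
    (hΨ : SmoothAt (fun _ : ℝ => Ψ) 0 x) {Γ : ConnField}
    (hΓ : SmoothConnAt (fun _ : ℝ => Γ) 0 x) {α : ℝ} (hα : α ≠ 0) (W : Pt → ℝ) :
    lagFirst α g Γ Ψ W x =
      vol g x * (Ψ x * scalLC g x + W x
        + (3 / 2) * (Ψ x / (4 * α ^ 2 + Ψ x ^ 2)) * gradSq g Ψ x)
      + ∑ a, pd a (flux α g Ψ (fun y l m n => Γ y l m n - leviCivita g y l m n) a) x
      + pairing (momentumField α g Ψ x) (fun l m n => Γ x l m n - scalarConn α g Ψ x l m n)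
          (fun l m n => Γ x l m n - scalarConn α g Ψ x l m n) := by
  have hsx := hs.self_of_nhds
  have hM : SmoothConnAt (fun _ : ℝ => fun y l m n => Γ y l m n - leviCivita g y l m n) 0 x :=
    fun l m n => (hΓ l m n).sub (hg.leviCivita l m n)
  have h := lagFirst_add hg hs hΨ hM α W
  simp only [add_sub_cancel] at h
  change lagFirst α g Γ Ψ W x = _ at h
  rw [h]
  set N := contortion (g x) (g x)⁻¹ (vol g x) (Ψ x) α (axialForm α Ψ x) with hN
  set D : Fin 4 → Fin 4 → Fin 4 → ℝ := fun l m n => Γ x l m n - scalarConn α g Ψ x l m n with hD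
  have hsum : (fun l m n => Γ x l m n - leviCivita g x l m n) = fun l m n => N l m n + D l m n := by
    funext l m n
    simp only [hD, scalarConn, ← hN]
    ring
  have hND := pairing_scalarConn hg.det_neg hsx hα Ψ D
  have hNN := pairing_scalarConn hg.det_neg hsx hα Ψ N
  rw [← hN] at hND hNN
  have hT := gradTrace_contortion (G := g x) (Gi := (g x)⁻¹) (fun i j => hsx i j)
    (fun i j => ginv_symm hsx i j) (fun i j => ginv_mul_sum hg.det_neg.ne i j) (vol g x) (Ψ x) hα
    (fun d => pd d Ψ x)
  change gradTrace (g x)⁻¹ _ N = _ at hT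
  have hgs : ∑ μ, ∑ ν, (g x)⁻¹ μ ν * pd μ Ψ x * pd ν Ψ x = gradSq g Ψ x := rfl
  rw [hgs] at hT
  have hlin := gradTrace_linear (g x)⁻¹ (fun d => pd d Ψ x) N D 1 1
  simp only [one_mul] at hlin
  rw [hsum, pairing_add, hlin, hND, hT]
  rw [hT] at hNN
  -- At the critical point the quadratic term is half the linear one, so minus one half of the
  -- linear term remains; the cross terms with D have already cancelled.
  linear_combination hNN / 2

end MAG

end

noncomputable section

namespace MAG

open Filter Topology MeasureTheory

/-! ### Variational calculus -/

/-- A function continuous near every point of a compact set and vanishing off it is integrable. -/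
theorem integrable_of_support {K : Set Pt} (hK : IsCompact K) {F : Pt → ℝ}
    (hF : ∀ x ∈ K, ContinuousAt F x) (h0 : ∀ x ∉ K, F x = 0) : Integrable F := by
  have h1 : IntegrableOn F K :=
    ContinuousOn.integrableOn_compact hK fun x hx => (hF x hx).continuousWithinAt
  refine (integrableOn_iff_integrable_of_support_subset ?_).1 h1
  intro x hx
  by_contra h
  exact hx (h0 x h)

/-- Differentiation under the integral sign for a family of Lagrangian densities that is
continuously differentiable at parameter `0` and varies only on a compact set. -/
theorem hasFirstVariation_of_contDiffAt {U K : Set Pt} (hK : IsCompact K)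
    (hKU : K ⊆ U) {L : ℝ → Pt → ℝ} (h0 : ∀ t, ∀ x ∉ K, L t x = L 0 x)
    (hL : ∀ x ∈ U, ContDiffAt ℝ 1 (fun p : ℝ × Pt => L p.1 p.2) (0, x)) :
    HasFirstVariation U L (∫ x in U, deriv (fun t => L t x) 0) := by
  let S : Set (ℝ × Pt) := {p | ContDiffAt ℝ 1 (fun p : ℝ × Pt => L p.1 p.2) p}
  have hS : IsOpen S := isOpen_iff_mem_nhds.2 fun p hp =>
    (show ContDiffAt ℝ 1 _ p from hp).eventually (by simp)
  have hsub : ({0} : Set ℝ) ×ˢ K ⊆ S := by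
    rintro ⟨t, x⟩ ⟨ht, hx⟩
    rw [Set.mem_singleton_iff] at ht
    subst ht
    exact hL x (hKU hx)
  -- The set where L is C¹ is open and contains {0} × K. Compactness of K yields one interval of
  -- parameters that works for all its points.
  obtain ⟨T, V, hT, -, h0T, hKV, hTV⟩ := generalized_tube_lemma isCompact_singleton hK hS hsub
  obtain ⟨ε, hε, hball⟩ := Metric.isOpen_iff.1 hT 0 (h0T rfl)
  have hC : ∀ t ∈ Metric.closedBall (0 : ℝ) (ε / 2), ∀ x ∈ K,
      ContDiffAt ℝ 1 (fun p : ℝ × Pt => L p.1 p.2) (t, x) := fun t ht x hx =>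
    hTV ⟨hball (Metric.closedBall_subset_ball (by linarith) ht), hKV hx⟩
  let D : ℝ → Pt → ℝ := fun t x => fderiv ℝ (fun p : ℝ × Pt => L p.1 p.2) (t, x) (1, 0)
  have hDcont : ∀ t ∈ Metric.closedBall (0 : ℝ) (ε / 2), ∀ x ∈ K,
      ContinuousAt (fun p : ℝ × Pt => D p.1 p.2) (t, x) := fun t ht x hx =>
    ((hC t ht x hx).continuousAt_fderiv (by simp)).clm_apply continuousAt_const
  have hderiv : ∀ t ∈ Metric.closedBall (0 : ℝ) (ε / 2), ∀ x ∈ K,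
      HasDerivAt (fun t => L t x) (D t x) t := by
    intro t ht x hx
    have h1 : HasFDerivAt (fun p : ℝ × Pt => L p.1 p.2) _ (t, x) :=
      ((hC t ht x hx).differentiableAt (by simp)).hasFDerivAt
    have h2 : HasDerivAt (fun s : ℝ => (s, x)) ((1 : ℝ), (0 : Pt)) t :=
      (hasDerivAt_id t).prodMk (hasDerivAt_const t x)
    exact h1.comp_hasDerivAt t h2
  obtain ⟨C, hCb⟩ : ∃ C, ∀ p ∈ Metric.closedBall (0 : ℝ) (ε / 2) ×ˢ K, ‖D p.1 p.2‖ ≤ C :=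
    ((isCompact_closedBall (0 : ℝ) (ε / 2)).prod hK).exists_bound_of_continuousOn
      fun p hp => (hDcont p.1 hp.1 p.2 hp.2).continuousWithinAt
  have hmem0 : (0 : ℝ) ∈ Metric.closedBall (0 : ℝ) (ε / 2) :=
    Metric.mem_closedBall_self (by linarith)
  have hcontx : ∀ t ∈ Metric.closedBall (0 : ℝ) (ε / 2), ∀ x ∈ K,
      ContinuousAt (fun y => L t y - L 0 y) x := by
    intro t ht x hx
    have c : ∀ t ∈ Metric.closedBall (0 : ℝ) (ε / 2), ContinuousAt (fun y => L t y) x :=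
      fun t ht => ContinuousAt.comp (x := x) (g := fun p : ℝ × Pt => L p.1 p.2)
        (f := fun y => (t, y)) (hC t ht x hx).continuousAt (by fun_prop)
    exact (c t ht).sub (c 0 hmem0)
  have hint : ∀ t ∈ Metric.closedBall (0 : ℝ) (ε / 2), Integrable (fun y => L t y - L 0 y) :=
    fun t ht => integrable_of_support hK (hcontx t ht) fun x hx => by rw [h0 t x hx, sub_self]
  let F' : ℝ → Pt → ℝ := fun t => K.indicator (D t)
  have hball' : Metric.closedBall (0 : ℝ) (ε / 2) ∈ 𝓝 (0 : ℝ) :=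
    Metric.closedBall_mem_nhds _ (by linarith)
  have hmain := hasDerivAt_integral_of_dominated_loc_of_deriv_le (μ := volume.restrict U)
    (F := fun t x => L t x - L 0 x) (F' := F') (x₀ := (0 : ℝ))
    (s := Metric.closedBall (0 : ℝ) (ε / 2)) (bound := K.indicator fun _ => C) hball'
    (Filter.eventually_of_mem hball' fun t ht =>
      (hint t ht).aestronglyMeasurable.restrict)
    (hint 0 hmem0).restrict
    (by
      have : Integrable (F' 0) := by
        refine integrableOn_univ.1 ?_
        have h1 : IntegrableOn (D 0) K :=
          ContinuousOn.integrableOn_compact hK fun x hx =>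
            (ContinuousAt.comp (x := x) (g := fun p : ℝ × Pt => D p.1 p.2)
              (f := fun y => ((0 : ℝ), y)) (hDcont 0 hmem0 x hx) (by fun_prop)).continuousWithinAt
        rw [integrableOn_univ]
        exact h1.integrable_indicator hK.measurableSet
      exact this.aestronglyMeasurable.restrict)
    (Filter.Eventually.of_forall fun x t ht => by
      by_cases hx : x ∈ K
      · simp only [F', Set.indicator_of_mem hx]
        exact hCb (t, x) ⟨ht, hx⟩
      · simp only [F', Set.indicator_of_notMem hx, norm_zero, le_refl])
    ((integrable_indicator_iff hK.measurableSet).2 (by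
      simp [hK.measure_lt_top])).restrict
    (Filter.Eventually.of_forall fun x t ht => by
      by_cases hx : x ∈ K
      · simp only [F', Set.indicator_of_mem hx]
        exact (hderiv t ht x hx).sub_const _
      · simp only [F', Set.indicator_of_notMem hx, h0 _ x hx, sub_self]
        exact hasDerivAt_const _ _)
  have hF' : ∀ x, F' 0 x = deriv (fun t => L t x) 0 := by
    intro x
    by_cases hx : x ∈ K
    · simp only [F', Set.indicator_of_mem hx]
      exact (hderiv 0 hmem0 x hx).deriv.symm
    · simp only [F', Set.indicator_of_notMem hx, h0 _ x hx, deriv_const]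
  have := hmain.2
  simp only [hF'] at this
  exact this

/-- The divergence of a compactly supported field integrates to zero. -/
theorem integral_pd_eq_zero {U K : Set Pt} (hK : IsCompact K) (hKU : K ⊆ U) {w : Pt → ℝ}
    (hw : ∀ x ∈ U, ContDiffAt ℝ ∞ w x) (h0 : ∀ x ∉ K, w x = 0) (a : Fin 4) :
    Integrable (pd a w) ∧ ∫ x in U, pd a w x = 0 := by
  have hw' : ∀ x ∉ K, w =ᶠ[𝓝 x] fun _ => 0 := fun x hx =>
    Filter.eventually_of_mem (hK.isClosed.isOpen_compl.mem_nhds hx) h0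
  have hpd0 : ∀ x ∉ K, pd a w x = 0 := fun x hx => by
    rw [pd_congr a (hw' x hx), pd_const]
  have hsm : ∀ x ∈ K, ContDiffAt ℝ ∞ (pd a w) x := fun x hx =>
    ((SmoothAt.of_field (E := ℝ) (e := 0) (hw x (hKU hx))).pd a).field
  have hi : Integrable (pd a w) :=
    integrable_of_support hK (fun x hx => (hsm x hx).continuousAt) hpd0
  have hiw : Integrable w :=
    integrable_of_support hK (fun x hx => (hw x (hKU hx)).continuousAt) h0
  refine ⟨hi, ?_⟩
  rw [setIntegral_eq_integral_of_forall_compl_eq_zero fun x hx => hpd0 x fun h => hx (hKU h)]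
  -- Integration by parts against the constant function 1.
  have := integral_mul_fderiv_eq_neg_fderiv_mul_of_integrable (μ := (volume : Measure Pt))
    (f := fun _ : Pt => (1 : ℝ)) (g := w) (v := Pi.single a 1) (by simp)
    (by simp only [one_mul]; exact hi) (by simpa using hiw) (fun x _ => differentiableAt_const _)
    (fun x _ => by
      by_cases hx : x ∈ K
      · exact (hw x (hKU hx)).differentiableAt (by simp)
      · exact (hw' x hx).differentiableAt_iff.2 (differentiableAt_const _))
  simp only [one_mul, fderiv_fun_const, Pi.zero_apply, zero_apply, zero_mul, integral_zero,
    neg_zero] at this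
  exact this

/-- The fundamental lemma of the calculus of variations. -/
theorem eq_zero_of_integral_test {U : Set Pt} (hU : IsOpen U) {F : Pt → ℝ} (hF : ContinuousOn F U)
    (h : ∀ φ, IsTest U φ → ∫ x in U, F x * φ x = 0) : ∀ x ∈ U, F x = 0 := by
  have h1 : ∀ᵐ x ∂(volume : Measure Pt), x ∈ U → F x = 0 := by
    refine hU.ae_eq_zero_of_integral_contDiff_smul_eq_zero
      (hF.locallyIntegrableOn hU.measurableSet) fun φ h1 h2 h3 => ?_
    rw [← h φ ⟨h1, h2, h3⟩, setIntegral_eq_integral_of_forall_compl_eq_zero fun x hx => ?_]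
    · exact integral_congr_ae (Filter.Eventually.of_forall fun x => mul_comm _ _)
    · rw [image_eq_zero_of_notMem_tsupport fun h => hx (h3 h), mul_zero]
  have h2 : F =ᵐ[volume.restrict U] fun _ => 0 := (ae_restrict_iff' hU.measurableSet).2 h1
  exact Measure.eqOn_open_of_ae_eq h2 hU hF continuousOn_const

theorem hasFirstVariation_congr {U : Set Pt} {L L' : ℝ → Pt → ℝ} {v : ℝ}
    (h : ∀ᶠ t in 𝓝 (0 : ℝ), ∫ x in U, (L t x - L 0 x) = ∫ x in U, (L' t x - L' 0 x)) :
    HasFirstVariation U L v ↔ HasFirstVariation U L' v :=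
  Filter.EventuallyEq.hasDerivAt_iff h

end MAG

end

noncomputable section

namespace MAG

open Filter Topology MeasureTheory

/-! ### Variations of the fields -/

theorem det_minkowski : minkowski.det = -1 := by
  rw [minkowski, Matrix.det_diagonal, Fin.prod_univ_four]
  simp

section lorentz

variable {U : Set Pt} {g : MetricField} (hg : IsLorentzMetric U g) {x : Pt} (hx : x ∈ U)

include hg hx

theorem IsLorentzMetric.det_neg : (g x).det < 0 := by
  obtain ⟨P, hP, h⟩ := hg.signature x hx
  rw [h, Matrix.det_mul, Matrix.det_mul, Matrix.det_transpose, det_minkowski]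
  have : 0 < P.det * P.det := mul_self_pos.2 hP
  linarith

theorem IsLorentzMetric.symm (μ ν : Fin 4) : g x ν μ = g x μ ν := by
  obtain ⟨P, -, h⟩ := hg.signature x hx
  have h1 : (g x).transpose = g x := by
    rw [h, Matrix.transpose_mul, Matrix.transpose_mul, Matrix.transpose_transpose, minkowski,
      Matrix.diagonal_transpose, Matrix.mul_assoc]
  exact congrFun (congrFun h1 μ) ν

end lorentz

/-- All the supports involved in a variation lie in one compact subset of `U`. -/
theorem exists_support {U : Set Pt} {ι : Type*} [Finite ι] {φ : ι → Pt → ℝ}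
    (h : ∀ i, IsTest U (φ i)) : ∃ K, IsCompact K ∧ K ⊆ U ∧ ∀ x ∉ K, ∀ i, φ i x = 0 := by
  refine ⟨⋃ i, tsupport (φ i), isCompact_iUnion fun i => (h i).2.1, Set.iUnion_subset fun i =>
    (h i).2.2, fun x hx i => ?_⟩
  exact image_eq_zero_of_notMem_tsupport fun hi => hx (Set.mem_iUnion.2 ⟨i, hi⟩)

theorem IsMetricVar.exists_support {U : Set Pt} {h : MetricField} (hh : IsMetricVar U h) :
    ∃ K, IsCompact K ∧ K ⊆ U ∧ ∀ x ∉ K, h x = 0 := by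
  obtain ⟨K, h1, h2, h3⟩ := MAG.exists_support (φ := fun (i : Fin 4 × Fin 4) x => h x i.1 i.2)
    fun i => hh.2 i.1 i.2
  exact ⟨K, h1, h2, fun x hx => by
    ext μ ν
    exact h3 x hx (μ, ν)⟩

theorem IsConnVar.exists_support {U : Set Pt} {γ : ConnField} (hγ : IsConnVar U γ) :
    ∃ K, IsCompact K ∧ K ⊆ U ∧ ∀ x ∉ K, γ x = 0 := by
  obtain ⟨K, h1, h2, h3⟩ := MAG.exists_support
    (φ := fun (i : Fin 4 × Fin 4 × Fin 4) x => γ x i.1 i.2.1 i.2.2) fun i => hγ i.1 i.2.1 i.2.2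
  exact ⟨K, h1, h2, fun x hx => by
    funext l μ ν
    exact h3 x hx (l, μ, ν)⟩

/-! ### Smoothness along one-parameter variations of the fields -/

section families

variable {E : Type*} [NormedAddCommGroup E] [NormedSpace ℝ E] {x : Pt}

theorem SmoothMetricAt.reparam {E' : Type*} [NormedAddCommGroup E'] [NormedSpace ℝ E']
    {g : E → MetricField} {r : E' → E} {e' : E'} (hg : SmoothMetricAt g (r e') x)
    (hr : ContDiffAt ℝ ∞ r e') : SmoothMetricAt (fun e' => g (r e')) e' x :=
  ⟨fun μ ν => (hg.comp μ ν).reparam hr, hg.det_neg⟩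

theorem SmoothConnAt.reparam {E' : Type*} [NormedAddCommGroup E'] [NormedSpace ℝ E']
    {Γ : E → ConnField} {r : E' → E} {e' : E'} (hΓ : SmoothConnAt Γ (r e') x)
    (hr : ContDiffAt ℝ ∞ r e') : SmoothConnAt (fun e' => Γ (r e')) e' x :=
  fun l μ ν => (hΓ l μ ν).reparam hr

theorem smoothAt_add_smul {φ ψ : Pt → ℝ} (hφ : ContDiffAt ℝ ∞ φ x) (hψ : ContDiffAt ℝ ∞ ψ x)
    (t : ℝ) : SmoothAt (fun t : ℝ => φ + t • ψ) t x := by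
  have h : SmoothAt (fun (s : ℝ) y => φ y + s * ψ y) t x :=
    (SmoothAt.of_field hφ).add ((SmoothAt.of_param contDiffAt_id).mul (SmoothAt.of_field hψ))
  exact h

end families

section variations

variable {U : Set Pt} (hU : IsOpen U) {g h : MetricField} {x : Pt}

include hU

theorem contDiffAt_of_contDiffOn {φ : Pt → ℝ} (hφ : ContDiffOn ℝ ∞ φ U) (hx : x ∈ U) :
    ContDiffAt ℝ ∞ φ x :=
  hφ.contDiffAt (hU.mem_nhds hx)

theorem smoothMetricAt_var (hg : IsLorentzMetric U g) (hh : IsMetricVar U h) (hx : x ∈ U) {t : ℝ}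
    (hd : ((g + t • h) x).det < 0) : SmoothMetricAt (fun t : ℝ => g + t • h) t x :=
  ⟨fun μ ν => smoothAt_add_smul (contDiffAt_of_contDiffOn hU (hg.smooth μ ν) hx)
    (hh.2 μ ν).1.contDiffAt t, hd⟩

theorem smoothMetricAt_var_zero (hg : IsLorentzMetric U g) (hh : IsMetricVar U h) (hx : x ∈ U) :
    SmoothMetricAt (fun t : ℝ => g + t • h) 0 x :=
  smoothMetricAt_var hU hg hh hx (by simpa using hg.det_neg hx)

theorem smoothMetricAt_const {E : Type*} [NormedAddCommGroup E] [NormedSpace ℝ E] (e : E)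
    (hg : IsLorentzMetric U g) (hx : x ∈ U) : SmoothMetricAt (fun _ : E => g) e x :=
  ⟨fun μ ν => SmoothAt.of_field (contDiffAt_of_contDiffOn hU (hg.smooth μ ν) hx), hg.det_neg hx⟩

theorem smoothConnAt_const {E : Type*} [NormedAddCommGroup E] [NormedSpace ℝ E] (e : E)
    {Γ : ConnField} (hΓ : SmoothConn U Γ) (hx : x ∈ U) : SmoothConnAt (fun _ : E => Γ) e x :=
  fun l μ ν => SmoothAt.of_field (contDiffAt_of_contDiffOn hU (hΓ l μ ν) hx)

theorem smoothConnAt_var {Γ γ : ConnField} (hΓ : SmoothConn U Γ) (hγ : IsConnVar U γ) (hx : x ∈ U)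
    (t : ℝ) : SmoothConnAt (fun t : ℝ => Γ + t • γ) t x :=
  fun l μ ν => smoothAt_add_smul (contDiffAt_of_contDiffOn hU (hΓ l μ ν) hx)
    (hγ l μ ν).1.contDiffAt t

theorem eventually_symm (hg : IsLorentzMetric U g) (hx : x ∈ U) :
    ∀ᶠ y in 𝓝 x, ∀ μ ν, g y ν μ = g y μ ν :=
  Filter.eventually_of_mem (hU.mem_nhds hx) fun _ hy => hg.symm hy

theorem eventually_symm_var (hg : IsLorentzMetric U g) (hh : IsMetricVar U h) (hx : x ∈ U) (t : ℝ) :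
    ∀ᶠ y in 𝓝 x, ∀ μ ν, (g + t • h) y ν μ = (g + t • h) y μ ν := by
  filter_upwards [eventually_symm hU hg hx] with y hy μ ν
  have : h y ν μ = h y μ ν := (hh.1 y).apply μ ν
  change g y ν μ + t * h y ν μ = g y μ ν + t * h y μ ν
  rw [hy, this]

/-- For small parameters the varied metrics have negative determinant throughout `U`. -/
theorem eventually_det_neg (hg : IsLorentzMetric U g) (hh : IsMetricVar U h) :
    ∀ᶠ t in 𝓝 (0 : ℝ), ∀ x ∈ U, ((g + t • h) x).det < 0 := by
  obtain ⟨K, hK, hKU, h0⟩ := hh.exists_support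
  have h1 : ∀ x ∈ K, ∀ᶠ p in 𝓝 ((0 : ℝ), x), ((g + p.1 • h) p.2).det < 0 := by
    intro x hx
    have hc : ContinuousAt (fun p : ℝ × Pt => ((g + p.1 • h) p.2).det) (0, x) :=
      (smoothAt_det (smoothMetricAt_var_zero hU hg hh (hKU hx)).comp).continuousAt
    refine hc.eventually_lt_const ?_
    simpa using hg.det_neg (hKU hx)
  have h2 := hK.eventually_forall_of_forall_eventually (x₀ := (0 : ℝ))
    (P := fun t x => ((g + t • h) x).det < 0) h1
  filter_upwards [h2] with t ht x hx
  by_cases hxK : x ∈ K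
  · exact ht x hxK
  · have : (g + t • h) x = g x := by
      change g x + t • h x = g x
      rw [h0 x hxK, smul_zero, add_zero]
    rw [this]
    exact hg.det_neg hx

end variations

theorem eventuallyEq_add_smul {A : Type*} [AddCommGroup A] [Module ℝ A] {K : Set Pt}
    (hK : IsClosed K) {φ ψ : Pt → A} (h0 : ∀ x ∉ K, ψ x = 0) {x : Pt} (hx : x ∉ K) (t : ℝ) :
    φ + t • ψ =ᶠ[𝓝 x] φ := by
  filter_upwards [hK.isOpen_compl.mem_nhds hx] with y hy
  change φ y + t • ψ y = φ y
  rw [h0 y hy, smul_zero, add_zero]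

/-- Splits a simultaneous variation of two fields into the sum of the separate variations. -/
theorem deriv_diag {H : ℝ × ℝ → ℝ} (hH : DifferentiableAt ℝ H (0, 0)) :
    deriv (fun t => H (t, t)) 0 = deriv (fun t => H (t, 0)) 0 + deriv (fun t => H (0, t)) 0 := by
  have h1 : HasDerivAt (fun t : ℝ => (t, t)) ((1 : ℝ), (1 : ℝ)) 0 :=
    (hasDerivAt_id 0).prodMk (hasDerivAt_id 0)
  have h2 : HasDerivAt (fun t : ℝ => (t, (0 : ℝ))) ((1 : ℝ), (0 : ℝ)) 0 :=
    (hasDerivAt_id 0).prodMk (hasDerivAt_const 0 0)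
  have h3 : HasDerivAt (fun t : ℝ => ((0 : ℝ), t)) ((0 : ℝ), (1 : ℝ)) 0 :=
    (hasDerivAt_const 0 0).prodMk (hasDerivAt_id 0)
  have hF := hH.hasFDerivAt
  have e1 : deriv (fun t => H (t, t)) 0 = _ := 
    (HasFDerivAt.comp_hasDerivAt (l := H) (f := fun t : ℝ => (t, t)) 0 hF h1).deriv
  have e2 : deriv (fun t => H (t, 0)) 0 = _ := 
    (HasFDerivAt.comp_hasDerivAt (l := H) (f := fun t : ℝ => (t, (0 : ℝ))) 0 hF h2).deriv
  have e3 : deriv (fun t => H (0, t)) 0 = _ := 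
    (HasFDerivAt.comp_hasDerivAt (l := H) (f := fun t : ℝ => ((0 : ℝ), t)) 0 hF h3).deriv
  rw [e1, e2, e3, ← map_add]
  simp

theorem SmoothAt.hasDerivAt {L : ℝ → Pt → ℝ} {t : ℝ} {x : Pt} (h : SmoothAt L t x) :
    HasDerivAt (fun s => L s x) (deriv (fun s => L s x) t) t :=
  (h.param.differentiableAt (by simp)).hasDerivAt

/-- The parameter derivative of a smooth family is a smooth function of further parameters and
the coordinates. -/
theorem SmoothAt.deriv_param {E : Type*} [NormedAddCommGroup E] [NormedSpace ℝ E]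
    {L : E → ℝ → Pt → ℝ} {e : E} {t : ℝ} {x : Pt}
    (h : SmoothAt (fun p : E × ℝ => L p.1 p.2) (e, t) x) :
    SmoothAt (fun e y => deriv (fun s => L e s y) t) e x := by
  have h1 : ContDiffAt ℝ ∞ (fun p : E × Pt => fderiv ℝ (fun s : ℝ => L p.1 s p.2) t) (e, x) := by
    refine ContDiffAt.fderiv (n := ∞) (f := fun (p : E × Pt) (s : ℝ) => L p.1 s p.2)
      (g := fun _ => t) ?_ contDiffAt_const (by simp)
    exact ContDiffAt.comp (x := ((e, x), t)) (g := fun q : (E × ℝ) × Pt => L q.1.1 q.1.2 q.2)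
      (f := fun p : (E × Pt) × ℝ => ((p.1.1, p.2), p.1.2)) h
      (((contDiffAt_fst.fst).prodMk contDiffAt_snd).prodMk contDiffAt_fst.snd)
  exact h1.clm_apply (contDiffAt_const (c := (1 : ℝ)))

end MAG

end

noncomputable section

namespace MAG

open Filter Topology MeasureTheory

/-! ### The variation of the metric-affine action -/

theorem pairing_smul (P : Fin 4 → Fin 4 → Fin 4 → Fin 4 → ℝ) (M N : Fin 4 → Fin 4 → Fin 4 → ℝ)
    (t : ℝ) :
    pairing P (fun l m n => M l m n + t * N l m n) (fun l m n => M l m n + t * N l m n) =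
      pairing P M M + t * (pairing P M N + pairing P N M) + t ^ 2 * pairing P N N := by
  simp only [pairing, Finset.mul_sum, ← Finset.sum_add_distrib]
  refine Finset.sum_congr rfl fun μ _ => Finset.sum_congr rfl fun ν _ =>
    Finset.sum_congr rfl fun a _ => Finset.sum_congr rfl fun b _ => Finset.sum_congr rfl fun r _ => ?_
  ring

/-- By `lagFirst_eq_scalarTensor` the dependence on t sits only in the flux, which is affine, and in
the square, which is quadratic. Hence the expansion is exact. -/
theorem lagFirst_add_smul {g : MetricField} {x : Pt} (hg : SmoothMetricAt (fun _ : ℝ => g) 0 x)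
    (hs : ∀ᶠ y in 𝓝 x, ∀ μ ν, g y ν μ = g y μ ν) {Ψ : Pt → ℝ}
    (hΨ : SmoothAt (fun _ : ℝ => Ψ) 0 x) {Γ γ : ConnField}
    (hΓ : SmoothConnAt (fun _ : ℝ => Γ) 0 x) (hγ : SmoothConnAt (fun _ : ℝ => γ) 0 x)
    {α : ℝ} (hα : α ≠ 0) (W : Pt → ℝ) (t : ℝ) :
    lagFirst α g (Γ + t • γ) Ψ W x = lagFirst α g Γ Ψ W x
      + t * (∑ a, pd a (flux α g Ψ γ a) x
        + ∑ μ, ∑ ν, ∑ b, bracket (momentumField α g Ψ x)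
            (fun l m n => Γ x l m n - scalarConn α g Ψ x l m n) μ ν b * γ x μ ν b)
      + t ^ 2 * pairing (momentumField α g Ψ x) (γ x) (γ x) := by
  have hΓt : SmoothConnAt (fun _ : ℝ => Γ + t • γ) 0 x := fun l m n =>
    (hΓ l m n).add ((SmoothAt.const t).mul (hγ l m n))
  have hM : SmoothConnAt (fun _ : ℝ => fun y l m n => Γ y l m n - leviCivita g y l m n) 0 x :=
    fun l m n => (hΓ l m n).sub (hg.leviCivita l m n)
  rw [lagFirst_eq_scalarTensor hg hs hΨ hΓt hα W, lagFirst_eq_scalarTensor hg hs hΨ hΓ hα W]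
  have h1 : ∀ a, pd a (flux α g Ψ (fun y l m n => (Γ + t • γ) y l m n - leviCivita g y l m n) a) x =
      pd a (flux α g Ψ (fun y l m n => Γ y l m n - leviCivita g y l m n) a) x
        + t * pd a (flux α g Ψ γ a) x := by
    intro a
    have e : flux α g Ψ (fun y l m n => (Γ + t • γ) y l m n - leviCivita g y l m n) a = fun y =>
        flux α g Ψ (fun y l m n => Γ y l m n - leviCivita g y l m n) a y + t * flux α g Ψ γ a y := by
      funext y
      simp only [flux, Finset.mul_sum, ← Finset.sum_add_distrib]
      refine Finset.sum_congr rfl fun μ _ => Finset.sum_congr rfl fun ν _ =>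
        Finset.sum_congr rfl fun b _ => ?_
      simp only [Pi.add_apply, Pi.smul_apply, smul_eq_mul]
      ring
    have d1 := (hg.flux α hΨ hM a).differentiableAt
    have d2 := (hg.flux α hΨ hγ a).differentiableAt
    rw [e, pd_add a d1 (d2.const_mul t), pd_const_mul a t d2]
  have h2 : (fun l m n => (Γ + t • γ) x l m n - scalarConn α g Ψ x l m n) =
      fun l m n => (Γ x l m n - scalarConn α g Ψ x l m n) + t * γ x l m n := by
    funext l m n
    simp only [Pi.add_apply, Pi.smul_apply, smul_eq_mul]
    ring
  simp only [h1, h2, Finset.sum_add_distrib, ← Finset.mul_sum]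
  rw [pairing_smul, pairing_add_pairing_swap]
  ring

/-- The density of the variation of the first-order action under a change `h` of the metric alone. -/
def metricDensity (α : ℝ) (g : MetricField) (Γ : ConnField) (Ψ W : Pt → ℝ) (h : MetricField)
    (x : Pt) : ℝ :=
  deriv (fun t : ℝ => lagFirst α (g + t • h) Γ Ψ W x) 0

theorem deriv_lagFirst_conn {g : MetricField} {x : Pt} (hg : SmoothMetricAt (fun _ : ℝ => g) 0 x)
    (hs : ∀ᶠ y in 𝓝 x, ∀ μ ν, g y ν μ = g y μ ν) {Ψ : Pt → ℝ}
    (hΨ : SmoothAt (fun _ : ℝ => Ψ) 0 x) {Γ γ : ConnField}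
    (hΓ : SmoothConnAt (fun _ : ℝ => Γ) 0 x) (hγ : SmoothConnAt (fun _ : ℝ => γ) 0 x)
    {α : ℝ} (hα : α ≠ 0) (W : Pt → ℝ) :
    deriv (fun t : ℝ => lagFirst α g (Γ + t • γ) Ψ W x) 0 = ∑ a, pd a (flux α g Ψ γ a) x
        + ∑ μ, ∑ ν, ∑ b, bracket (momentumField α g Ψ x)
            (fun l m n => Γ x l m n - scalarConn α g Ψ x l m n) μ ν b * γ x μ ν b := by
  simp only [lagFirst_add_smul hg hs hΨ hΓ hγ hα W]
  generalize (∑ a, pd a (flux α g Ψ γ a) x + ∑ μ, ∑ ν, ∑ b, bracket (momentumField α g Ψ x)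
            (fun l m n => Γ x l m n - scalarConn α g Ψ x l m n) μ ν b * γ x μ ν b) = A
  have h1 : HasDerivAt (fun t : ℝ => lagFirst α g Γ Ψ W x + t * A
      + t ^ 2 * pairing (momentumField α g Ψ x) (γ x) (γ x))
      (1 * A + ((2 : ℕ) * (0 : ℝ) ^ (2 - 1) * 1) * pairing (momentumField α g Ψ x) (γ x) (γ x)) 0 :=
    (((hasDerivAt_id 0).mul_const A).const_add _).add (((hasDerivAt_id 0).pow 2).mul_const _)
  rw [h1.deriv]
  simp

theorem SmoothMetricAt.bracket {E : Type*} [NormedAddCommGroup E] [NormedSpace ℝ E]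
    {g : E → MetricField} {e : E} {x : Pt} (hg : SmoothMetricAt g e x) (α : ℝ) {Ψ : E → Pt → ℝ}
    (hΨ : SmoothAt Ψ e x) {M : E → ConnField} (hM : SmoothConnAt M e x) (μ ν b : Fin 4) :
    SmoothAt (fun e y => MAG.bracket (MAG.momentumField α (g e) (Ψ e) y) (M e y) μ ν b) e x :=
  SmoothAt.sum fun r _ => SmoothAt.sum fun a _ =>
    ((hg.momentumField α hΨ r ν a b).mul (hM r μ a)).add
      ((hg.momentumField α hΨ μ r b a).mul (hM ν r a))

/-! ### The first variation of the metric-affine action and the connection equation -/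

section magVariation

variable {U : Set Pt} (hU : IsOpen U) {κ α : ℝ} (hα : α ≠ 0) {f : ℝ → ℝ} {I : Set ℝ} (hI : IsOpen I)
  (hf : ContDiffOn ℝ ∞ f I) {g h : MetricField} {Γ γ : ConnField} {Ψ W : Pt → ℝ} {x : Pt}

/-- To first order f may be replaced by its tangent line at the unperturbed curvature: the slope is
the frozen scalar and the intercept the frozen potential term. -/
theorem deriv_lagMAG {g : ℝ → MetricField} {Γ : ℝ → ConnField} (hg : SmoothMetricAt g 0 x)
    (hΓ : SmoothConnAt Γ 0 x) (hf : DifferentiableAt ℝ f (scal (g 0) (Γ 0) x)) :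
    deriv (fun t => lagMAG κ α f (g t) (Γ t) x) 0 = 1 / (2 * κ) *
      deriv (fun t => lagFirst α (g t) (Γ t) (fun y => deriv f (scal (g 0) (Γ 0) y))
        (fun y => f (scal (g 0) (Γ 0) y)
          - deriv f (scal (g 0) (Γ 0) y) * scal (g 0) (Γ 0) y) x) 0 := by
  have hv := hg.vol.hasDerivAt
  have hs := (hg.scal hΓ).hasDerivAt
  have hh := (hg.holst hΓ).hasDerivAt
  have hfs := HasDerivAt.comp (h₂ := f) (h := fun t => scal (g t) (Γ t) x) 0 hf.hasDerivAt hs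
  have h1 := (hv.mul (hfs.add (hh.const_mul α))).const_mul (1 / (2 * κ))
  have h2 := hv.mul (((hs.const_mul (deriv f (scal (g 0) (Γ 0) x))).add_const
    (f (scal (g 0) (Γ 0) x) - deriv f (scal (g 0) (Γ 0) x) * scal (g 0) (Γ 0) x)).add
    (hh.const_mul α))
  have e1 : deriv (fun t => lagMAG κ α f (g t) (Γ t) x) 0 = _ := h1.deriv
  have e2 : deriv (fun t => lagFirst α (g t) (Γ t) (fun y => deriv f (scal (g 0) (Γ 0) y))
        (fun y => f (scal (g 0) (Γ 0) y)
          - deriv f (scal (g 0) (Γ 0) y) * scal (g 0) (Γ 0) y) x) 0 = _ := h2.deriv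
  rw [e1, e2]
  simp only [Pi.add_apply, Function.comp_apply]
  ring

include hI hf in
theorem contDiffAt_deriv_of_contDiffOn {r : ℝ} (hr : r ∈ I) : ContDiffAt ℝ ∞ (deriv f) r := by
  have h := hf.contDiffAt (hI.mem_nhds hr)
  have h1 : ContDiffAt ℝ ∞ (fun r => fderiv ℝ f r) r := h.fderiv_right (by simp)
  exact h1.clm_apply (contDiffAt_const (c := (1 : ℝ)))

include hU in
theorem smoothAt_metricDensity (hg : IsLorentzMetric U g) (hh : IsMetricVar U h)
    (hΓ : SmoothConn U Γ) (hΨ : ContDiffOn ℝ ∞ Ψ U) (hW : ContDiffOn ℝ ∞ W U) (hx : x ∈ U) :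
    ContDiffAt ℝ ∞ (metricDensity α g Γ Ψ W h) x := by
  have h1 : SmoothAt (fun p : ℝ × ℝ => lagFirst α (g + p.2 • h) Γ Ψ W) ((0 : ℝ), (0 : ℝ)) x :=
    ((smoothMetricAt_var_zero hU hg hh hx).reparam (r := fun p : ℝ × ℝ => p.2) (e' := (0, 0))
      contDiffAt_snd).lagFirst α (smoothConnAt_const hU _ hΓ hx)
      (SmoothAt.of_field (contDiffAt_of_contDiffOn hU hΨ hx))
      (SmoothAt.of_field (contDiffAt_of_contDiffOn hU hW hx))
  exact (SmoothAt.deriv_param (L := fun (_ : ℝ) s y => lagFirst α (g + s • h) Γ Ψ W y) h1).field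

theorem metricDensity_eq_zero {K : Set Pt} (h0 : ∀ x ∉ K, h x = 0) (hx : x ∉ K) :
    metricDensity α g Γ Ψ W h x = 0 := by
  have : ∀ t : ℝ, lagFirst α (g + t • h) Γ Ψ W x = lagFirst α g Γ Ψ W x := fun t =>
    lagFirst_congr α (by simp [h0 x hx]) Filter.EventuallyEq.rfl rfl rfl
  simp only [metricDensity, this, deriv_const]

theorem metricDensity_zero : metricDensity α g Γ Ψ W 0 x = 0 :=
  metricDensity_eq_zero (K := ∅) (fun _ _ => rfl) (Set.notMem_empty x)

include hU in
theorem contDiffOn_scal (hg : IsLorentzMetric U g) (hΓ : SmoothConn U Γ) :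
    ContDiffOn ℝ ∞ (scal g Γ) U := fun _ hx =>
  ((smoothMetricAt_const hU (0 : ℝ) hg hx).scal
    (smoothConnAt_const hU (0 : ℝ) hΓ hx)).field.contDiffWithinAt

include hU hI hf in
theorem contDiffOn_deriv_scal (hg : IsLorentzMetric U g) (hΓ : SmoothConn U Γ)
    (hR : ∀ x ∈ U, scal g Γ x ∈ I) : ContDiffOn ℝ ∞ (fun x => deriv f (scal g Γ x)) U := fun x hx =>
  ContDiffAt.comp_contDiffWithinAt x (contDiffAt_deriv_of_contDiffOn hI hf (hR x hx))
    (contDiffOn_scal hU hg hΓ x hx)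

include hU hα hI hf in
/-- The first variation of the metric-affine action. -/
theorem hasFirstVariation_lagMAG (hg : IsLorentzMetric U g) (hΓ : SmoothConn U Γ)
    (hR : ∀ x ∈ U, scal g Γ x ∈ I) (hh : IsMetricVar U h) (hγ : IsConnVar U γ)
    (hΨ : Ψ = fun y => deriv f (scal g Γ y)) (hW : W = fun y => f (scal g Γ y) - Ψ y * scal g Γ y) :
    HasFirstVariation U (fun t => lagMAG κ α f (g + t • h) (Γ + t • γ))
      (1 / (2 * κ) * ∫ x in U, (metricDensity α g Γ Ψ W h x
        + ∑ μ, ∑ ν, ∑ b, bracket (momentumField α g Ψ x)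
            (fun l m n => Γ x l m n - scalarConn α g Ψ x l m n) μ ν b * γ x μ ν b)) := by
  obtain ⟨K₁, hK₁, hK₁U, hh0⟩ := hh.exists_support
  obtain ⟨K₂, hK₂, hK₂U, hγ0⟩ := hγ.exists_support
  have hK : IsCompact (K₁ ∪ K₂) := hK₁.union hK₂
  have hKU : K₁ ∪ K₂ ⊆ U := Set.union_subset hK₁U hK₂U
  have hΨs : ContDiffOn ℝ ∞ Ψ U := by
    rw [hΨ]; exact contDiffOn_deriv_scal hU hI hf hg hΓ hR
  have hWs : ContDiffOn ℝ ∞ W U := by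
    rw [hW]
    refine ContDiffOn.sub (fun x hx => ?_) (hΨs.mul (contDiffOn_scal hU hg hΓ))
    exact ContDiffAt.comp_contDiffWithinAt x (hf.contDiffAt (hI.mem_nhds (hR x hx)))
      (contDiffOn_scal hU hg hΓ x hx)
  have hγs : ∀ x, SmoothConnAt (fun _ : ℝ => γ) 0 x := fun x l m n =>
    SmoothAt.of_field (hγ l m n).1.contDiffAt
  have hvar := hasFirstVariation_of_contDiffAt hK hKU
    (L := fun t => lagMAG κ α f (g + t • h) (Γ + t • γ))
    (fun t x hx => by
      refine lagMAG_congr κ α f ?_ ?_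
      · simp [hh0 x fun hx' => hx (Or.inl hx')]
      · rw [zero_smul, add_zero]
        exact eventuallyEq_add_smul hK₂.isClosed hγ0 (fun hx' => hx (Or.inr hx')) t)
    (fun x hx => by
      have hgx := smoothMetricAt_var_zero hU hg hh hx
      have hΓx := smoothConnAt_var hU hΓ hγ hx 0
      have hfx : ContDiffAt ℝ ∞ f (scal (g + (0 : ℝ) • h) (Γ + (0 : ℝ) • γ) x) := by
        simpa using hf.contDiffAt (hI.mem_nhds (hR x hx))
      have : SmoothAt (fun t : ℝ => lagMAG κ α f (g + t • h) (Γ + t • γ)) 0 x :=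
        (SmoothAt.const _).mul (hgx.vol.mul ((SmoothAt.comp
          (F := fun t : ℝ => scal (g + t • h) (Γ + t • γ)) hfx (hgx.scal hΓx)).add
          ((SmoothAt.const _).mul (hgx.holst hΓx))))
      exact ContDiffAt.of_le this (by simp))
  have hderiv : ∀ x ∈ U, deriv (fun t : ℝ => lagMAG κ α f (g + t • h) (Γ + t • γ) x) 0 =
      1 / (2 * κ) * ((metricDensity α g Γ Ψ W h x
        + ∑ μ, ∑ ν, ∑ b, bracket (momentumField α g Ψ x)
            (fun l m n => Γ x l m n - scalarConn α g Ψ x l m n) μ ν b * γ x μ ν b)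
        + ∑ a, pd a (flux α g Ψ γ a) x) := by
    intro x hx
    have hgx := smoothMetricAt_var_zero hU hg hh hx
    have hΓx := smoothConnAt_var hU hΓ hγ hx 0
    have hΨx : ContDiffAt ℝ ∞ Ψ x := contDiffAt_of_contDiffOn hU hΨs hx
    have hWx : ContDiffAt ℝ ∞ W x := contDiffAt_of_contDiffOn hU hWs hx
    rw [deriv_lagMAG hgx hΓx (by
      simpa using (hf.contDiffAt (hI.mem_nhds (hR x hx))).differentiableAt (by simp))]
    simp only [zero_smul, add_zero]
    rw [hΨ] at hW
    rw [← hW, ← hΨ]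
    congr 1
    have hH : SmoothAt (fun p : ℝ × ℝ => lagFirst α (g + p.1 • h) (Γ + p.2 • γ) Ψ W)
        ((0 : ℝ), (0 : ℝ)) x :=
      (hgx.reparam (r := fun p : ℝ × ℝ => p.1) (e' := (0, 0)) contDiffAt_fst).lagFirst α
        (hΓx.reparam (r := fun p : ℝ × ℝ => p.2) (e' := (0, 0)) contDiffAt_snd)
        (SmoothAt.of_field hΨx) (SmoothAt.of_field hWx)
    rw [deriv_diag (H := fun p : ℝ × ℝ => lagFirst α (g + p.1 • h) (Γ + p.2 • γ) Ψ W x)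
      (hH.param.differentiableAt (by simp))]
    simp only [zero_smul, add_zero]
    rw [deriv_lagFirst_conn (smoothMetricAt_const hU 0 hg hx) (eventually_symm hU hg hx)
      (SmoothAt.of_field hΨx) (smoothConnAt_const hU 0 hΓ hx) (hγs x) hα W, metricDensity]
    ring
  have hflux : ∀ a, Integrable (pd a (flux α g Ψ γ a)) ∧ ∫ x in U, pd a (flux α g Ψ γ a) x = 0 :=
    fun a => integral_pd_eq_zero hK₂ hK₂U (fun x hx => ((smoothMetricAt_const hU (0 : ℝ) hg hx).flux α
      (SmoothAt.of_field (contDiffAt_of_contDiffOn hU hΨs hx)) (hγs x) a).field)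
      (fun x hx => by simp [flux, hγ0 x hx]) a
  have hint : Integrable (fun x => metricDensity α g Γ Ψ W h x
        + ∑ μ, ∑ ν, ∑ b, bracket (momentumField α g Ψ x)
            (fun l m n => Γ x l m n - scalarConn α g Ψ x l m n) μ ν b * γ x μ ν b) := by
    refine integrable_of_support hK (fun x hx => ?_) fun x hx => ?_
    · have hxU := hKU hx
      have hg0 := smoothMetricAt_const hU (0 : ℝ) hg hxU
      have hΨ0 : SmoothAt (fun _ : ℝ => Ψ) 0 x :=
        SmoothAt.of_field (contDiffAt_of_contDiffOn hU hΨs hxU)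
      refine (smoothAt_metricDensity hU hg hh hΓ hΨs hWs hxU).continuousAt.add ?_
      have : SmoothAt (fun (_ : ℝ) y => ∑ μ, ∑ ν, ∑ b, bracket (momentumField α g Ψ y)
            (fun l m n => Γ y l m n - scalarConn α g Ψ y l m n) μ ν b * γ y μ ν b) 0 x :=
        SmoothAt.sum fun μ _ => SmoothAt.sum fun ν _ => SmoothAt.sum fun b _ =>
          (hg0.bracket α hΨ0 (fun l m n => (smoothConnAt_const hU 0 hΓ hxU l m n).sub
            (hg0.scalarConn hα hΨ0 l m n)) μ ν b).mul (hγs x μ ν b)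
      exact this.field.continuousAt
    · rw [metricDensity_eq_zero hh0 fun hx' => hx (Or.inl hx')]
      simp [hγ0 x fun hx' => hx (Or.inr hx')]
  rw [setIntegral_congr_fun hU.measurableSet hderiv, integral_const_mul, integral_add hint.restrict
    (integrable_finsetSum _ fun a _ => (hflux a).1.restrict),
    integral_finsetSum _ fun a _ => (hflux a).1.restrict] at hvar
  simpa [(hflux _).2] using hvar

/-- For variations with a single nonzero component, from which the fundamental lemma extracts the
connection equation component by component. -/
theorem sum_bracket_single {P : Pt → Fin 4 → Fin 4 → Fin 4 → Fin 4 → ℝ} {D : ConnField}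
    (l m n : Fin 4) (φ : Pt → ℝ) (x : Pt) :
    ∑ μ, ∑ ν, ∑ b, bracket (P x) (D x) μ ν b * (if μ = l ∧ ν = m ∧ b = n then φ x else 0) =
      bracket (P x) (D x) l m n * φ x := by
  rw [Finset.sum_eq_single l, Finset.sum_eq_single m, Finset.sum_eq_single n]
  · simp
  all_goals simp +contextual

include hU hα hI hf in
/-- The connection equation. -/
theorem IsMAGSolution.bracket_eq_zero (hκ : 0 < κ) (hsol : IsMAGSolution U κ α f I g Γ)
    (hΨ : Ψ = fun y => deriv f (scal g Γ y)) (hx : x ∈ U) (l m n : Fin 4) :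
    bracket (momentumField α g Ψ x) (fun l m n => Γ x l m n - scalarConn α g Ψ x l m n) l m n = 0 := by
  have hΨs : ContDiffOn ℝ ∞ Ψ U := by
    rw [hΨ]; exact contDiffOn_deriv_scal hU hI hf hsol.metric hsol.conn hsol.range
  have h0 : IsMetricVar U 0 := by
    refine ⟨fun x => Matrix.isSymm_zero, fun μ ν => ?_⟩
    change IsTest U fun _ => 0
    exact ⟨contDiff_const, HasCompactSupport.zero, by simp [tsupport]⟩
  refine eq_zero_of_integral_test hU (F := fun x => bracket (momentumField α g Ψ x)
    (fun l m n => Γ x l m n - scalarConn α g Ψ x l m n) l m n) ?_ ?_ x hx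
  · intro y hy
    have hg0 := smoothMetricAt_const hU (0 : ℝ) hsol.metric hy
    have hΨ0 : SmoothAt (fun _ : ℝ => Ψ) 0 y :=
      SmoothAt.of_field (contDiffAt_of_contDiffOn hU hΨs hy)
    exact (hg0.bracket α hΨ0 (fun l m n => (smoothConnAt_const hU 0 hsol.conn hy l m n).sub
      (hg0.scalarConn hα hΨ0 l m n)) l m n).field.continuousAt.continuousWithinAt
  · intro φ hφ
    have hγ : IsConnVar U fun x μ ν b => if μ = l ∧ ν = m ∧ b = n then φ x else 0 := by
      intro μ ν b
      by_cases h : μ = l ∧ ν = m ∧ b = n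
      · simpa only [if_pos h] using hφ
      · simp only [if_neg h]
        exact ⟨contDiff_const, HasCompactSupport.zero, by simp [tsupport]⟩
    have h1 := hasFirstVariation_lagMAG (κ := κ) hU hα hI hf hsol.metric hsol.conn hsol.range h0 hγ
      hΨ rfl
    have h2 := HasDerivAt.unique h1 (hsol.stationary _ _ h0 hγ)
    simp only [metricDensity_zero, zero_add, sum_bracket_single (P := momentumField α g Ψ)
      (D := fun x l m n => Γ x l m n - scalarConn α g Ψ x l m n)] at h2
    have h3 : (1 / (2 * κ)) ≠ 0 := by positivity
    exact (mul_eq_zero.1 h2).resolve_left h3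

include hU hα hI hf in
/-- On shell the connection is determined by the metric and `f'(R)` up to a projective
transformation. -/
theorem IsMAGSolution.exists_projective (hκ : 0 < κ) (hsol : IsMAGSolution U κ α f I g Γ)
    (hΨ : Ψ = fun y => deriv f (scal g Γ y)) (hne : ∀ x ∈ U, Ψ x ≠ 0) :
    ∃ ξ, SmoothForm U ξ ∧ ∀ x ∈ U, Γ x = projective (scalarConn α g Ψ) ξ x := by
  have hΨs : ContDiffOn ℝ ∞ Ψ U := by
    rw [hΨ]; exact contDiffOn_deriv_scal hU hI hf hsol.metric hsol.conn hsol.range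
  -- The kernel lemma provides a covector at each point without any regularity. Reading it off the
  -- component with l = μ = 0 makes it visibly smooth.
  refine ⟨fun x n => Γ x 0 0 n - scalarConn α g Ψ x 0 0 n, fun n x hx => ?_, fun x hx => ?_⟩
  · have hg0 := smoothMetricAt_const hU (0 : ℝ) hsol.metric hx
    have hΨ0 : SmoothAt (fun _ : ℝ => Ψ) 0 x :=
      SmoothAt.of_field (contDiffAt_of_contDiffOn hU hΨs hx)
    exact ((smoothConnAt_const hU 0 hsol.conn hx 0 0 n).sub
      (hg0.scalarConn hα hΨ0 0 0 n)).field.contDiffWithinAt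
  · obtain ⟨A, hA, hGA⟩ := hsol.metric.signature x hx
    have hv := (smoothMetricAt_const hU (0 : ℝ) hsol.metric hx).vol_pos
    obtain ⟨ξ, hξ⟩ := kernel_lorentz hA hGA (v := vol g x) (F := Ψ x) (α := α)
      (mul_ne_zero hv.ne' (hne x hx))
      (D := fun l m n => Γ x l m n - scalarConn α g Ψ x l m n)
      (fun μ ν b => hsol.bracket_eq_zero hU hα hI hf hκ hΨ hx μ ν b)
    have h0 : ∀ n, Γ x 0 0 n - scalarConn α g Ψ x 0 0 n = ξ n := fun n => by simpa using hξ 0 0 n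
    funext l m n
    simp only [projective, h0, ← hξ l m n]
    ring

end magVariation

end MAG

end

noncomputable section

namespace MAG

open Filter Topology MeasureTheory

/-! ### The variation of the scalar-tensor action -/

/-- Nothing is assumed about A: if it is not integrable, neither is the sum, and both integrals take
the default value 0. This permits an arbitrary potential V in `hasFirstVariation_lagST_iff`. -/
theorem integral_add_of_integral_eq_zero {m : Measure Pt} {A d : Pt → ℝ} (hd : Integrable d m)
    (h0 : ∫ x, d x ∂m = 0) : ∫ x, (A x + d x) ∂m = ∫ x, A x ∂m := by
  by_cases hA : Integrable A m
  · rw [integral_add hA hd, h0, add_zero]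
  · rw [integral_undef hA, integral_undef]
    exact fun h => hA ((integrable_add_iff_integrable_left hd).1 h)

/-- Quadratic in an array that vanishes at parameter 0. -/
theorem hasDerivAt_pairing_zero {P : ℝ → Fin 4 → Fin 4 → Fin 4 → Fin 4 → ℝ}
    {D : ℝ → Fin 4 → Fin 4 → Fin 4 → ℝ} (hP : ∀ μ ν a b, DifferentiableAt ℝ (fun t => P t μ ν a b) 0)
    (hD : ∀ l m n, DifferentiableAt ℝ (fun t => D t l m n) 0) (h0 : ∀ l m n, D 0 l m n = 0) :
    HasDerivAt (fun t => pairing (P t) (D t) (D t)) 0 0 := by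
  have h : ∀ μ ν a b r, HasDerivAt (fun t => P t μ ν a b * (D t μ r a * D t r ν b)) 0 0 := by
    intro μ ν a b r
    have := (hP μ ν a b).hasDerivAt.fun_mul ((hD μ r a).hasDerivAt.fun_mul (hD r ν b).hasDerivAt)
    simpa only [h0, mul_zero, zero_mul, add_zero] using this
  have h5 := HasDerivAt.fun_sum (u := Finset.univ) fun μ _ => HasDerivAt.fun_sum (u := Finset.univ)
    fun ν _ => HasDerivAt.fun_sum (u := Finset.univ) fun a _ => HasDerivAt.fun_sum (u := Finset.univ)
    fun b _ => HasDerivAt.fun_sum (u := Finset.univ) fun r _ => h μ ν a b r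
  simp only [Finset.sum_const_zero] at h5
  exact h5

section stVariation

variable {U : Set Pt} (hU : IsOpen U) {κ α : ℝ} (hα : α ≠ 0) {V : ℝ → ℝ} {g h : MetricField}
  {Ψ ψ : Pt → ℝ} {x : Pt}

include hU hα in
theorem smoothConn_scalarConn (hg : IsLorentzMetric U g) (hΨ : ContDiffOn ℝ ∞ Ψ U) :
    SmoothConn U (scalarConn α g Ψ) := fun l m n _ hx =>
  ((smoothMetricAt_const hU (0 : ℝ) hg hx).scalarConn hα
    (SmoothAt.of_field (contDiffAt_of_contDiffOn hU hΨ hx)) l m n).field.contDiffWithinAt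

/-- The scalar-tensor density up to a divergence, with the connection kept fixed. -/
def lagFixed (α : ℝ) (V : ℝ → ℝ) (g : MetricField) (Ψ : Pt → ℝ) (Γ : ConnField) (x : Pt) : ℝ :=
  lagFirst α g Γ Ψ (fun y => V (Ψ y)) x
    - pairing (momentumField α g Ψ x) (fun l m n => Γ x l m n - scalarConn α g Ψ x l m n)
        (fun l m n => Γ x l m n - scalarConn α g Ψ x l m n)

theorem lagST_eq_lagFixed (hg : SmoothMetricAt (fun _ : ℝ => g) 0 x)
    (hs : ∀ᶠ y in 𝓝 x, ∀ μ ν, g y ν μ = g y μ ν) (hΨ : SmoothAt (fun _ : ℝ => Ψ) 0 x)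
    {Γ : ConnField} (hΓ : SmoothConnAt (fun _ : ℝ => Γ) 0 x) (hα : α ≠ 0) :
    lagST κ α V g Ψ x = 1 / (2 * κ) * (lagFixed α V g Ψ Γ x
      - ∑ a, pd a (flux α g Ψ (fun y l m n => Γ y l m n - leviCivita g y l m n) a) x) := by
  rw [lagST, lagFixed, lagFirst_eq_scalarTensor hg hs hΨ hΓ hα]
  ring

include hU hα in
-- The two densities differ by a divergence whose change under the variation has compact support, so
-- the two action differences coincide for all small t.
theorem hasFirstVariation_lagST_iff (hg : IsLorentzMetric U g) (hΨ : ContDiffOn ℝ ∞ Ψ U)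
    (hh : IsMetricVar U h) (hψ : IsTest U ψ) {Γ : ConnField} (hΓ : SmoothConn U Γ) (v : ℝ) :
    HasFirstVariation U (fun t => lagST κ α V (g + t • h) (Ψ + t • ψ)) v ↔
    HasFirstVariation U
      (fun t x => 1 / (2 * κ) * lagFixed α V (g + t • h) (Ψ + t • ψ) Γ x) v := by
  refine hasFirstVariation_congr ?_
  obtain ⟨K₁, hK₁, hK₁U, hh0⟩ := hh.exists_support
  have hψ0 : ∀ x ∉ tsupport ψ, ψ x = 0 := fun x hx => image_eq_zero_of_notMem_tsupport hx
  have hK : IsCompact (K₁ ∪ tsupport ψ) := hK₁.union hψ.2.1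
  have hKU : K₁ ∪ tsupport ψ ⊆ U := Set.union_subset hK₁U hψ.2.2
  let F : ℝ → Fin 4 → Pt → ℝ := fun t a => flux α (g + t • h) (Ψ + t • ψ)
    (fun y l m n => Γ y l m n - leviCivita (g + t • h) y l m n) a
  filter_upwards [eventually_det_neg hU hg hh] with t ht
  have hmet : ∀ s : ℝ, (∀ x ∈ U, ((g + s • h) x).det < 0) → ∀ x ∈ U,
      SmoothMetricAt (fun _ : ℝ => g + s • h) 0 x := fun s hs x hx =>
    (smoothMetricAt_var hU hg hh hx (hs x hx)).reparam (r := fun _ : ℝ => s) (e' := 0)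
      contDiffAt_const
  have hsc : ∀ s : ℝ, ∀ x ∈ U, SmoothAt (fun _ : ℝ => Ψ + s • ψ) 0 x := fun s x hx =>
    (smoothAt_add_smul (contDiffAt_of_contDiffOn hU hΨ hx) hψ.1.contDiffAt s).reparam
      (r := fun _ : ℝ => s) (e' := 0) contDiffAt_const
  have h0d : ∀ x ∈ U, ((g + (0 : ℝ) • h) x).det < 0 := fun x hx => by simpa using hg.det_neg hx
  have hF : ∀ s : ℝ, (∀ x ∈ U, ((g + s • h) x).det < 0) → ∀ a, ∀ x ∈ U, ContDiffAt ℝ ∞ (F s a) x :=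
    fun s hs a x hx => ((hmet s hs x hx).flux α (hsc s x hx) (fun l m n =>
      (smoothConnAt_const hU 0 hΓ hx l m n).sub ((hmet s hs x hx).leviCivita l m n)) a).field
  have hL : ∀ s : ℝ, (∀ x ∈ U, ((g + s • h) x).det < 0) → ∀ x ∈ U,
      lagST κ α V (g + s • h) (Ψ + s • ψ) x = 1 / (2 * κ) * lagFixed α V (g + s • h) (Ψ + s • ψ) Γ x
        - 1 / (2 * κ) * ∑ a, pd a (F s a) x := fun s hs x hx => by
    rw [lagST_eq_lagFixed (hmet s hs x hx) (eventually_symm_var hU hg hh hx s) (hsc s x hx)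
      (smoothConnAt_const hU 0 hΓ hx) hα, mul_sub]
  -- The flux itself need not have compact support, since the fixed connection differs from
  -- Levi-Civita everywhere. Only its change between parameters 0 and t is localized.
  have hdiv : ∀ a, Integrable (pd a fun x => F t a x - F 0 a x) ∧
      ∫ x in U, pd a (fun x => F t a x - F 0 a x) x = 0 := fun a =>
    integral_pd_eq_zero hK hKU (fun x hx => (hF t ht a x hx).sub (hF 0 h0d a x hx)) (fun x hx => by
      have e1 := eventuallyEq_add_smul (φ := g) hK₁.isClosed hh0 (fun hx' => hx (Or.inl hx'))
      have e2 := eventuallyEq_add_smul (φ := Ψ) (isClosed_tsupport ψ) hψ0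
        (fun hx' => hx (Or.inr hx'))
      simp only [F, flux, momentumField, vol, leviCivita_congr (e1 t), leviCivita_congr (e1 0),
        (e1 t).eq_of_nhds, (e1 0).eq_of_nhds, (e2 t).eq_of_nhds, (e2 0).eq_of_nhds, sub_self]) a
  have hE : ∀ x ∈ U, lagST κ α V (g + t • h) (Ψ + t • ψ) x
      - lagST κ α V (g + (0 : ℝ) • h) (Ψ + (0 : ℝ) • ψ) x =
      (1 / (2 * κ) * lagFixed α V (g + t • h) (Ψ + t • ψ) Γ x
        - 1 / (2 * κ) * lagFixed α V (g + (0 : ℝ) • h) (Ψ + (0 : ℝ) • ψ) Γ x)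
      + -(1 / (2 * κ)) * ∑ a, pd a (fun x => F t a x - F 0 a x) x := by
    intro x hx
    have : ∀ a, pd a (fun x => F t a x - F 0 a x) x = pd a (F t a) x - pd a (F 0 a) x := fun a =>
      pd_sub a ((hF t ht a x hx).differentiableAt (by simp))
        ((hF 0 h0d a x hx).differentiableAt (by simp))
    simp only [this, Finset.sum_sub_distrib, hL t ht x hx, hL 0 h0d x hx]
    ring
  rw [setIntegral_congr_fun hU.measurableSet hE]
  refine integral_add_of_integral_eq_zero
    ((integrable_finsetSum _ fun a _ => (hdiv a).1.restrict).const_mul _) ?_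
  rw [integral_const_mul, integral_finsetSum _ fun a _ => (hdiv a).1.restrict]
  simp [(hdiv _).2]

include hU hα in
/-- The first variation of the scalar-tensor action. -/
theorem hasFirstVariation_lagST (hg : IsLorentzMetric U g) (hΨ : ContDiffOn ℝ ∞ Ψ U)
    (hV : ∀ x ∈ U, ContDiffAt ℝ ∞ V (Ψ x)) (hh : IsMetricVar U h) (hψ : IsTest U ψ) :
    HasFirstVariation U (fun t => lagST κ α V (g + t • h) (Ψ + t • ψ))
      (1 / (2 * κ) * ∫ x in U, (metricDensity α g (scalarConn α g Ψ) Ψ (fun y => V (Ψ y)) h x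
        + vol g x * (scal g (scalarConn α g Ψ) x + deriv V (Ψ x)) * ψ x)) := by
  have hΓ := smoothConn_scalarConn hU hα hg hΨ
  rw [hasFirstVariation_lagST_iff hU hα hg hΨ hh hψ hΓ]
  obtain ⟨K₁, hK₁, hK₁U, hh0⟩ := hh.exists_support
  have hψ0 : ∀ x ∉ tsupport ψ, ψ x = 0 := fun x hx => image_eq_zero_of_notMem_tsupport hx
  have hK : IsCompact (K₁ ∪ tsupport ψ) := hK₁.union hψ.2.1
  have hKU : K₁ ∪ tsupport ψ ⊆ U := Set.union_subset hK₁U hψ.2.2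
  have hsc : ∀ x ∈ U, SmoothAt (fun t : ℝ => Ψ + t • ψ) 0 x := fun x hx =>
    smoothAt_add_smul (contDiffAt_of_contDiffOn hU hΨ hx) hψ.1.contDiffAt 0
  have hVs : ∀ x ∈ U, SmoothAt (fun (t : ℝ) y => V ((Ψ + t • ψ) y)) 0 x := fun x hx =>
    SmoothAt.comp (F := fun t : ℝ => Ψ + t • ψ) (by simpa using hV x hx) (hsc x hx)
  have hD : ∀ x ∈ U, SmoothConnAt (fun (t : ℝ) y l m n => scalarConn α g Ψ y l m n
      - scalarConn α (g + t • h) (Ψ + t • ψ) y l m n) 0 x := fun x hx l m n =>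
    (smoothConnAt_const hU 0 hΓ hx l m n).sub
      ((smoothMetricAt_var_zero hU hg hh hx).scalarConn hα (hsc x hx) l m n)
  have hvar := hasFirstVariation_of_contDiffAt hK hKU
    (L := fun t x => 1 / (2 * κ) * lagFixed α V (g + t • h) (Ψ + t • ψ) (scalarConn α g Ψ) x)
    (fun t x hx => by
      have e1 := eventuallyEq_add_smul (φ := g) hK₁.isClosed hh0 (fun hx' => hx (Or.inl hx'))
      have e2 := eventuallyEq_add_smul (φ := Ψ) (isClosed_tsupport ψ) hψ0
        (fun hx' => hx (Or.inr hx'))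
      have e3 : ∀ t : ℝ, lagFixed α V (g + t • h) (Ψ + t • ψ) (scalarConn α g Ψ) x =
          lagFixed α V g Ψ (scalarConn α g Ψ) x := by
        intro t
        simp only [lagFixed, scalarConn_congr α (e1 t) (e2 t), momentumField, vol,
          (e1 t).eq_of_nhds, (e2 t).eq_of_nhds]
        rw [lagFirst_congr (W' := fun y => V (Ψ y)) α (e1 t).eq_of_nhds Filter.EventuallyEq.rfl (e2 t).eq_of_nhds
          (congrArg V (e2 t).eq_of_nhds)]
      rw [e3 t, e3 0])
    (fun x hx => by
      have hgx := smoothMetricAt_var_zero hU hg hh hx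
      have : SmoothAt (fun (t : ℝ) x => 1 / (2 * κ) *
          lagFixed α V (g + t • h) (Ψ + t • ψ) (scalarConn α g Ψ) x) 0 x :=
        (SmoothAt.const _).mul ((hgx.lagFirst α (smoothConnAt_const hU 0 hΓ hx) (hsc x hx)
          (hVs x hx)).sub (hgx.pairing α (hD x hx) (hsc x hx)))
      exact ContDiffAt.of_le this (by simp))
  have hderiv : ∀ x ∈ U, deriv (fun t : ℝ => 1 / (2 * κ) *
      lagFixed α V (g + t • h) (Ψ + t • ψ) (scalarConn α g Ψ) x) 0 =
      1 / (2 * κ) * (metricDensity α g (scalarConn α g Ψ) Ψ (fun y => V (Ψ y)) h x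
        + vol g x * (scal g (scalarConn α g Ψ) x + deriv V (Ψ x)) * ψ x) := by
    intro x hx
    have hgx := smoothMetricAt_var_zero hU hg hh hx
    have h1 := (hgx.lagFirst α (smoothConnAt_const hU 0 hΓ hx) (hsc x hx) (hVs x hx)).hasDerivAt
    -- The fixed connection is the scalar connection of the unperturbed fields, so the deviation
    -- vanishes at t = 0 and the square does not contribute.
    have h2 := hasDerivAt_pairing_zero
      (P := fun t : ℝ => momentumField α (g + t • h) (Ψ + t • ψ) x)
      (D := fun (t : ℝ) l m n => scalarConn α g Ψ x l m n
        - scalarConn α (g + t • h) (Ψ + t • ψ) x l m n)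
      (fun μ ν a b => (hgx.momentumField α (hsc x hx) μ ν a b).hasDerivAt.differentiableAt)
      (fun l m n => (hD x hx l m n).hasDerivAt.differentiableAt) (fun l m n => by simp)
    have h3 : deriv (fun t : ℝ => 1 / (2 * κ) *
      lagFixed α V (g + t • h) (Ψ + t • ψ) (scalarConn α g Ψ) x) 0 = _ :=
      ((h1.fun_sub h2).const_mul (1 / (2 * κ))).deriv
    rw [h3, sub_zero]
    congr 1
    have hH : SmoothAt (fun p : ℝ × ℝ => lagFirst α (g + p.1 • h) (scalarConn α g Ψ) (Ψ + p.2 • ψ)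
        (fun y => V ((Ψ + p.2 • ψ) y))) ((0 : ℝ), (0 : ℝ)) x :=
      (hgx.reparam (r := fun p : ℝ × ℝ => p.1) (e' := (0, 0)) contDiffAt_fst).lagFirst α
        (smoothConnAt_const hU _ hΓ hx)
        (SmoothAt.reparam (F := fun t : ℝ => Ψ + t • ψ) (r := fun p : ℝ × ℝ => p.2) (e' := (0, 0))
          (hsc x hx) contDiffAt_snd)
        (SmoothAt.reparam (F := fun (t : ℝ) y => V ((Ψ + t • ψ) y)) (r := fun p : ℝ × ℝ => p.2)
          (e' := (0, 0)) (hVs x hx) contDiffAt_snd)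
    rw [deriv_diag (H := fun p : ℝ × ℝ => lagFirst α (g + p.1 • h) (scalarConn α g Ψ) (Ψ + p.2 • ψ)
        (fun y => V ((Ψ + p.2 • ψ) y)) x) (hH.param.differentiableAt (by simp))]
    simp only [zero_smul, add_zero]
    rw [metricDensity]
    congr 1
    have hl : HasDerivAt (fun t : ℝ => Ψ x + t * ψ x) (ψ x) 0 := by
      simpa using ((hasDerivAt_id (0 : ℝ)).mul_const (ψ x)).const_add (Ψ x)
    have hVd : HasDerivAt V (deriv V (Ψ x)) (Ψ x + 0 * ψ x) := by
      rw [zero_mul, add_zero]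
      exact ((hV x hx).differentiableAt (by simp)).hasDerivAt
    have hVc := HasDerivAt.comp (h₂ := V) (h := fun t : ℝ => Ψ x + t * ψ x) 0 hVd hl
    have h4 : deriv (fun t : ℝ => lagFirst α g (scalarConn α g Ψ) (Ψ + t • ψ)
        (fun y => V ((Ψ + t • ψ) y)) x) 0 = _ :=
      ((((hl.mul_const (scal g (scalarConn α g Ψ) x)).fun_add hVc).add_const
        (α * holst g (scalarConn α g Ψ) x)).const_mul (vol g x)).deriv
    rw [h4]
    ring
  rw [setIntegral_congr_fun hU.measurableSet hderiv, integral_const_mul] at hvar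
  exact hvar

end stVariation

end MAG

end

noncomputable section

namespace MAG

open Filter Topology MeasureTheory

/-! ### Projective transformations -/

section projective

variable {x : Pt} {g : MetricField} {Γ : ConnField} {ξ : OneForm}

/-- The shift is a multiple of the identity matrix in its first two indices, so it commutes with the
connection matrices. All products cancel and only the exterior derivative of ξ remains. -/
theorem riem_projective (hΓ : ∀ l μ ν, DifferentiableAt ℝ (fun y => Γ y l μ ν) x)
    (hξ : ∀ μ, DifferentiableAt ℝ (fun y => ξ y μ) x) (μ ν a b : Fin 4) :
    riem (projective Γ ξ) x μ ν a b = riem Γ x μ ν a b + (if μ = ν then 1 else 0) *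
      (pd a (fun y => ξ y b) x - pd b (fun y => ξ y a) x) := by
  have h := riem_add hΓ (M := fun y l m n => (if l = m then 1 else 0) * ξ y n)
    (fun l m n => (hξ n).const_mul _) μ ν a b
  have e : (fun y l m n => Γ y l m n + (if l = m then 1 else 0) * ξ y n) = projective Γ ξ := rfl
  rw [e] at h
  rw [h, pd_const_mul a _ (hξ b), pd_const_mul b _ (hξ a)]
  simp only [Finset.sum_add_distrib, mul_ite, ite_mul, mul_zero, zero_mul, one_mul,
    Finset.sum_ite_eq, Finset.sum_ite_eq', Finset.mem_univ, if_true]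
  split_ifs <;> ring

variable (hΓ : ∀ l μ ν, DifferentiableAt ℝ (fun y => Γ y l μ ν) x)
  (hξ : ∀ μ, DifferentiableAt ℝ (fun y => ξ y μ) x) (hs : ∀ μ ν, g x ν μ = g x μ ν)

include hΓ hξ hs

/-- The Ricci tensor changes by dξ, which is antisymmetric and invisible to the symmetric inverse
metric. -/
theorem scal_projective : scal g (projective Γ ξ) x = scal g Γ x := by
  have h := sum_antisymm_mul_symm (fun μ ν => pd μ (fun y => ξ y ν) x - pd ν (fun y => ξ y μ) x)
    (fun μ ν => ginv g x μ ν) (fun i j => by ring) (fun i j => ginv_symm hs i j)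
  have e : ∀ μ ν, ricci (projective Γ ξ) x μ ν = ricci Γ x μ ν
      + (pd μ (fun y => ξ y ν) x - pd ν (fun y => ξ y μ) x) := by
    intro μ ν
    simp [ricci, riem_projective hΓ hξ, Finset.sum_add_distrib]
  simp only [scal, e, mul_comm (ginv g x _ _), add_mul, Finset.sum_add_distrib] at h ⊢
  rw [h, add_zero]

/-- The change carries a factor ε^{μνab} g_{μν}, which vanishes by symmetry. -/
theorem holst_projective : holst g (projective Γ ξ) x = holst g Γ x := by
  have h : ∀ a b, ∑ μ, ∑ ν, epsUp g x μ ν a b * g x μ ν = 0 := fun a b =>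
    sum_antisymm_mul_symm (fun μ ν => epsUp g x μ ν a b) (fun μ ν => g x μ ν)
      (fun i j => by rw [epsUp, epsUp, symb_swap₁₂ i j, neg_div]) hs
  have e : ∀ μ ν a b, epsUp g x μ ν a b * ∑ r, g x μ r * riem (projective Γ ξ) x r ν a b =
      epsUp g x μ ν a b * (∑ r, g x μ r * riem Γ x r ν a b)
        + epsUp g x μ ν a b * g x μ ν * (pd a (fun y => ξ y b) x - pd b (fun y => ξ y a) x) := by
    intro μ ν a b
    simp only [riem_projective hΓ hξ, mul_add, Finset.sum_add_distrib]
    simp [mul_assoc]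
  simp only [holst, e, Finset.sum_add_distrib]
  have e2 : ∑ μ, ∑ ν, ∑ a, ∑ b, epsUp g x μ ν a b * g x μ ν *
      (pd a (fun y => ξ y b) x - pd b (fun y => ξ y a) x) =
      ∑ a, ∑ b, (∑ μ, ∑ ν, epsUp g x μ ν a b * g x μ ν) *
        (pd a (fun y => ξ y b) x - pd b (fun y => ξ y a) x) := by
    simp only [Finset.sum_mul]
    calc _ = ∑ μ, ∑ a, ∑ ν, ∑ b, epsUp g x μ ν a b * g x μ ν *
          (pd a (fun y => ξ y b) x - pd b (fun y => ξ y a) x) :=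
          Finset.sum_congr rfl fun _ _ => Finset.sum_comm
      _ = ∑ μ, ∑ a, ∑ b, ∑ ν, epsUp g x μ ν a b * g x μ ν *
          (pd a (fun y => ξ y b) x - pd b (fun y => ξ y a) x) :=
          Finset.sum_congr rfl fun _ _ => Finset.sum_congr rfl fun _ _ => Finset.sum_comm
      _ = ∑ a, ∑ μ, ∑ b, ∑ ν, epsUp g x μ ν a b * g x μ ν *
          (pd a (fun y => ξ y b) x - pd b (fun y => ξ y a) x) := Finset.sum_comm
      _ = _ := Finset.sum_congr rfl fun _ _ => Finset.sum_comm
  rw [e2]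
  simp [h]

theorem lagMAG_projective (κ α : ℝ) (f : ℝ → ℝ) :
    lagMAG κ α f g (projective Γ ξ) x = lagMAG κ α f g Γ x := by
  rw [lagMAG, lagMAG, scal_projective hΓ hξ hs, holst_projective hΓ hξ hs]

theorem lagFirst_projective (α : ℝ) (Ψ W : Pt → ℝ) :
    lagFirst α g (projective Γ ξ) Ψ W x = lagFirst α g Γ Ψ W x := by
  rw [lagFirst, lagFirst, scal_projective hΓ hξ hs, holst_projective hΓ hξ hs]

end projective

/-! ### Projective transformations acting on solutions -/

section projectiveField

variable {U : Set Pt} (hU : IsOpen U) {κ α : ℝ} {f : ℝ → ℝ} {I : Set ℝ} {g h : MetricField}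
  {Γ γ : ConnField} {ξ : OneForm} {x : Pt}

include hU

theorem SmoothConn.differentiableAt (hΓ : SmoothConn U Γ) (hx : x ∈ U) (l m n : Fin 4) :
    DifferentiableAt ℝ (fun y => Γ y l m n) x :=
  (contDiffAt_of_contDiffOn hU (hΓ l m n) hx).differentiableAt (by simp)

theorem SmoothForm.differentiableAt (hξ : SmoothForm U ξ) (hx : x ∈ U) (m : Fin 4) :
    DifferentiableAt ℝ (fun y => ξ y m) x :=
  (contDiffAt_of_contDiffOn hU (hξ m) hx).differentiableAt (by simp)

omit hU in
theorem SmoothConn.projective (hΓ : SmoothConn U Γ) (hξ : SmoothForm U ξ) :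
    SmoothConn U (projective Γ ξ) := fun l m n => (hΓ l m n).add (contDiffOn_const.mul (hξ n))

/-- The shift commutes with adding a connection variation, and invariance of the density needs only
a symmetric g. The whole family of actions is therefore unchanged, for every t, including those at
which the varied metric degenerates. -/
theorem IsMAGSolution.projective (hsol : IsMAGSolution U κ α f I g Γ) (hξ : SmoothForm U ξ) :
    IsMAGSolution U κ α f I g (projective Γ ξ) := by
  refine ⟨hsol.metric, hsol.conn.projective hξ, fun x hx => ?_, fun h γ hh hγ => ?_⟩
  · rw [scal_projective (hsol.conn.differentiableAt hU hx) (hξ.differentiableAt hU hx)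
      (hsol.metric.symm hx)]
    exact hsol.range x hx
  · refine (hasFirstVariation_congr (Filter.Eventually.of_forall fun t => ?_)).1
      (hsol.stationary h γ hh hγ)
    have e : ∀ t : ℝ, ∀ x ∈ U, lagMAG κ α f (g + t • h) (MAG.projective Γ ξ + t • γ) x =
        lagMAG κ α f (g + t • h) (Γ + t • γ) x := by
      intro t x hx
      have e1 : MAG.projective Γ ξ + t • γ = MAG.projective (Γ + t • γ) ξ := by
        funext y l m n
        simp only [MAG.projective, Pi.add_apply, Pi.smul_apply]
        ring
      rw [e1, lagMAG_projective _ (hξ.differentiableAt hU hx)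
        (eventually_symm_var hU hsol.metric hh hx t).self_of_nhds]
      exact fun l m n => (smoothConnAt_var hU hsol.conn hγ hx t l m n).differentiableAt
    exact (setIntegral_congr_fun hU.measurableSet fun x hx => by
      simp only [e t x hx, e 0 x hx]).symm

theorem metricDensity_projective (hg : IsLorentzMetric U g) (hΓ : SmoothConn U Γ)
    (hξ : SmoothForm U ξ) (hh : IsMetricVar U h) (Ψ W : Pt → ℝ) (hx : x ∈ U) :
    metricDensity α g (projective Γ ξ) Ψ W h x = metricDensity α g Γ Ψ W h x := by
  simp only [metricDensity, lagFirst_projective (hΓ.differentiableAt hU hx)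
    (hξ.differentiableAt hU hx) (eventually_symm_var hU hg hh hx _).self_of_nhds]

theorem metricDensity_congr {Γ' : ConnField} {Ψ Ψ' W W' : Pt → ℝ} (hΓ : ∀ y ∈ U, Γ y = Γ' y)
    (hx : x ∈ U) (hΨ : Ψ x = Ψ' x) (hW : W x = W' x) :
    metricDensity α g Γ Ψ W h x = metricDensity α g Γ' Ψ' W' h x := by
  have : ∀ t : ℝ, lagFirst α (g + t • h) Γ Ψ W x = lagFirst α (g + t • h) Γ' Ψ' W' x := fun t =>
    lagFirst_congr α rfl (Filter.eventually_of_mem (hU.mem_nhds hx) hΓ) hΨ hW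
  simp only [metricDensity, this]

end projectiveField

end MAG

end

noncomputable section

namespace MAG

open Filter Topology MeasureTheory

/-! ### Torsion and nonmetricity of the solutions -/

theorem epsLow_eq {g : MetricField} {x : Pt} (hd : (g x).det < 0) (a b c d : Fin 4) :
    epsLow g x a b c d = -vol g x * symb a b c d := by
  have hv : vol g x ≠ 0 := (Real.sqrt_pos.2 (by linarith)).ne'
  have h := sum_rows_mul_symb (g x) a b c d
  have e : epsLow g x a b c d = (1 / vol g x) *
      ∑ i, ∑ j, ∑ k, ∑ l, g x a i * g x b j * g x c k * g x d l * symb i j k l := by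
    simp only [epsLow, epsUp, Finset.mul_sum]
    refine Finset.sum_congr rfl fun i _ => Finset.sum_congr rfl fun j _ =>
      Finset.sum_congr rfl fun k _ => Finset.sum_congr rfl fun l _ => by ring
  rw [e, h, vol_sq hd]
  field_simp

theorem symb_cycle (l m k r : Fin 4) : symb l m k r = symb k l m r := by
  rw [symb_swap₂₃ l k m, symb_swap₁₂ k l m, neg_neg]

section geometry

variable {g : MetricField} {Γ : ConnField} {x : Pt} (hs : ∀ᶠ y in 𝓝 x, ∀ μ ν, g y ν μ = g y μ ν)
  (hd : (g x).det < 0) {F α : ℝ} {w ξ : Fin 4 → ℝ}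
  (hΓ : ∀ l m n, Γ x l m n = leviCivita g x l m n
    + contortion (g x) (g x)⁻¹ (vol g x) F α w l m n + (if l = m then 1 else 0) * ξ n)

include hs hd in
-- With all indices down the axial part is an ε and the vector part is of the form g ∧ w, both
-- antisymmetric in the first pair. So the contortion does not disturb metric compatibility.
theorem lower_contortion_antisymm (l m n : Fin 4) :
    ∑ r, contortion (g x) (g x)⁻¹ (vol g x) F α w r m n * g x r l =
      -∑ r, contortion (g x) (g x)⁻¹ (vol g x) F α w r l n * g x r m := by
  have hsx := hs.self_of_nhds
  have hG : ∀ i j, g x j i = g x i j := fun i j => hsx i j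
  have hGi : ∀ i j, (g x)⁻¹ j i = (g x)⁻¹ i j := fun i j => ginv_symm hsx i j
  have hinv : ∀ i j, ∑ k, (g x)⁻¹ i k * g x k j = if i = j then 1 else 0 :=
    fun i j => ginv_mul_sum hd.ne i j
  have key : ∀ l m, ∑ r, contortion (g x) (g x)⁻¹ (vol g x) F α w r m n * g x r l =
      1 / (6 * vol g x) * ((g x).det * ∑ k, symb l m n k * ∑ d, (g x)⁻¹ k d * w d)
        + F / (12 * α) * (g x m n * w l - g x n l * w m) := by
    intro l m
    rw [← lower_axialPart hG hGi hinv w l m n]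
    have h2 := lower_raise hG hGi hinv w l
    conv_rhs => rw [← h2]
    have h3 : g x n l * w m = ∑ r, (if r = n then 1 else 0) * w m * g x r l := by simp [mul_comm]
    rw [h3]
    simp only [Finset.mul_sum, ← Finset.sum_sub_distrib, ← Finset.sum_add_distrib, contortion,
      vectorPart]
    refine Finset.sum_congr rfl fun r _ => ?_
    rw [hG l r, ← Finset.mul_sum, ← Finset.mul_sum, ← Finset.mul_sum]
    ring
  rw [key, key]
  simp only [symb_swap₁₂ m l]
  simp only [neg_mul, Finset.sum_neg_distrib]
  rw [hG n l, hG n m]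
  ring

include hs hd hΓ

/-- The Levi-Civita part and the contortion drop out; only the projective shift contributes, in pure
Weyl form. Its two traces, 8 ξ and 2 ξ, follow. -/
theorem nonmet_eq (l μ ν : Fin 4) : nonmet g Γ x l μ ν = 2 * ξ l * g x μ ν := by
  have hsx := hs.self_of_nhds
  have h1 := lower_contortion_antisymm hs hd (F := F) (α := α) (w := w) ν μ l
  rw [nonmet, pd_metric hs hd.ne]
  have e : ∀ r, Γ x r μ l * g x r ν + Γ x r ν l * g x μ r =
      (leviCivita g x r μ l * g x r ν + leviCivita g x r ν l * g x μ r)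
      + contortion (g x) (g x)⁻¹ (vol g x) F α w r μ l * g x r ν
      + contortion (g x) (g x)⁻¹ (vol g x) F α w r ν l * g x r μ
      + ((if r = μ then ξ l * g x r ν else 0) + (if r = ν then ξ l * g x μ r else 0)) := by
    intro r
    rw [hΓ, hΓ, hsx r μ]
    split_ifs <;> ring
  simp only [e, Finset.sum_add_distrib, h1, Finset.sum_ite_eq', Finset.mem_univ, if_true]
  ring

theorem weylVec_eq (l : Fin 4) : weylVec g Γ x l = 8 * ξ l := by
  have hinv : ∀ i j, ∑ k, ginv g x i k * g x k j = if i = j then 1 else 0 :=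
    fun i j => ginv_mul_sum hd.ne i j
  have e : ∀ μ, ∑ ν, ginv g x μ ν * nonmet g Γ x l μ ν = 2 * ξ l := by
    intro μ
    have : ∑ ν, ginv g x μ ν * nonmet g Γ x l μ ν = 2 * ξ l * ∑ ν, ginv g x μ ν * g x ν μ := by
      rw [Finset.mul_sum]
      exact Finset.sum_congr rfl fun ν _ => by
        rw [nonmet_eq hs hd hΓ, hs.self_of_nhds μ ν]; ring
    rw [this, hinv]
    simp
  simp only [weylVec, e, Finset.sum_const, Finset.card_univ, Fintype.card_fin, nsmul_eq_mul]
  push_cast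
  ring

theorem secondVec_eq (ν : Fin 4) : secondVec g Γ x ν = 2 * ξ ν := by
  have hinv : ∀ i j, ∑ k, ginv g x i k * g x k j = if i = j then 1 else 0 :=
    fun i j => ginv_mul_sum hd.ne i j
  have e : ∀ l, ∑ μ, ginv g x l μ * nonmet g Γ x l μ ν = 2 * ξ l * if l = ν then 1 else 0 := by
    intro l
    rw [← hinv, Finset.mul_sum]
    exact Finset.sum_congr rfl fun μ _ => by rw [nonmet_eq hs hd hΓ]; ring
  simp [secondVec, e]

theorem nonmetTraceless_eq_zero (l μ ν : Fin 4) : nonmetTraceless g Γ x l μ ν = 0 := by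
  simp only [nonmetTraceless, weylVec_eq hs hd hΓ, secondVec_eq hs hd hΓ, nonmet_eq hs hd hΓ]
  ring

omit hd in
theorem tors_eq (μ ν r : Fin 4) : tors Γ x μ ν r =
    1 / (6 * vol g x) * axialPart (g x) w r μ ν
      + ((if r = μ then 1 else 0) * (F / (12 * α) * w ν + ξ ν)
        - (if r = ν then 1 else 0) * (F / (12 * α) * w μ + ξ μ)) / 2 := by
  rw [tors, hΓ, hΓ, leviCivita_symm hs r μ ν, contortion, contortion, axialPart_swap w r μ ν,
    vectorPart, vectorPart, hs.self_of_nhds μ ν]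
  ring

omit hd in
theorem torsVec_eq (l : Fin 4) : torsVec Γ x l = -(3 / 2) * (F / (12 * α) * w l + ξ l) := by
  have h := sum_axialPart_trace (G := g x) (fun i j => hs.self_of_nhds i j) w l
  simp only [torsVec, tors_eq hs hΓ, Finset.sum_add_distrib, ← Finset.mul_sum, h,
    ← Finset.sum_div, Finset.sum_sub_distrib]
  simp
  ring

/-- The vector and projective parts of the lowered torsion contain the metric and die against ε. The
axial part yields −1/6 times the triple contraction −6, so the normalization 1/6 in `contortion`
makes w the torsion pseudo-vector. -/
theorem pseudoUp_eq (r : Fin 4) : pseudoUp g Γ x r = ∑ d, ginv g x r d * w d := by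
  have hv : vol g x ≠ 0 := (Real.sqrt_pos.2 (by linarith)).ne'
  have hsx := hs.self_of_nhds
  have hG : ∀ i j, g x j i = g x i j := fun i j => hsx i j
  have hGi : ∀ i j, (g x)⁻¹ j i = (g x)⁻¹ i j := fun i j => ginv_symm hsx i j
  have hinv : ∀ i j, ∑ k, (g x)⁻¹ i k * g x k j = if i = j then 1 else 0 :=
    fun i j => ginv_mul_sum hd.ne i j
  set c : Fin 4 → ℝ := fun μ => F / (12 * α) * w μ + ξ μ with hc
  set W : Fin 4 → ℝ := fun k => ∑ d, (g x)⁻¹ k d * w d with hW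
  have e1 : ∀ a b e, ∑ s, tors Γ x a b s * g x s e =
      -vol g x / 6 * (∑ k, symb e a b k * W k) + (g x a e * c b / 2 - g x b e * c a / 2) := by
    intro a b e
    have h1 := lower_axialPart hG hGi hinv w e a b
    have h2 : -vol g x / 6 * (∑ k, symb e a b k * W k) =
        1 / (6 * vol g x) * ((g x).det * ∑ k, symb e a b k * W k) := by
      rw [vol_sq hd]
      field_simp
    rw [h2, ← h1]
    have h3 : g x a e * c b / 2 - g x b e * c a / 2 =
        ∑ s, ((if s = a then 1 else 0) * c b - (if s = b then 1 else 0) * c a) / 2 * g x s e := by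
      simp only [sub_div, sub_mul, Finset.sum_sub_distrib, ite_mul, ite_div, zero_mul, one_mul,
        zero_div, Finset.sum_ite_eq', Finset.mem_univ, if_true]
      ring
    rw [h3, Finset.mul_sum, ← Finset.sum_add_distrib]
    refine Finset.sum_congr rfl fun s _ => ?_
    rw [tors_eq hs hΓ, hG s e]
    ring
  have e2 : ∀ a b e, epsUp g x r a b e * ∑ s, tors Γ x a b s * g x s e =
      -(1 / 6) * (∑ k, symb r a b e * symb e a b k * W k)
        + (1 / (2 * vol g x)) * (symb r a b e * g x a e * c b)
        - (1 / (2 * vol g x)) * (symb r a b e * g x b e * c a) := by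
    intro a b e
    have : ∑ k, symb r a b e * symb e a b k * W k = symb r a b e * ∑ k, symb e a b k * W k := by
      rw [Finset.mul_sum]
      exact Finset.sum_congr rfl fun k _ => by ring
    rw [e1, this, epsUp]
    field_simp
    ring
  have z1 : ∑ a, ∑ b, ∑ e, symb r a b e * g x a e * c b = 0 := by
    rw [Finset.sum_comm]
    refine Finset.sum_eq_zero fun b _ => ?_
    have := sum_antisymm_mul_symm (fun a e => symb r a b e * c b) (fun a e => g x a e)
      (fun i j => by
        rw [symb_swap₂₃ r b j i, symb_swap₃₄ r b i j, symb_swap₂₃ r i b j]; ring) hG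
    simpa only [mul_right_comm] using this
  have z2 : ∑ a, ∑ b, ∑ e, symb r a b e * g x b e * c a = 0 := by
    refine Finset.sum_eq_zero fun a _ => ?_
    have := sum_antisymm_mul_symm (fun b e => symb r a b e * c a) (fun b e => g x b e)
      (fun i j => by rw [symb_swap₃₄ r a i j]; ring) hG
    simpa only [mul_right_comm] using this
  have z3 : ∑ a, ∑ b, ∑ e, ∑ k, symb r a b e * symb e a b k * W k = -6 * W r := by
    calc _ = ∑ a, ∑ b, ∑ k, ∑ e, symb r a b e * symb e a b k * W k :=
          Finset.sum_congr rfl fun _ _ => Finset.sum_congr rfl fun _ _ => Finset.sum_comm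
      _ = ∑ a, ∑ k, ∑ b, ∑ e, symb r a b e * symb e a b k * W k :=
          Finset.sum_congr rfl fun _ _ => Finset.sum_comm
      _ = ∑ k, ∑ a, ∑ b, ∑ e, symb r a b e * symb e a b k * W k := Finset.sum_comm
      _ = ∑ k, (-6 * if r = k then 1 else 0) * W k := by
          refine Finset.sum_congr rfl fun k _ => ?_
          rw [← symb_contract_three r k]
          simp only [Finset.sum_mul]
      _ = -6 * W r := by simp
  simp only [pseudoUp, e2, Finset.sum_add_distrib, Finset.sum_sub_distrib, ← Finset.mul_sum, z1, z2,
    z3]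
  change _ = W r
  ring

theorem pseudoLow_eq (m : Fin 4) : pseudoLow g Γ x m = w m := by
  have hsx := hs.self_of_nhds
  simp only [pseudoLow, pseudoUp_eq hs hd hΓ]
  exact lower_raise (G := g x) (Gi := (g x)⁻¹) (fun i j => hsx i j) (fun i j => ginv_symm hsx i j)
    (fun i j => ginv_mul_sum hd.ne i j) w m

theorem sum_ginv_mul_epsLow (l m n : Fin 4) :
    ∑ k, ∑ r, ginv g x l k * epsLow g x k m n r * pseudoUp g Γ x r =
      1 / vol g x * axialPart (g x) w l m n := by
  have hv : vol g x ≠ 0 := (Real.sqrt_pos.2 (by linarith)).ne'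
  have hsx := hs.self_of_nhds
  rw [axialPart_eq (G := g x) (Gi := (g x)⁻¹) (fun i j => hsx i j) (fun i j => ginv_symm hsx i j)
    (fun i j => ginv_mul_sum hd.ne i j), vol_sq hd, ← mul_assoc,
    show 1 / vol g x * -vol g x ^ 2 = -vol g x by field_simp]
  simp only [pseudoUp_eq hs hd hΓ, epsLow_eq hd]
  rw [Finset.mul_sum]
  refine Finset.sum_congr rfl fun k _ => ?_
  change _ = -vol g x * (ginv g x l k * ∑ r, symb k m n r * ∑ d, ginv g x r d * w d)
  rw [Finset.mul_sum (a := ginv g x l k), Finset.mul_sum]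
  exact Finset.sum_congr rfl fun r _ => by ring

/-- By `tors_eq` the torsion is an axial term plus a trace term, and the pseudo-vector and torsion
vector just computed reproduce exactly these two. -/
theorem torsTraceless_eq_zero (l μ ν : Fin 4) : torsTraceless g Γ x l μ ν = 0 := by
  have hsx := hs.self_of_nhds
  have e : ∑ k, ∑ r, epsLow g x l μ k r * ginv g x k ν * pseudoUp g Γ x r =
      1 / vol g x * axialPart (g x) w ν l μ := by
    rw [← sum_ginv_mul_epsLow hs hd hΓ ν l μ]
    refine Finset.sum_congr rfl fun k _ => Finset.sum_congr rfl fun r _ => ?_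
    rw [epsLow_eq hd, epsLow_eq hd, symb_cycle l μ k r, ginv_symm hsx ν k]
    ring
  rw [torsTraceless, e, torsVec_eq hs hΓ, torsVec_eq hs hΓ, tors_eq hs hΓ]
  simp only [eq_comm (a := ν)]
  ring

end geometry

end MAG

end

noncomputable section

namespace MAG

open Filter Topology MeasureTheory

/-! ### The potential -/

section potential

variable {f : ℝ → ℝ} {I : Set ℝ} (hI : IsOpen I) (hf : ContDiffOn ℝ ∞ f I)
  (hf2 : ∀ r ∈ I, deriv (deriv f) r ≠ 0) (hinj : Set.InjOn (deriv f) I) {r : ℝ} (hr : r ∈ I)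

include hinj hr in
theorem invFunOn_deriv : Function.invFunOn (deriv f) I (deriv f r) = r :=
  hinj.leftInvOn_invFunOn hr

include hinj hr in
theorem potential_deriv : potential f I (deriv f r) = f r - deriv f r * r := by
  rw [potential, invFunOn_deriv hinj hr]

include hI hf hf2 hinj hr

/-- Since f'' ≠ 0, the inverse function theorem gives a smooth local inverse of f'. Injectivity on I
forces the globally chosen inverse to agree with it nearby. -/
theorem contDiffAt_invFunOn : ContDiffAt ℝ ∞ (Function.invFunOn (deriv f) I) (deriv f r) := by
  have hc := contDiffAt_deriv_of_contDiffOn hI hf hr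
  have hd : HasDerivAt (deriv f) (deriv (deriv f) r) r :=
    (hc.differentiableAt (by simp)).hasDerivAt
  let e : ℝ ≃L[ℝ] ℝ := ContinuousLinearEquiv.unitsEquivAut ℝ (Units.mk0 _ (hf2 r hr))
  have hd' : HasFDerivAt (deriv f) (e : ℝ →L[ℝ] ℝ) r := by
    have he : (e : ℝ →L[ℝ] ℝ) = ContinuousLinearMap.toSpanSingleton ℝ (deriv (deriv f) r) := by
      ext
      simp [e]
    rw [he]
    exact hd.hasFDerivAt
  have hσ := hc.to_localInverse hd' (by simp)
  refine hσ.congr_of_eventuallyEq ?_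
  have h1 : ∀ᶠ y in 𝓝 (deriv f r), deriv f (hc.localInverse hd' (by simp) y) = y :=
    (hc.hasStrictFDerivAt' hd' (by simp)).eventually_right_inverse
  have h2 : ∀ᶠ y in 𝓝 (deriv f r), hc.localInverse hd' (by simp) y ∈ I := by
    refine hσ.continuousAt.eventually_mem ?_
    rw [hc.localInverse_apply_image hd']
    exact hI.mem_nhds hr
  filter_upwards [h1, h2] with y hy1 hy2
  conv_lhs => rw [← hy1]
  exact invFunOn_deriv hinj hy2

theorem contDiffAt_potential : ContDiffAt ℝ ∞ (potential f I) (deriv f r) := by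
  have h := contDiffAt_invFunOn hI hf hf2 hinj hr
  refine ContDiffAt.sub ?_ (contDiffAt_id.mul h)
  refine ContDiffAt.comp (g := f) (deriv f r) ?_ h
  rw [invFunOn_deriv hinj hr]
  exact hf.contDiffAt (hI.mem_nhds hr)

/-- V is a Legendre transform: in V' = f'(χ) χ' − χ − ψ χ' the terms with χ' cancel because f'(χ(ψ))
= ψ. -/
theorem deriv_potential_deriv : deriv (potential f I) (deriv f r) = -r := by
  have h := ((contDiffAt_invFunOn hI hf hf2 hinj hr).differentiableAt (by simp)).hasDerivAt
  have hfr : HasDerivAt f (deriv f r) (Function.invFunOn (deriv f) I (deriv f r)) := by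
    rw [invFunOn_deriv hinj hr]
    exact ((hf.contDiffAt (hI.mem_nhds hr)).differentiableAt (by simp)).hasDerivAt
  have h1 := (HasDerivAt.comp (h₂ := f) (h := Function.invFunOn (deriv f) I) (deriv f r) hfr
    h).fun_sub ((hasDerivAt_id (deriv f r)).fun_mul h)
  have h2 : deriv (potential f I) (deriv f r) = _ := h1.deriv
  rw [h2, invFunOn_deriv hinj hr]
  simp

end potential

/-! ### The limit of small `α` -/

theorem lagBD_eq_lagST (κ : ℝ) (V : ℝ → ℝ) (g : MetricField) (Ψ : Pt → ℝ) (x : Pt) :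
    lagBD κ (-(3 / 2)) V g Ψ x = lagST κ 0 V g Ψ x := by
  have h : -(3 / 2) / Ψ x = -((3 / 2) * (Ψ x / (4 * 0 ^ 2 + Ψ x ^ 2))) := by
    -- At a zero of Ψ both quotients are 0 by convention, so the identity holds without a
    -- nonvanishing hypothesis.
    by_cases h0 : Ψ x = 0
    · simp [h0]
    · field_simp
      ring
  rw [lagBD, lagST, h]
  ring

/-- The coupling `a e` is part of the parameter, and Ψ ≠ 0 keeps the denominator positive even at
zero coupling. Hence smoothness extends through the Brans–Dicke point. -/
theorem SmoothMetricAt.lagST {E : Type*} [NormedAddCommGroup E] [NormedSpace ℝ E]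
    {g : E → MetricField} {Ψ : E → Pt → ℝ} {a : E → ℝ} {e : E} {x : Pt} (κ : ℝ) {V : ℝ → ℝ}
    (hg : SmoothMetricAt g e x) (hΨ : SmoothAt Ψ e x) (ha : ContDiffAt ℝ ∞ a e)
    (hV : ContDiffAt ℝ ∞ V (Ψ e x)) (h0 : Ψ e x ≠ 0) :
    SmoothAt (fun e => MAG.lagST κ (a e) V (g e) (Ψ e)) e x := by
  have ha' : SmoothAt (fun e (_ : Pt) => 4 * a e ^ 2) e x :=
    SmoothAt.of_param (contDiffAt_const.mul (ha.pow 2))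
  have hΨ2 : SmoothAt (fun e y => Ψ e y ^ 2) e x := ContDiffAt.pow hΨ 2
  exact (SmoothAt.const _).mul (hg.vol.mul (((hΨ.mul (hg.scal hg.leviCivita)).add
    (SmoothAt.comp (F := Ψ) hV hΨ)).add (((SmoothAt.const _).mul (hΨ.div (ha'.add hΨ2)
      (by positivity))).mul (hg.gradSq hΨ))))

section limit

variable {U : Set Pt} (hU : IsOpen U) {κ : ℝ} {V : ℝ → ℝ} {g h : MetricField} {Ψ ψ : Pt → ℝ}

include hU

theorem tendsto_lagST (hg : IsLorentzMetric U g) (hΨ : ContDiffOn ℝ ∞ Ψ U)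
    (hV : ∀ x ∈ U, ContDiffAt ℝ ∞ V (Ψ x)) (h0 : ∀ x ∈ U, Ψ x ≠ 0) {x : Pt} (hx : x ∈ U) :
    Tendsto (fun a => lagST κ a V g Ψ x) (𝓝[≠] 0) (𝓝 (lagBD κ (-(3 / 2)) V g Ψ x)) := by
  rw [lagBD_eq_lagST]
  have h := ((smoothMetricAt_const hU (0 : ℝ) hg hx).lagST κ (a := fun a => a)
    (SmoothAt.of_field (contDiffAt_of_contDiffOn hU hΨ hx)) contDiffAt_id (hV x hx) (h0 x hx)).param
  exact h.continuousAt.tendsto.mono_left nhdsWithin_le_nhds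

/-- The first variation is the integral of the parameter derivative of the density, which is
continuous jointly in a and x and supported in one compact set for all a. -/
theorem exists_tendsto_variation (hg : IsLorentzMetric U g) (hΨ : ContDiffOn ℝ ∞ Ψ U)
    (hV : ∀ x ∈ U, ContDiffAt ℝ ∞ V (Ψ x)) (h0 : ∀ x ∈ U, Ψ x ≠ 0)
    (hh : IsMetricVar U h) (hψ : IsTest U ψ) :
    ∃ v : ℝ → ℝ, (∀ a, HasFirstVariation U
        (fun t => lagST κ a V (g + t • h) (Ψ + t • ψ)) (v a)) ∧ Continuous v := by
  obtain ⟨K₁, hK₁, hK₁U, hh0⟩ := hh.exists_support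
  have hψ0 : ∀ x ∉ tsupport ψ, ψ x = 0 := fun x hx => image_eq_zero_of_notMem_tsupport hx
  have hK : IsCompact (K₁ ∪ tsupport ψ) := hK₁.union hψ.2.1
  have hKU : K₁ ∪ tsupport ψ ⊆ U := Set.union_subset hK₁U hψ.2.2
  have hsm : ∀ a : ℝ, ∀ x ∈ U, SmoothAt (fun p : ℝ × ℝ => lagST κ p.1 V (g + p.2 • h)
      (Ψ + p.2 • ψ)) (a, (0 : ℝ)) x := fun a x hx =>
    ((smoothMetricAt_var_zero hU hg hh hx).reparam (r := fun p : ℝ × ℝ => p.2) (e' := (a, 0))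
      contDiffAt_snd).lagST κ (SmoothAt.reparam (F := fun t : ℝ => Ψ + t • ψ)
        (r := fun p : ℝ × ℝ => p.2) (e' := (a, 0))
        (smoothAt_add_smul (contDiffAt_of_contDiffOn hU hΨ hx) hψ.1.contDiffAt 0) contDiffAt_snd)
      contDiffAt_fst (by simpa using hV x hx) (by simpa using h0 x hx)
  have hconst : ∀ a t : ℝ, ∀ x ∉ K₁ ∪ tsupport ψ,
      lagST κ a V (g + t • h) (Ψ + t • ψ) x = lagST κ a V g Ψ x := fun a t x hx =>
    lagST_congr κ a V (eventuallyEq_add_smul hK₁.isClosed hh0 (fun hx' => hx (Or.inl hx')) t)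
      (eventuallyEq_add_smul (isClosed_tsupport ψ) hψ0 (fun hx' => hx (Or.inr hx')) t)
  let D : ℝ → Pt → ℝ := fun a x => deriv (fun t : ℝ => lagST κ a V (g + t • h) (Ψ + t • ψ) x) 0
  have hD0 : ∀ a, ∀ x ∉ K₁ ∪ tsupport ψ, D a x = 0 := fun a x hx => by
    simp only [D, hconst a _ x hx, deriv_const]
  refine ⟨fun a => ∫ x in U, D a x, fun a => ?_, ?_⟩
  · refine hasFirstVariation_of_contDiffAt hK hKU
      (L := fun t => lagST κ a V (g + t • h) (Ψ + t • ψ))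
      (fun t x hx => by rw [hconst a t x hx, hconst a 0 x hx]) fun x hx => ?_
    have : SmoothAt (fun t : ℝ => lagST κ a V (g + t • h) (Ψ + t • ψ)) 0 x :=
      SmoothAt.reparam (r := fun t : ℝ => (a, t)) (hsm a x hx)
        (contDiffAt_const.prodMk contDiffAt_id)
    exact ContDiffAt.of_le this (by simp)
  · have e : (fun a => ∫ x in U, D a x) = fun a => ∫ x, D a x := by
      funext a
      exact setIntegral_eq_integral_of_forall_compl_eq_zero fun x hx => hD0 a x fun h => hx (hKU h)
    rw [e, ← continuousOn_univ]
    refine continuousOn_integral_of_compact_support hK ?_ fun a x _ hx => hD0 a x hx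
    rw [Set.univ_prod_univ, continuousOn_univ, continuous_iff_continuousAt]
    rintro ⟨a, x⟩
    by_cases hx : x ∈ K₁ ∪ tsupport ψ
    · exact (SmoothAt.deriv_param (L := fun a t => lagST κ a V (g + t • h) (Ψ + t • ψ))
        (hsm a x (hKU hx))).continuousAt
    · refine ContinuousAt.congr (f := fun _ => (0 : ℝ)) continuousAt_const ?_
      filter_upwards [continuousAt_snd.eventually_mem (hK.isClosed.isOpen_compl.mem_nhds hx)]
        with p hp using (hD0 p.1 p.2 hp).symm

end limit

end MAG

end

noncomputable section

namespace MAG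

open Filter Topology MeasureTheory

/-! ### Structure of the solutions and equivalence with the scalar-tensor theory -/

theorem isTest_zero (U : Set Pt) : IsTest U 0 :=
  ⟨contDiff_const, HasCompactSupport.zero, by simp [tsupport]⟩

theorem isMetricVar_zero (U : Set Pt) : IsMetricVar U 0 :=
  ⟨fun _ => Matrix.isSymm_zero, fun _ _ => isTest_zero U⟩

theorem isConnVar_zero (U : Set Pt) : IsConnVar U 0 := fun _ _ _ => isTest_zero U

section structureTheorem

variable {U : Set Pt} (hU : IsOpen U) {κ α : ℝ} {f : ℝ → ℝ} {I : Set ℝ} {g : MetricField}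
  {Γ : ConnField} {Ψ : Pt → ℝ} {ξ : OneForm} {x : Pt}

theorem projective_scalarConn_apply (hΓ : Γ x = projective (scalarConn α g Ψ) ξ x) (l m n : Fin 4) :
    Γ x l m n = leviCivita g x l m n
      + contortion (g x) (g x)⁻¹ (vol g x) (Ψ x) α (axialForm α Ψ x) l m n
      + (if l = m then 1 else 0) * ξ x n := by
  rw [hΓ]
  rfl

theorem projective_zero_apply (Γ : ConnField) (x : Pt) : Γ x = projective Γ 0 x := by
  funext l m n
  simp [projective]

theorem projective_projective (Γ : ConnField) (ξ ξ' : OneForm) :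
    projective (projective Γ ξ) ξ' = projective Γ (ξ + ξ') := by
  funext x l m n
  simp only [projective, Pi.add_apply]
  ring

theorem projective_congr {Γ' : ConnField} (hΓ : Γ x = Γ' x) (ξ : OneForm) :
    projective Γ ξ x = projective Γ' ξ x := by
  funext l m n
  simp only [projective, hΓ]

include hU

theorem metricCompatible_scalarConn (hg : IsLorentzMetric U g) :
    MetricCompatible U g (scalarConn α g Ψ) := fun x hx l μ ν => by
  rw [nonmet_eq (eventually_symm hU hg hx) (hg.det_neg hx)
    (projective_scalarConn_apply (projective_zero_apply (scalarConn α g Ψ) x))]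
  simp

/-- Metric compatibility fixes the projective gauge. -/
theorem eq_zero_of_metricCompatible (hg : IsLorentzMetric U g)
    (hΓ : ∀ x ∈ U, Γ x = projective (scalarConn α g Ψ) ξ x) (hm : MetricCompatible U g Γ)
    (hx : x ∈ U) : ξ x = 0 := by
  funext l
  have h := weylVec_eq (eventually_symm hU hg hx) (hg.det_neg hx)
    (projective_scalarConn_apply (hΓ x hx)) l
  simp only [weylVec, hm x hx, mul_zero, Finset.sum_const_zero] at h
  rw [Pi.zero_apply]
  linarith

/-- A projective shift changes the Weyl vector by 8 times itself, so the nonmetricity is removed by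
−ξ and by nothing else. -/
theorem existsUnique_gauge (hg : IsLorentzMetric U g) (hξ : SmoothForm U ξ)
    (hΓ : ∀ x ∈ U, Γ x = projective (scalarConn α g Ψ) ξ x) :
    ∃ ξ : OneForm, SmoothForm U ξ ∧ MetricCompatible U g (projective Γ ξ) ∧
      ∀ ξ' : OneForm, MetricCompatible U g (projective Γ ξ') → ∀ x ∈ U, ξ' x = ξ x := by
  have h : ∀ ξ' : OneForm, ∀ x ∈ U,
      projective Γ ξ' x = projective (scalarConn α g Ψ) (ξ + ξ') x := fun ξ' x hx => by
    rw [← projective_projective, projective_congr (hΓ x hx)]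
  refine ⟨-ξ, fun m => (hξ m).neg, fun x hx l μ ν => ?_, fun ξ' hm x hx => ?_⟩
  · rw [nonmet_eq (eventually_symm hU hg hx) (hg.det_neg hx)
      (projective_scalarConn_apply (h (-ξ) x hx))]
    simp
  · have := eq_zero_of_metricCompatible hU hg (h ξ') hm hx
    rw [Pi.add_apply] at this
    exact eq_neg_of_add_eq_zero_right this

omit hU in
theorem pd_arctan (hα : α ≠ 0) (hΨ : DifferentiableAt ℝ Ψ x) (m : Fin 4) :
    -3 * pd m (fun y => Real.arctan (Ψ y / (2 * α))) x = axialForm α Ψ x m := by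
  have hpos : Ψ x ^ 2 + 4 * α ^ 2 ≠ 0 := by positivity
  have e : pd m (fun y => (1 / (2 * α)) * Ψ y) x = 1 / (2 * α) * pd m Ψ x := pd_const_mul m _ hΨ
  have e' : (fun y => Real.arctan (Ψ y / (2 * α))) =
      fun y => Real.arctan ((1 / (2 * α)) * Ψ y) := by
    funext y
    congr 1
    ring
  rw [e', pd_comp m (φ := Real.arctan) (F := fun y => (1 / (2 * α)) * Ψ y)
    (Real.differentiableAt_arctan _) (hΨ.const_mul _), e, Real.deriv_arctan, axialForm]
  have h2 : 1 + (1 / (2 * α) * Ψ x) ^ 2 = (Ψ x ^ 2 + 4 * α ^ 2) / (4 * α ^ 2) := by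
    field_simp
    ring
  simp only [h2]
  field_simp
  ring

omit hU in
theorem pd_log (hα : α ≠ 0) (hΨ : DifferentiableAt ℝ Ψ x) (m : Fin 4) :
    3 / 8 * pd m (fun y => Real.log (Ψ y ^ 2 + 4 * α ^ 2)) x =
      -(3 / 2) * (Ψ x / (12 * α) * axialForm α Ψ x m) := by
  have hpos : Ψ x ^ 2 + 4 * α ^ 2 ≠ 0 := by positivity
  have hd : DifferentiableAt ℝ (fun r : ℝ => Real.log (r ^ 2 + 4 * α ^ 2)) (Ψ x) :=
    DifferentiableAt.log (by fun_prop) hpos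
  have h1 : HasDerivAt (fun r : ℝ => r ^ 2 + 4 * α ^ 2) (2 * Ψ x) (Ψ x) := by
    simpa using (hasDerivAt_pow 2 (Ψ x)).add_const (4 * α ^ 2)
  rw [pd_comp m (φ := fun r : ℝ => Real.log (r ^ 2 + 4 * α ^ 2)) hd hΨ, (h1.log hpos).deriv,
    axialForm]
  field_simp
  ring

theorem metricCompatible_structure (hα : α ≠ 0) (hg : IsLorentzMetric U g)
    (hΨ : ContDiffOn ℝ ∞ Ψ U) (hΓ : ∀ x ∈ U, Γ x = projective (scalarConn α g Ψ) ξ x)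
    (hm : MetricCompatible U g Γ) :
    ∃ Φ : Pt → ℝ, ContDiffOn ℝ ∞ Φ U ∧
      ∀ x ∈ U, Φ x ∈ Set.Ioo (-(Real.pi / 2)) (Real.pi / 2) ∧
        Ψ x = 2 * α * Real.tan (Φ x) ∧
        (∀ m, pseudoLow g Γ x m = -3 * pd m Φ x) ∧
        (∀ m, torsVec Γ x m = 3 / 8 * pd m (fun y => Real.log (Ψ y ^ 2 + 4 * α ^ 2)) x) ∧
        (∀ l μ ν, Γ x l μ ν = leviCivita g x l μ ν
          + 1 / 6 * (∑ k, ∑ r, ginv g x l k * epsLow g x k μ ν r * pseudoUp g Γ x r)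
          + Ψ x / (12 * α) * (g x μ ν * pseudoUp g Γ x l
              - (if l = ν then 1 else 0) * pseudoLow g Γ x μ)) := by
  -- Solves Ψ = 2 α tan Φ on the principal branch; α ≠ 0 makes it smooth everywhere.
  refine ⟨fun y => Real.arctan (Ψ y / (2 * α)),
    Real.contDiff_arctan.comp_contDiffOn (hΨ.div_const _), fun x hx => ?_⟩
  have hs := eventually_symm hU hg hx
  have hd := hg.det_neg hx
  have hΨx : DifferentiableAt ℝ Ψ x :=
    (contDiffAt_of_contDiffOn hU hΨ hx).differentiableAt (by simp)
  have hΓx := projective_scalarConn_apply (hΓ x hx)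
  have hξ : ∀ n, ξ x n = 0 := fun n =>
    congrFun (eq_zero_of_metricCompatible hU hg hΓ hm hx) n
  refine ⟨⟨Real.neg_pi_div_two_lt_arctan _, Real.arctan_lt_pi_div_two _⟩, ?_, fun m => ?_,
    fun m => ?_, fun l μ ν => ?_⟩
  · rw [Real.tan_arctan]
    field_simp
  · rw [pseudoLow_eq hs hd hΓx, pd_arctan hα hΨx]
  · rw [torsVec_eq hs hΓx, pd_log hα hΨx, hξ, add_zero]
  · rw [sum_ginv_mul_epsLow hs hd hΓx, pseudoLow_eq hs hd hΓx, pseudoUp_eq hs hd hΓx, hΓx, hξ,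
      mul_zero, add_zero, contortion, vectorPart]
    change _ + (_ + _ * (g x μ ν * ∑ d, ginv g x l d * axialForm α Ψ x d - _)) = _
    ring

end structureTheorem

/-! ### The on-shell equivalence of the two theories -/

section equivalence

variable {U : Set Pt} (hU : IsOpen U) {κ α : ℝ} (hκ : 0 < κ) (hα : α ≠ 0) {f : ℝ → ℝ} {I : Set ℝ}
  (hI : IsOpen I) (hf : ContDiffOn ℝ ∞ f I) (hf2 : ∀ r ∈ I, deriv (deriv f) r ≠ 0)
  (hinj : Set.InjOn (deriv f) I) {g : MetricField} {Γ : ConnField} {Ψ : Pt → ℝ}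

include hU hκ hα hI hf hf2 hinj

/-- The coefficient of ψ in the scalar-tensor variation is R + V'(Ψ) = R − R = 0. The metric part
equals the metric variation of the metric-affine action, since Γ is a projective transform of the
scalar connection. -/
theorem IsMAGSolution.isSTSolution (hsol : IsMAGSolution U κ α f I g Γ)
    (hne : ∀ x ∈ U, deriv f (scal g Γ x) ≠ 0) :
    IsSTSolution U κ α (potential f I) (deriv f '' I) g (fun x => deriv f (scal g Γ x)) := by
  obtain ⟨Ψ, hΨ⟩ : ∃ Ψ : Pt → ℝ, Ψ = fun y => deriv f (scal g Γ y) := ⟨_, rfl⟩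
  rw [← hΨ]
  have hg := hsol.metric
  have hΨs : ContDiffOn ℝ ∞ Ψ U := by
    rw [hΨ]; exact contDiffOn_deriv_scal hU hI hf hg hsol.conn hsol.range
  have hΨx : ∀ x, Ψ x = deriv f (scal g Γ x) := fun x => by rw [hΨ]
  obtain ⟨ξ, hξ, hΓ⟩ := hsol.exists_projective hU hα hI hf hκ hΨ
    (fun x hx => by rw [hΨ]; exact hne x hx)
  have hs := smoothConn_scalarConn hU hα hg hΨs
  refine ⟨hg, hΨs, fun x hx => ⟨_, hsol.range x hx, (hΨx x).symm⟩, fun h ψ hh hψ => ?_⟩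
  have h1 := hasFirstVariation_lagST (κ := κ) hU hα hg hΨs (V := potential f I)
    (fun x hx => by rw [hΨx]; exact contDiffAt_potential hI hf hf2 hinj (hsol.range x hx)) hh hψ
  have h2 := (hasFirstVariation_lagMAG (κ := κ) hU hα hI hf hg hsol.conn hsol.range hh
    (isConnVar_zero U) hΨ rfl).unique (hsol.stationary h 0 hh (isConnVar_zero U))
  convert h1 using 1
  rw [← h2]
  congr 1
  refine setIntegral_congr_fun hU.measurableSet fun x hx => ?_
  have e1 : scal g (scalarConn α g Ψ) x = scal g Γ x := by
    rw [scal_congr (g := g) (Γ := Γ) rfl (Filter.eventually_of_mem (hU.mem_nhds hx) hΓ),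
      scal_projective (hs.differentiableAt hU hx) (hξ.differentiableAt hU hx) (hg.symm hx)]
  have e2 : deriv (potential f I) (Ψ x) = -scal g Γ x := by
    rw [hΨx, deriv_potential_deriv hI hf hf2 hinj (hsol.range x hx)]
  have e3 : potential f I (Ψ x) = f (scal g Γ x) - Ψ x * scal g Γ x := by
    rw [hΨx, potential_deriv hinj (hsol.range x hx)]
  simp only [e1, e2, add_neg_cancel, mul_zero, zero_mul, add_zero, Pi.zero_apply,
    Finset.sum_const_zero]
  rw [metricDensity_congr (W' := fun y => potential f I (Ψ y)) hU hΓ hx rfl e3.symm, metricDensity_projective hU hg hs hξ hh _ _ hx]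

/-- The scalar field equation, obtained by varying Ψ alone, is R + V'(Ψ) = 0 for the curvature R of
the scalar connection, and V' = −χ. -/
theorem IsSTSolution.scal_eq (hsol : IsSTSolution U κ α (potential f I) (deriv f '' I) g Ψ) {x : Pt}
    (hx : x ∈ U) {r : ℝ} (hr : r ∈ I) (hrx : deriv f r = Ψ x) :
    scal g (scalarConn α g Ψ) x = r := by
  have hg := hsol.metric
  have hV : ∀ x ∈ U, ContDiffAt ℝ ∞ (potential f I) (Ψ x) := fun x hx => by
    obtain ⟨r, hr, hrx⟩ := hsol.range x hx
    rw [← hrx]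
    exact contDiffAt_potential hI hf hf2 hinj hr
  have hs := smoothConn_scalarConn hU hα hg hsol.scalar
  have h0 := eq_zero_of_integral_test hU
    (F := fun x => vol g x * (scal g (scalarConn α g Ψ) x + deriv (potential f I) (Ψ x)))
    (fun x hx => by
      have hg0 := smoothMetricAt_const hU (0 : ℝ) hg hx
      have hV' : ContinuousAt (deriv (potential f I)) (Ψ x) := by
        have h1 : ContDiffAt ℝ ∞ (fun r => fderiv ℝ (potential f I) r) (Ψ x) :=
          (hV x hx).fderiv_right (by simp)
        exact (h1.clm_apply (contDiffAt_const (c := (1 : ℝ)))).continuousAt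
      have hc : ContinuousAt (fun y => deriv (potential f I) (Ψ y)) x :=
        ContinuousAt.comp (g := deriv (potential f I)) hV'
          (contDiffAt_of_contDiffOn hU hsol.scalar hx).continuousAt
      exact (hg0.vol.field.continuousAt.mul ((hg0.scal
        (smoothConnAt_const hU (0 : ℝ) hs hx)).field.continuousAt.add hc)).continuousWithinAt)
    (fun φ hφ => by
      have h1 := (hasFirstVariation_lagST (κ := κ) hU hα hg hsol.scalar hV (isMetricVar_zero U)
        hφ).unique (hsol.stationary 0 φ (isMetricVar_zero U) hφ)
      simp only [metricDensity_zero, zero_add] at h1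
      have h3 : (1 / (2 * κ)) ≠ 0 := by positivity
      exact (mul_eq_zero.1 h1).resolve_left h3) x hx
  have hv := (smoothMetricAt_const hU (0 : ℝ) hg hx).vol_pos
  have h1 := (mul_eq_zero.1 h0).resolve_left hv.ne'
  rw [← hrx, deriv_potential_deriv hI hf hf2 hinj hr] at h1
  linarith

/-- The scalar field equation identifies Ψ with f'(R) on U. Then the deviation from the scalar
connection is zero, which gives the connection equation, and the metric variations coincide. -/
theorem IsSTSolution.isMAGSolution
    (hsol : IsSTSolution U κ α (potential f I) (deriv f '' I) g Ψ) :
    IsMAGSolution U κ α f I g (scalarConn α g Ψ) ∧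
      ∀ x ∈ U, deriv f (scal g (scalarConn α g Ψ) x) = Ψ x := by
  have hg := hsol.metric
  have hs := smoothConn_scalarConn hU hα hg hsol.scalar
  have hR : ∀ x ∈ U, scal g (scalarConn α g Ψ) x ∈ I ∧
      deriv f (scal g (scalarConn α g Ψ) x) = Ψ x := fun x hx => by
    obtain ⟨r, hr, hrx⟩ := hsol.range x hx
    rw [hsol.scal_eq hU hκ hα hI hf hf2 hinj hx hr hrx]
    exact ⟨hr, hrx⟩
  refine ⟨⟨hg, hs, fun x hx => (hR x hx).1, fun h γ hh hγ => ?_⟩, fun x hx => (hR x hx).2⟩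
  have hV : ∀ x ∈ U, ContDiffAt ℝ ∞ (potential f I) (Ψ x) := fun x hx => by
    rw [← (hR x hx).2]
    exact contDiffAt_potential hI hf hf2 hinj (hR x hx).1
  have h1 := hasFirstVariation_lagMAG (κ := κ) hU hα hI hf hg hs (fun x hx => (hR x hx).1) hh hγ
    rfl rfl
  have h2 := (hasFirstVariation_lagST (κ := κ) hU hα hg hsol.scalar hV hh (isTest_zero U)).unique
    (hsol.stationary h 0 hh (isTest_zero U))
  convert h1 using 1
  rw [← h2]
  congr 1
  refine setIntegral_congr_fun hU.measurableSet fun x hx => ?_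
  -- Ψ and f'(R) agree on U only. The scalar connection involves a derivative of Ψ, so equality near
  -- x is what transfers.
  have hev : Ψ =ᶠ[𝓝 x] fun y => deriv f (scal g (scalarConn α g Ψ) y) :=
    Filter.eventually_of_mem (hU.mem_nhds hx) fun y hy => (hR y hy).2.symm
  have e1 : scalarConn α g (fun y => deriv f (scal g (scalarConn α g Ψ) y)) x =
      scalarConn α g Ψ x := (scalarConn_congr α Filter.EventuallyEq.rfl hev).symm
  have e3 : potential f I (Ψ x) = f (scal g (scalarConn α g Ψ) x)
      - deriv f (scal g (scalarConn α g Ψ) x) * scal g (scalarConn α g Ψ) x := by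
    rw [← (hR x hx).2, potential_deriv hinj (hR x hx).1]
  simp only [e1, sub_self, Pi.zero_apply, mul_zero, add_zero]
  rw [metricDensity_congr (Ψ' := fun y => deriv f (scal g (scalarConn α g Ψ) y))
    (W' := fun y => f (scal g (scalarConn α g Ψ) y)
      - deriv f (scal g (scalarConn α g Ψ) y) * scal g (scalarConn α g Ψ) y)
    hU (fun _ _ => rfl) hx (hR x hx).2.symm e3]
  simp [bracket]

omit hf2 hinj in
theorem IsMAGSolution.exists_projective_of_deriv_eq (hne : ∀ x ∈ U, Ψ x ≠ 0)
    (hΓ : IsMAGSolution U κ α f I g Γ)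
    (hΓΨ : ∀ x ∈ U, deriv f (scal g Γ x) = Ψ x) :
    ∃ ξ, SmoothForm U ξ ∧ ∀ x ∈ U, Γ x = MAG.projective (scalarConn α g Ψ) ξ x := by
  obtain ⟨ξ, hξ, h⟩ := hΓ.exists_projective hU hα hI hf hκ rfl fun x hx => by
    rw [hΓΨ x hx]; exact hne x hx
  refine ⟨ξ, hξ, fun x hx => ?_⟩
  rw [h x hx]
  exact projective_congr (scalarConn_congr α Filter.EventuallyEq.rfl
    (Filter.eventually_of_mem (hU.mem_nhds hx) hΓΨ)) ξ

end equivalence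

end MAG

end

/-! ### Assembly of the four claims -/

theorem mainTheorem4 (U : Set MAG.Pt) (hU : IsOpen U) (κ α : ℝ) (hκ : 0 < κ) (hα : α ≠ 0)
    (f : ℝ → ℝ) (I : Set ℝ) (hI : IsOpen I) (hf : ContDiffOn ℝ ∞ f I) :
    -- projective invariance
    (∀ (g : MAG.MetricField) (Γ : MAG.ConnField) (ξ : MAG.OneForm),
      MAG.IsLorentzMetric U g → MAG.SmoothConn U Γ → MAG.SmoothForm U ξ →
      (∀ x ∈ U, MAG.scal g (MAG.projective Γ ξ) x = MAG.scal g Γ x) ∧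
      (∀ x ∈ U, MAG.lagMAG κ α f g (MAG.projective Γ ξ) x = MAG.lagMAG κ α f g Γ x) ∧
      (MAG.IsMAGSolution U κ α f I g Γ →
        MAG.IsMAGSolution U κ α f I g (MAG.projective Γ ξ))) ∧
    -- structure of the solutions, before and after fixing the projective gauge
    (∀ (g : MAG.MetricField) (Γ : MAG.ConnField), MAG.IsMAGSolution U κ α f I g Γ →
      (∀ x ∈ U, deriv f (MAG.scal g Γ x) ≠ 0) →
      (∀ x ∈ U, ∀ l μ ν, MAG.nonmetTraceless g Γ x l μ ν = 0 ∧
        MAG.torsTraceless g Γ x l μ ν = 0 ∧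
        MAG.nonmet g Γ x l μ ν = MAG.secondVec g Γ x l * g x μ ν) ∧
      (∃ ξ : MAG.OneForm, MAG.SmoothForm U ξ ∧
        MAG.MetricCompatible U g (MAG.projective Γ ξ) ∧
        ∀ ξ' : MAG.OneForm, MAG.MetricCompatible U g (MAG.projective Γ ξ') →
          ∀ x ∈ U, ξ' x = ξ x) ∧
      (MAG.MetricCompatible U g Γ →
        ∃ Φ : MAG.Pt → ℝ, ContDiffOn ℝ ∞ Φ U ∧
          ∀ x ∈ U, Φ x ∈ Set.Ioo (-(Real.pi / 2)) (Real.pi / 2) ∧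
            deriv f (MAG.scal g Γ x) = 2 * α * Real.tan (Φ x) ∧
            (∀ m, MAG.pseudoLow g Γ x m = -3 * MAG.pd m Φ x) ∧
            (∀ m, MAG.torsVec Γ x m = 3 / 8 * MAG.pd m
              (fun y => Real.log (deriv f (MAG.scal g Γ y) ^ 2 + 4 * α ^ 2)) x) ∧
            (∀ l μ ν, Γ x l μ ν = MAG.leviCivita g x l μ ν
              + 1 / 6 * (∑ k, ∑ r, MAG.ginv g x l k * MAG.epsLow g x k μ ν r *
                  MAG.pseudoUp g Γ x r)
              + deriv f (MAG.scal g Γ x) / (12 * α) *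
                (g x μ ν * MAG.pseudoUp g Γ x l
                  - (if l = ν then 1 else 0) * MAG.pseudoLow g Γ x μ)))) ∧
    -- equivalence with the scalar-tensor theory
    ((∀ r ∈ I, deriv (deriv f) r ≠ 0) → Set.InjOn (deriv f) I →
      -- from the metric-affine theory to the scalar-tensor theory
      (∀ (g : MAG.MetricField) (Γ : MAG.ConnField), MAG.IsMAGSolution U κ α f I g Γ →
        (∀ x ∈ U, deriv f (MAG.scal g Γ x) ≠ 0) →
        MAG.IsSTSolution U κ α (MAG.potential f I) (deriv f '' I) g
          (fun x => deriv f (MAG.scal g Γ x))) ∧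
      -- from the scalar-tensor theory to the metric-affine theory
      (∀ (g : MAG.MetricField) (Ψ : MAG.Pt → ℝ),
        MAG.IsSTSolution U κ α (MAG.potential f I) (deriv f '' I) g Ψ →
        (∀ x ∈ U, Ψ x ≠ 0) →
        ∃ Γ : MAG.ConnField, MAG.IsMAGSolution U κ α f I g Γ ∧
          MAG.MetricCompatible U g Γ ∧
          (∀ x ∈ U, deriv f (MAG.scal g Γ x) = Ψ x) ∧
          ∀ Γ' : MAG.ConnField, MAG.IsMAGSolution U κ α f I g Γ' →
            (∀ x ∈ U, deriv f (MAG.scal g Γ' x) = Ψ x) →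
            (∃ ξ : MAG.OneForm, MAG.SmoothForm U ξ ∧
              ∀ x ∈ U, Γ' x = MAG.projective Γ ξ x) ∧
            (MAG.MetricCompatible U g Γ' → ∀ x ∈ U, Γ' x = Γ x)) ∧
      -- small `α`: the Lagrangian and the first variation tend to those of Brans-Dicke theory
      (∀ (g : MAG.MetricField) (Ψ : MAG.Pt → ℝ), MAG.IsLorentzMetric U g →
        ContDiffOn ℝ ∞ Ψ U → (∀ x ∈ U, Ψ x ∈ deriv f '' I) → (∀ x ∈ U, Ψ x ≠ 0) →
        (∀ x ∈ U, Filter.Tendsto (fun a => MAG.lagST κ a (MAG.potential f I) g Ψ x)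
          (nhdsWithin 0 {0}ᶜ) (nhds (MAG.lagBD κ (-(3 / 2)) (MAG.potential f I) g Ψ x))) ∧
        (∀ (h : MAG.MetricField) (ψ : MAG.Pt → ℝ), MAG.IsMetricVar U h → MAG.IsTest U ψ →
          ∃ (v : ℝ → ℝ) (v₀ : ℝ),
            (∀ a, a ≠ 0 → MAG.HasFirstVariation U
              (fun t => MAG.lagST κ a (MAG.potential f I) (g + t • h) (Ψ + t • ψ)) (v a)) ∧
            MAG.HasFirstVariation U
              (fun t => MAG.lagBD κ (-(3 / 2)) (MAG.potential f I) (g + t • h) (Ψ + t • ψ)) v₀ ∧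
            Filter.Tendsto v (nhdsWithin 0 {0}ᶜ) (nhds v₀)))) := by
  refine ⟨fun g Γ ξ hg hΓ hξ => ⟨fun x hx => ?_, fun x hx => ?_, fun hsol => ?_⟩,
    fun g Γ hsol hne => ?_, fun hf2 hinj => ⟨fun g Γ hsol hne => ?_, fun g Ψ hsol hne => ?_,
      fun g Ψ hg hΨ hrange hne => ?_⟩⟩
  · exact MAG.scal_projective (hΓ.differentiableAt hU hx) (hξ.differentiableAt hU hx) (hg.symm hx)
  · exact MAG.lagMAG_projective (hΓ.differentiableAt hU hx) (hξ.differentiableAt hU hx)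
      (hg.symm hx) κ α f
  · exact hsol.projective hU hξ
  · obtain ⟨ξ, hξ, hΓ⟩ := hsol.exists_projective hU hα hI hf hκ rfl hne
    refine ⟨fun x hx l μ ν => ?_, MAG.existsUnique_gauge hU hsol.metric hξ hΓ,
      MAG.metricCompatible_structure hU hα hsol.metric
        (MAG.contDiffOn_deriv_scal hU hI hf hsol.metric hsol.conn hsol.range) hΓ⟩
    have hs := MAG.eventually_symm hU hsol.metric hx
    have hd := hsol.metric.det_neg hx
    have hΓx := MAG.projective_scalarConn_apply (hΓ x hx)
    refine ⟨MAG.nonmetTraceless_eq_zero hs hd hΓx l μ ν, MAG.torsTraceless_eq_zero hs hd hΓx l μ ν, ?_⟩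
    rw [MAG.nonmet_eq hs hd hΓx, MAG.secondVec_eq hs hd hΓx]
  · exact hsol.isSTSolution hU hκ hα hI hf hf2 hinj hne
  · obtain ⟨hMAG, hΨ⟩ := hsol.isMAGSolution hU hκ hα hI hf hf2 hinj
    refine ⟨MAG.scalarConn α g Ψ, hMAG, MAG.metricCompatible_scalarConn hU hsol.metric, hΨ,
      fun Γ' hΓ' hΨ' => ?_⟩
    obtain ⟨ξ, hξ, h⟩ := MAG.IsMAGSolution.exists_projective_of_deriv_eq hU hκ hα hI hf hne hΓ' hΨ'
    refine ⟨⟨ξ, hξ, h⟩, fun hm x hx => ?_⟩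
    have h0 := MAG.eq_zero_of_metricCompatible hU hsol.metric h hm hx
    rw [h x hx]
    funext l m n
    simp [MAG.projective, h0]
  · have hV : ∀ x ∈ U, ContDiffAt ℝ ∞ (MAG.potential f I) (Ψ x) := fun x hx => by
      obtain ⟨r, hr, hrx⟩ := hrange x hx
      rw [← hrx]
      exact MAG.contDiffAt_potential hI hf hf2 hinj hr
    refine ⟨fun x hx => MAG.tendsto_lagST hU hg hΨ hV hne hx, fun h ψ hh hψ => ?_⟩
    obtain ⟨v, hv, hc⟩ := MAG.exists_tendsto_variation (κ := κ) hU hg hΨ hV hne hh hψ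
    -- The variation v is defined and continuous at a = 0 as well, and its value there is the
    -- Brans–Dicke variation.
    refine ⟨v, v 0, fun a _ => hv a, ?_, (hc.tendsto 0).mono_left nhdsWithin_le_nhds⟩
    have e : (fun t : ℝ => MAG.lagBD κ (-(3 / 2)) (MAG.potential f I) (g + t • h) (Ψ + t • ψ)) =
        fun t : ℝ => MAG.lagST κ 0 (MAG.potential f I) (g + t • h) (Ψ + t • ψ) := by
      funext t x
      exact MAG.lagBD_eq_lagST κ _ _ _ x
    rw [e]
    exact hv 0
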